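/- Let $a:\mathbb R^d\to\mathbb R$ and $\mu:\mathbb R^d\times\mathbb R^d\times\mathbb R\to\mathbb R$ be measurable and satisfy: (C1) $a\ge 0$ and $\int_{\mathbb R^d}a(z)\,dz=1$; (C2) $\int_{\mathbb R^d}|z|^2a(z)\,dz<\infty$; (C3) there are $\mu^\pm>0$ with $\mu^-\le\mu(\xi,\eta,s)\le\mu^+$ for all $\xi,\eta,s$; (C4) $\mu$ is periodic with period one in each coordinate of $\xi$ and of $\eta$, and in $s$; (C5) $a(-z)=a(z)$ and $\mu(\xi,\eta,s)=\mu(\eta,\xi,s)$ for all $z,\xi,\eta,s$. For $\varepsilon>0$ put $$(\mathcal A^\varepsilon(t)v)(x)=\frac1{\varepsilon^{d+2}}\int_{\mathbb R^d}a\Big(\frac{x-y}\varepsilon\Big)\,\mu\Big(\frac x\varepsilon,\frac y\varepsilon,\frac t{\varepsilon^2}\Big)\big(v(y)-v(x)\big)\,dy .$$ A corrector is a vector function $\chi=(\chi_1,\dots,\chi_d)$, periodic with period one in $\xi$ and $s$, with $\chi_j\in L^\infty(0,1;L^2(\mathbb T^d))\cap H^1(\mathbb T;L^2(\mathbb T^d))$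 and $\int_0^1\int_{\mathbb T^d}\chi_j\,d\xi\,ds=0$, such that for $j=1,\dots,d$ $$\partial_s\chi_j(\xi,s)-\int_{\mathbb R^d}a(\xi-\eta)\mu(\xi,\eta,s)\big(\chi_j(\eta,s)-\chi_j(\xi,s)\big)d\eta=-\int_{\mathbb R^d}a(\xi-\eta)\mu(\xi,\eta,s)(\eta_j-\xi_j)\,d\eta .$$ A corrector exists. For a corrector $\chi$ let $a^{\rm eff}_{ij}=\frac12(\widehat a_{ij}+\widehat a_{ji})$, where $$\widehat a_{ij}=\int_0^1\int_{\mathbb T^d}\int_{\mathbb R^d}a(\xi-\eta)\mu(\xi,\eta,s)\Big(\tfrac12(\eta_i-\xi_i)(\eta_j-\xi_j)-(\eta_i-\xi_i)\chi_j(\eta,s)\Big)\,d\eta\,d\xi\,ds .$$ Then the matrix $a^{\rm eff}$ is positive definite, and for all $T>0$ and $u_0\in L^2(\mathbb R^d)$ the following holds. For each $\varepsilon>0$ the Cauchy problem $$\partial_tu^\varepsilon=\mathcal A^\varepsilon(t)u^\varepsilon,\qquad u^\varepsilon(\cdot,0)=u_0,$$ has a solution in $L^\infty(0,T;L^2(\mathbb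 R^d))$; the problem $$\partial_tu^0=\operatorname{div}\big(a^{\rm eff}\nabla u^0\big),\qquad u^0(\cdot,0)=u_0,$$ understood in the sense of distributions, has a solution in $L^\infty(0,T;L^2(\mathbb R^d))$; and for any such solutions $u^\varepsilon$ and $u^0$ $$\lim_{\varepsilon\to0}\|u^\varepsilon-u^0\|_{L^\infty(0,T;L^2(\mathbb R^d))}=0 .$$ -/

import Mathlib

open MeasureTheory Filter Topology Set
open scoped ContDiff

noncomputable section

namespace NonlocalHomogenization

/-- The space `ℝ^d` with its Euclidean norm. -/
abbrev Space (d : ℕ) : Type := EuclideanSpace ℝ (Fin d)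

/-- The real Hilbert space `L²(ℝ^d)`. -/
abbrev L2Space (d : ℕ) : Type := Lp ℝ 2 (volume : Measure (Space d))

/-- The real Hilbert space `L²(𝕋^d)`, where `𝕋^d = ℝ^d / ℤ^d` carries its Lebesgue
(probability) measure. -/
abbrev L2Torus (d : ℕ) : Type := Lp ℝ 2 (volume : Measure (UnitAddTorus (Fin d)))

/-- The projection `ℝ^d → 𝕋^d`; `β ∘ torusProj` is the periodic function on `ℝ^d` that is
identified with the function `β` on the torus. -/
def torusProj {d : ℕ} (ξ : Space d) : UnitAddTorus (Fin d) := fun i => (ξ i : UnitAddCircle)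

/-- The unit cell `[0,1)^d`. -/
def unitCell (d : ℕ) : Set (Space d) := {ξ | ∀ i, ξ i ∈ Ico (0 : ℝ) 1}

/-- The standing conditions on the convolution kernel `a` and the coefficient `μ(ξ, η, s)`. -/
structure Conditions {d : ℕ} (a : Space d → ℝ) (μ : Space d → Space d → ℝ → ℝ) : Prop where
  /-- Non-negativity and integrability of the kernel. -/
  kernel_nonneg : ∀ z, 0 ≤ a z
  kernel_integrable : Integrable a
  kernel_integral : ∫ z, a z = 1
  /-- Finite second moment. -/
  kernel_second_moment : Integrable (fun z => ‖z‖ ^ 2 * a z)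
  /-- Measurability and uniform ellipticity of the coefficient. -/
  coeff_measurable : Measurable (fun p : Space d × Space d × ℝ => μ p.1 p.2.1 p.2.2)
  coeff_elliptic : ∃ μmin μmax : ℝ, 0 < μmin ∧ 0 < μmax ∧
    ∀ ξ η s, μmin ≤ μ ξ η s ∧ μ ξ η s ≤ μmax
  /-- Periodicity, with period one in each coordinate of `ξ`, of `η`, and in `s`. -/
  coeff_periodic_left : ∀ (i : Fin d) ξ η s, μ (ξ + EuclideanSpace.single i 1) η s = μ ξ η s
  coeff_periodic_right : ∀ (i : Fin d) ξ η s, μ ξ (η + EuclideanSpace.single i 1) s = μ ξ η s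
  coeff_periodic_time : ∀ ξ η s, μ ξ η (s + 1) = μ ξ η s
  /-- Symmetry. -/
  kernel_even : ∀ z, a (-z) = a z
  coeff_symm : ∀ ξ η s, μ ξ η s = μ η ξ s

/-- The rescaled operator
`(𝒜^ε(t) v)(x) = ε^{-(d+2)} ∫ a((x-y)/ε) μ(x/ε, y/ε, t/ε²) (v(y) - v(x)) dy`. -/
def scaledOp {d : ℕ} (a : Space d → ℝ) (μ : Space d → Space d → ℝ → ℝ) (ε t : ℝ)
    (v : Space d → ℝ) (x : Space d) : ℝ :=
  1 / ε ^ (d + 2) *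
    ∫ y, a (ε⁻¹ • (x - y)) * μ (ε⁻¹ • x) (ε⁻¹ • y) (t / ε ^ 2) * (v y - v x)

/-- `u` is a solution in `L^∞(0,T; L²(ℝ^d))` of `∂_t u = 𝒜^ε(t) u`, `u(0) = u₀`: the time
derivative `g` of `u` (an integrable function with values in `L²(ℝ^d)`) satisfies
`g(t) = 𝒜^ε(t) u(t)` for a.e. `t`, and `u(t) = u₀ + ∫₀ᵗ g(s) ds` for a.e. `t`. -/
def IsScaledSolution {d : ℕ} (a : Space d → ℝ) (μ : Space d → Space d → ℝ → ℝ) (ε T : ℝ)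
    (u₀ : L2Space d) (u : ℝ → L2Space d) : Prop :=
  MemLp u ⊤ (volume.restrict (Ioo 0 T)) ∧
  ∃ g : ℝ → L2Space d, IntegrableOn g (Ioo 0 T) ∧
    (∀ᵐ t ∂volume.restrict (Ioo 0 T), ∀ᵐ x : Space d, g t x = scaledOp a μ ε t (u t) x) ∧
    (∀ᵐ t ∂volume.restrict (Ioo 0 T), u t = u₀ + ∫ s in (0 : ℝ)..t, g s)

/-- The differential operator `φ ↦ div(A ∇φ)` with a constant matrix `A`. -/
def divGrad {d : ℕ} (A : Matrix (Fin d) (Fin d) ℝ) (φ : Space d → ℝ) (x : Space d) : ℝ :=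
  ∑ i, fderiv ℝ
    (fun y => ∑ j, A i j * fderiv ℝ φ y (EuclideanSpace.single j 1)) x (EuclideanSpace.single i 1)

/-- `u` is a (distributional) solution in `L^∞(0,T; L²(ℝ^d))` of `∂_t u = div(A ∇u)`,
`u(0) = u₀`, for a constant matrix `A`: for every test function `φ ∈ C_c^∞(ℝ^d)`,
`(u(t), φ) = (u₀, φ) + ∫₀ᵗ (u(s), div(Aᵀ ∇φ)) ds` for a.e. `t ∈ (0,T)`. -/
def IsDiffusionSolution {d : ℕ} (A : Matrix (Fin d) (Fin d) ℝ) (T : ℝ)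
    (u₀ : L2Space d) (u : ℝ → L2Space d) : Prop :=
  MemLp u ⊤ (volume.restrict (Ioo 0 T)) ∧
  ∀ φ : Space d → ℝ, ContDiff ℝ ∞ φ → HasCompactSupport φ →
    ∀ᵐ t ∂volume.restrict (Ioo 0 T),
      ∫ x, u t x * φ x =
        (∫ x, u₀ x * φ x) + ∫ s in (0 : ℝ)..t, ∫ x, u s x * divGrad A.transpose φ x

/-- The operator `(𝒜(s) β)(ξ) = ∫ a(ξ-η) μ(ξ, η, s) (β(η) - β(ξ)) dη` on functions on `ℝ^d`. -/
def cellOp {d : ℕ} (a : Space d → ℝ) (μ : Space d → Space d → ℝ → ℝ) (s : ℝ)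
    (β : Space d → ℝ) (ξ : Space d) : ℝ :=
  ∫ η, a (ξ - η) * μ ξ η s * (β η - β ξ)

/-- `χ = (χ_1, …, χ_d)`, `χ_j(s) ∈ L²(𝕋^d)`, is the corrector: each `χ_j` is `1`-periodic in `s`,
lies in `L^∞(0,1; L²(𝕋^d))` and in `H¹(𝕋; L²(𝕋^d))` (with time derivative `g`), satisfies
`∂_s χ_j(ξ,s) - (𝒜(s) χ_j)(ξ,s) = -∫ a(ξ-η) μ(ξ,η,s) (η_j - ξ_j) dη`
for a.e. `s` and a.e. `ξ`, and has mean zero over `𝕋^{d+1}`. -/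
def IsCorrector {d : ℕ} (a : Space d → ℝ) (μ : Space d → Space d → ℝ → ℝ)
    (χ : Fin d → ℝ → L2Torus d) : Prop :=
  ∀ j : Fin d,
    Function.Periodic (χ j) 1 ∧
    MemLp (χ j) ⊤ (volume.restrict (Ioo 0 1)) ∧
    (∃ g : ℝ → L2Torus d, MemLp g 2 (volume.restrict (Ioo 0 1)) ∧
      (∀ s ∈ Icc (0 : ℝ) 1, χ j s = χ j 0 + ∫ r in (0 : ℝ)..s, g r) ∧
      (∀ᵐ s ∂volume.restrict (Ioo (0 : ℝ) 1), ∀ᵐ ξ : Space d,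
        g s (torusProj ξ) - cellOp a μ s (fun η => χ j s (torusProj η)) ξ =
          -∫ η, a (ξ - η) * μ ξ η s * (η j - ξ j))) ∧
    ∫ s in (0 : ℝ)..1, ∫ x, χ j s x = 0

/-- The matrix
`â_ij = ∫₀¹ ∫_{𝕋^d} ∫_{ℝ^d} a(ξ-η) μ(ξ,η,s) (½(η_i-ξ_i)(η_j-ξ_j) - (η_i-ξ_i) χ_j(η,s)) dη dξ ds`. -/
def preEffMatrix {d : ℕ} (a : Space d → ℝ) (μ : Space d → Space d → ℝ → ℝ)
    (χ : Fin d → ℝ → L2Torus d) : Matrix (Fin d) (Fin d) ℝ :=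
  Matrix.of fun i j => ∫ s in (0 : ℝ)..1, ∫ ξ in unitCell d, ∫ η,
    a (ξ - η) * μ ξ η s *
      (1 / 2 * (η i - ξ i) * (η j - ξ j) - (η i - ξ i) * χ j s (torusProj η))

/-- The effective matrix `a^eff_ij = ½ (â_ij + â_ji)`. -/
def effMatrix {d : ℕ} (a : Space d → ℝ) (μ : Space d → Space d → ℝ → ℝ)
    (χ : Fin d → ℝ → L2Torus d) : Matrix (Fin d) (Fin d) ℝ :=
  Matrix.of fun i j => 1 / 2 * (preEffMatrix a μ χ i j + preEffMatrix a μ χ j i)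

end NonlocalHomogenization

end

open MeasureTheory Filter Topology Set
open scoped ContDiff

noncomputable section

set_option linter.unusedSectionVars false

/-! The rescaled operator describes symmetric jumps. Pairing it with `f` and averaging the jumps `z`
and `-z` gives minus one half of a Dirichlet form (`JumpKernel.inner_gen`), so it is bounded and
dissipative on L². Hence any function of time whose residual in the rescaled equation is small in
L², uniformly in time, stays close to the exact solution (`IsScaledSolution.norm_sub_le`). It
remains to construct such functions.

With `c_j = -χ_j` the ansatz is `w = P(v, 1) + ε ∑ P(∂_j v, c_j(t/ε²)) + ε² ∑ P(∂_i ∂_j v,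
κ_ij(t/ε²))`. Expand the slow factor to second order under a jump of size `εz`. The terms of order
`ε⁻¹` cancel by the corrector equation. Those of order one cancel if `κ_ij` solves a second cell
problem and `∂_t v = ∑ â_ij ∂_i ∂_j v`. That cell problem has a periodic solution because its
right-hand side has zero space-time mean, which is what the formula for `â_ij` expresses
(`preEffMatrix_eq`). The Hessian is symmetric, so only the symmetric part of `â` acts on `v`.

Two points need care. Correctors are only L² in the fast variable, so `v(x) χ(x/ε)` need not lie in
L². The product `P = cellProduct` first averages the slow factor over a cell of size `ε`; then
`‖P(v, χ)‖ ≤ ‖v‖ ‖χ‖`, and `P` still intertwines the jumps on the space with those on the torus.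
Moreover the kernel has only two moments. The Taylor remainders are therefore bounded by `|h|^k
min(1, |h|)` with `k ≤ 2`, and dominated convergence gives smallness without a rate. This yields
`exists_ansatz_rate`.

The cell problems are solved as fixed points of the period map, a contraction thanks to a nonlocal
Poincaré inequality on the torus (`exists_spectral_gap`). That inequality holds because the symbol
`∫ a(z) |e_n(z) - 1|² dz` is positive for `n ≠ 0` and tends to 2 by Riemann–Lebesgue. Positive
definiteness follows from completing a square: up to a term that integrates to zero over a period,
`∑ p_i p_j â_ij` is the mean of half the energy of `p·z - (C(ξ-z) - C(ξ))`, where `C = ∑ p_j c_j`.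
Its mean over the torus is `p·z` for every jump, so it cannot be small.

For general data, `v` is taken band-limited, where the diffusion is the flow of a bounded operator
and all Taylor bounds are bounds on Fourier multipliers. Such data are dense in L². Weak solutions
of the effective problem are contractive in the data (`IsDiffusionSolution.norm_le`, proved by
mollification), so both `u^ε` and `u⁰` are compared with the same `v`. -/

namespace NonlocalHomogenization

/-! ### Linear evolution equations with bounded operators in a Hilbert space -/

section AbstractEvolution

/-- Product rule for primitives of integrable functions, in integrated form. -/
theorem bilin_primitive {E F G : Type*} [NormedAddCommGroup E] [NormedSpace ℝ E] [CompleteSpace E]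
    [NormedAddCommGroup F] [NormedSpace ℝ F] [CompleteSpace F]
    [NormedAddCommGroup G] [NormedSpace ℝ G] [CompleteSpace G]
    (B : E →L[ℝ] F →L[ℝ] G) {f : ℝ → E} {g : ℝ → F} {t : ℝ} (ht : 0 ≤ t)
    (hf : IntervalIntegrable f volume 0 t) (hg : IntervalIntegrable g volume 0 t) (x₀ : E) (y₀ : F) :
    B (x₀ + ∫ s in (0 : ℝ)..t, f s) (y₀ + ∫ s in (0 : ℝ)..t, g s) = B x₀ y₀ +
      ∫ s in (0 : ℝ)..t, (B (f s) (y₀ + ∫ r in (0 : ℝ)..s, g r) +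
        B (x₀ + ∫ r in (0 : ℝ)..s, f r) (g s)) := by
  have hsub : ∀ s ∈ Ioc 0 t, uIcc 0 s ⊆ uIcc 0 t := fun s hs => by
    rw [uIcc_of_le ht, uIcc_of_le hs.1.le]; exact Icc_subset_Icc_right hs.2
  have hcg : ContinuousOn (fun s => ∫ r in (0 : ℝ)..s, g r) (uIcc 0 t) :=
    intervalIntegral.continuousOn_primitive_interval (by
      rw [uIcc_of_le ht, integrableOn_Icc_iff_integrableOn_Ioc]
      exact (intervalIntegrable_iff_integrableOn_Ioc_of_le ht).1 hg)
  have hcf : ContinuousOn (fun s => ∫ r in (0 : ℝ)..s, f r) (uIcc 0 t) :=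
    intervalIntegral.continuousOn_primitive_interval (by
      rw [uIcc_of_le ht, integrableOn_Icc_iff_integrableOn_Ioc]
      exact (intervalIntegrable_iff_integrableOn_Ioc_of_le ht).1 hf)
  have hf' := (intervalIntegrable_iff_integrableOn_Ioc_of_le ht).1 hf
  have hg' := (intervalIntegrable_iff_integrableOn_Ioc_of_le ht).1 hg
  -- integrability of products with continuous functions
  have key1 : ∀ {y : ℝ → F}, ContinuousOn y (uIcc 0 t) →
      IntegrableOn (fun s => B (f s) (y s)) (Ioc 0 t) := by
    intro y hy
    have hyI : AEStronglyMeasurable y (volume.restrict (Ioc 0 t)) :=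
      (hy.mono (by rw [uIcc_of_le ht]; exact Ioc_subset_Icc_self)).aestronglyMeasurable
        measurableSet_Ioc
    obtain ⟨C, hC⟩ := isCompact_uIcc.exists_bound_of_continuousOn hy
    refine Integrable.mono' (hf'.norm.const_mul (‖B‖ * C))
      (B.aestronglyMeasurable_comp₂ hf'.aestronglyMeasurable hyI) ?_
    refine (ae_restrict_iff' measurableSet_Ioc).2 (ae_of_all _ fun s hs => ?_)
    have hs' : s ∈ uIcc 0 t := by rw [uIcc_of_le ht]; exact Ioc_subset_Icc_self hs
    calc ‖B (f s) (y s)‖ ≤ ‖B‖ * ‖f s‖ * ‖y s‖ := B.le_opNorm₂ _ _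
      _ ≤ ‖B‖ * ‖f s‖ * C := by gcongr; exact hC s hs'
      _ = ‖B‖ * C * ‖f s‖ := by ring
  have key2 : ∀ {y : ℝ → E}, ContinuousOn y (uIcc 0 t) →
      IntegrableOn (fun s => B (y s) (g s)) (Ioc 0 t) := by
    intro y hy
    have hyI : AEStronglyMeasurable y (volume.restrict (Ioc 0 t)) :=
      (hy.mono (by rw [uIcc_of_le ht]; exact Ioc_subset_Icc_self)).aestronglyMeasurable
        measurableSet_Ioc
    obtain ⟨C, hC⟩ := isCompact_uIcc.exists_bound_of_continuousOn hy
    refine Integrable.mono' (hg'.norm.const_mul (‖B‖ * C))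
      (B.aestronglyMeasurable_comp₂ hyI hg'.aestronglyMeasurable) ?_
    refine (ae_restrict_iff' measurableSet_Ioc).2 (ae_of_all _ fun s hs => ?_)
    have hs' : s ∈ uIcc 0 t := by rw [uIcc_of_le ht]; exact Ioc_subset_Icc_self hs
    calc ‖B (y s) (g s)‖ ≤ ‖B‖ * ‖y s‖ * ‖g s‖ := B.le_opNorm₂ _ _
      _ ≤ ‖B‖ * C * ‖g s‖ := by gcongr; exact hC s hs'
  -- The square `(0,t]²` is cut along its diagonal. By Fubini on the triangle `s < r`, the second
  -- summand equals the integral of `B (f s) (∫ r in s..t, g r)`, which completes the first summand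
  -- to an integral over all of `(0,t]`.
  have fub : B (∫ s in (0 : ℝ)..t, f s) (∫ s in (0 : ℝ)..t, g s) =
      ∫ s in Ioc 0 t, (B (f s) (∫ r in (0 : ℝ)..s, g r) + B (∫ r in (0 : ℝ)..s, f r) (g s)) := by
    set ν := volume.restrict (Ioc 0 t) with hν
    have hint : Integrable (fun p : ℝ × ℝ => B (f p.1) (g p.2)) (ν.prod ν) := by
      refine Integrable.mono' ((Integrable.mul_prod hf'.norm hg'.norm).const_mul ‖B‖)
        (B.aestronglyMeasurable_comp₂ hf'.aestronglyMeasurable.comp_fst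
          hg'.aestronglyMeasurable.comp_snd) (ae_of_all _ fun p => ?_)
      calc _ ≤ ‖B‖ * ‖f p.1‖ * ‖g p.2‖ := B.le_opNorm₂ _ _
        _ = _ := by ring
    have hS : MeasurableSet {p : ℝ × ℝ | p.1 < p.2} := measurableSet_lt measurable_fst measurable_snd
    have hint' : Integrable ({p : ℝ × ℝ | p.1 < p.2}.indicator
        fun p : ℝ × ℝ => B (f p.1) (g p.2)) (ν.prod ν) := hint.indicator hS
    have swap : ∫ s in Ioc 0 t, B (f s) (∫ r in s..t, g r) =
        ∫ s in Ioc 0 t, B (∫ r in (0 : ℝ)..s, f r) (g s) := by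
      have e1 : ∫ s in Ioc 0 t, B (f s) (∫ r in s..t, g r) = ∫ s, ∫ r,
          ({p : ℝ × ℝ | p.1 < p.2}.indicator fun p : ℝ × ℝ => B (f p.1) (g p.2)) (s, r) ∂ν ∂ν := by
        refine setIntegral_congr_fun measurableSet_Ioc fun s hs => ?_
        have : (fun r => ({p : ℝ × ℝ | p.1 < p.2}.indicator
            fun p : ℝ × ℝ => B (f p.1) (g p.2)) (s, r)) =
            (Ioi s).indicator fun r => B (f s) (g r) := by
          ext r; simp only [indicator, mem_ofPred_eq, mem_Ioi]
        simp only [this]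
        rw [integral_indicator measurableSet_Ioi, hν, Measure.restrict_restrict measurableSet_Ioi,
          intervalIntegral.integral_of_le hs.2]
        have hset : Ioi s ∩ Ioc 0 t = Ioc s t := by
          ext r; simp only [mem_inter_iff, mem_Ioi, mem_Ioc]
          exact ⟨fun h => ⟨h.1, h.2.2⟩, fun h => ⟨h.1, hs.1.trans h.1, h.2⟩⟩
        rw [hset, ContinuousLinearMap.integral_comp_comm]
        exact hg'.mono_set (Ioc_subset_Ioc_left hs.1.le)
      have e2 : ∫ s in Ioc 0 t, B (∫ r in (0 : ℝ)..s, f r) (g s) = ∫ r, ∫ s,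
          ({p : ℝ × ℝ | p.1 < p.2}.indicator fun p : ℝ × ℝ => B (f p.1) (g p.2)) (s, r) ∂ν ∂ν := by
        refine setIntegral_congr_fun measurableSet_Ioc fun r hr => ?_
        have : (fun s => ({p : ℝ × ℝ | p.1 < p.2}.indicator
            fun p : ℝ × ℝ => B (f p.1) (g p.2)) (s, r)) =
            (Iio r).indicator fun s => B.flip (g r) (f s) := by
          ext s; simp only [indicator, mem_ofPred_eq, mem_Iio, ContinuousLinearMap.flip_apply]
        simp only [this]
        rw [integral_indicator measurableSet_Iio, hν, Measure.restrict_restrict measurableSet_Iio,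
          intervalIntegral.integral_of_le hr.1.le]
        have hset : Iio r ∩ Ioc 0 t = Ioo 0 r := by
          ext s; simp only [mem_inter_iff, mem_Iio, mem_Ioc, mem_Ioo]
          exact ⟨fun h => ⟨h.2.1, h.1⟩, fun h => ⟨h.2, h.1, (h.2.trans_le hr.2).le⟩⟩
        rw [hset, ← integral_Ioc_eq_integral_Ioo, ContinuousLinearMap.integral_comp_comm]
        · rfl
        · exact hf'.mono_set (Ioc_subset_Ioc_right hr.2)
      rw [e1, e2]
      exact integral_integral_swap hint'
    have hconst : ContinuousOn (fun s => ∫ r in s..t, g r) (uIcc 0 t) := by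
      have : EqOn (fun s => ∫ r in s..t, g r)
          (fun s => (∫ r in (0 : ℝ)..t, g r) - ∫ r in (0 : ℝ)..s, g r) (uIcc 0 t) := by
        intro s hs
        have hs1 : IntervalIntegrable g volume 0 s :=
          hg.mono_set (uIcc_subset_uIcc left_mem_uIcc hs)
        have hs2 : IntervalIntegrable g volume s t :=
          hg.mono_set (uIcc_subset_uIcc hs right_mem_uIcc)
        simp [← intervalIntegral.integral_add_adjacent_intervals hs1 hs2]
      exact (continuousOn_const.sub hcg).congr this
    rw [integral_add (key1 hcg) (key2 hcf), ← swap, ← integral_add (key1 hcg) (key1 hconst)]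
    have : ∀ s ∈ Ioc 0 t, B (f s) (∫ r in (0 : ℝ)..s, g r) + B (f s) (∫ r in s..t, g r) =
        B.flip (∫ r in (0 : ℝ)..t, g r) (f s) := by
      intro s hs
      have hs' : s ∈ uIcc 0 t := by rw [uIcc_of_le ht]; exact Ioc_subset_Icc_self hs
      rw [← map_add, intervalIntegral.integral_add_adjacent_intervals
        (hg.mono_set (uIcc_subset_uIcc left_mem_uIcc hs'))
        (hg.mono_set (uIcc_subset_uIcc hs' right_mem_uIcc))]
      rfl
    rw [setIntegral_congr_fun measurableSet_Ioc this, ContinuousLinearMap.integral_comp_comm _ hf',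
      ← intervalIntegral.integral_of_le ht]
    rfl
  have expand : ∀ s, B (f s) (y₀ + ∫ r in (0 : ℝ)..s, g r) + B (x₀ + ∫ r in (0 : ℝ)..s, f r) (g s) =
      (B.flip y₀ (f s) + B x₀ (g s)) +
      (B (f s) (∫ r in (0 : ℝ)..s, g r) + B (∫ r in (0 : ℝ)..s, f r) (g s)) := by
    intro s
    simp only [map_add, add_apply, ContinuousLinearMap.flip_apply]
    abel
  simp only [expand]
  have i1 : IntegrableOn (fun s => B.flip y₀ (f s)) (Ioc 0 t) := (B.flip y₀).integrable_comp hf'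
  have i2 : IntegrableOn (fun s => B x₀ (g s)) (Ioc 0 t) := (B x₀).integrable_comp hg'
  have i12 : IntegrableOn (fun s => B.flip y₀ (f s) + B x₀ (g s)) (Ioc 0 t) := i1.add i2
  have i34 : IntegrableOn (fun s => B (f s) (∫ r in (0 : ℝ)..s, g r) +
      B (∫ r in (0 : ℝ)..s, f r) (g s)) (Ioc 0 t) := (key1 hcg).add (key2 hcf)
  have e : ∫ s in (0 : ℝ)..t, ((B.flip y₀ (f s) + B x₀ (g s)) +
      (B (f s) (∫ r in (0 : ℝ)..s, g r) + B (∫ r in (0 : ℝ)..s, f r) (g s))) =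
      (B.flip y₀ (∫ s in (0 : ℝ)..t, f s) + B x₀ (∫ s in (0 : ℝ)..t, g s)) +
        B (∫ s in (0 : ℝ)..t, f s) (∫ s in (0 : ℝ)..t, g s) := by
    rw [fub, intervalIntegral.integral_of_le ht, integral_add i12 i34, integral_add i1 i2,
      ContinuousLinearMap.integral_comp_comm _ hf', ContinuousLinearMap.integral_comp_comm _ hg',
      ← intervalIntegral.integral_of_le ht, ← intervalIntegral.integral_of_le ht]
  rw [e]
  simp only [map_add, add_apply, ContinuousLinearMap.flip_apply]
  abel

variable {H : Type*} [NormedAddCommGroup H] [InnerProductSpace ℝ H] [CompleteSpace H]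

/-- A family of bounded operators, strongly measurable and uniformly bounded in time. -/
structure BddFamily (A : ℝ → H →L[ℝ] H) (C : ℝ) : Prop where
  meas : ∀ x, StronglyMeasurable fun s => A s x
  bound : ∀ s, ‖A s‖ ≤ C

/-- A Carathéodory argument: continuity in the vector and strong measurability in time give joint
measurability on a separable space. -/
theorem BddFamily.comp [SecondCountableTopology H] {A : ℝ → H →L[ℝ] H} {C : ℝ} (hA : BddFamily A C)
    {x : ℝ → H} (hx : StronglyMeasurable x) : StronglyMeasurable fun s => A s (x s) := by
  borelize H
  have := stronglyMeasurable_uncurry_of_continuous_of_stronglyMeasurable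
    (u := fun (y : H) (s : ℝ) => A s y) (fun s => (A s).continuous) hA.meas
  exact this.comp_measurable (hx.measurable.prodMk measurable_id)

theorem BddFamily.norm_le {A : ℝ → H →L[ℝ] H} {C : ℝ} (hA : BddFamily A C) (s : ℝ) (x : H) :
    ‖A s x‖ ≤ C * ‖x‖ := (A s).le_of_opNorm_le (hA.bound s) x

theorem BddFamily.nonneg {A : ℝ → H →L[ℝ] H} {C : ℝ} (hA : BddFamily A C) : 0 ≤ C :=
  (norm_nonneg _).trans (hA.bound 0)

theorem intervalIntegrable_of_bounded {E : Type*} [NormedAddCommGroup E] {f : ℝ → E}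
    (hf : StronglyMeasurable f) {a b M : ℝ} (hM : ∀ s ∈ uIcc a b, ‖f s‖ ≤ M) :
    IntervalIntegrable f volume a b := by
  rw [intervalIntegrable_iff]
  refine IntegrableOn.of_bound (by simp) hf.aestronglyMeasurable M
    ((ae_restrict_iff' measurableSet_uIoc).2 (ae_of_all _ fun s hs => hM s (uIoc_subset_uIcc hs)))

/-- Linear evolution equations with bounded measurable coefficients are solvable. -/
theorem exists_evolution [SecondCountableTopology H] {A : ℝ → H →L[ℝ] H} {C : ℝ}
    (hA : BddFamily A C) {F : ℝ → H} (hF : StronglyMeasurable F) {M : ℝ} (hM : ∀ s, ‖F s‖ ≤ M)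
    (x₀ : H) :
    ∃ x : ℝ → H, Continuous x ∧ ∀ t, x t = x₀ + ∫ s in (0 : ℝ)..t, (A s (x s) + F s) := by
  have hC := hA.nonneg
  have hM0 : 0 ≤ M := (norm_nonneg _).trans (hM 0)
  have hii : ∀ {y : ℝ → H}, Continuous y → ∀ a b,
      IntervalIntegrable (fun s => A s (y s) + F s) volume a b := by
    intro y hy a b
    obtain ⟨N, hN⟩ := (isCompact_uIcc (a := a) (b := b)).exists_bound_of_continuousOn hy.continuousOn
    refine intervalIntegrable_of_bounded (M := C * N + M) ((hA.comp hy.stronglyMeasurable).add hF) fun s hs => ?_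
    refine (norm_add_le _ _).trans (add_le_add ((hA.norm_le _ _).trans ?_) (hM s))
    exact mul_le_mul_of_nonneg_left (hN s hs) hC
  -- Picard iteration. No continuity of `A` in time is available, so the fixed point solves the
  -- integral equation only.
  let Φ : (ℝ → H) → ℝ → H := fun y t => x₀ + ∫ s in (0 : ℝ)..t, (A s (y s) + F s)
  let X : ℕ → ℝ → H := fun n => Φ^[n] fun _ => x₀
  have hX : ∀ n, X (n + 1) = Φ (X n) := fun n => Function.iterate_succ_apply' _ _ _
  have hc : ∀ n, Continuous (X n) := by
    intro n
    induction n with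
    | zero => exact continuous_const
    | succ n ih =>
      rw [hX]
      exact continuous_const.add (intervalIntegral.continuous_primitive (fun a b => hii ih a b) 0)
  set K := C * ‖x₀‖ + M with hK
  have hK0 : 0 ≤ K := by positivity
  -- `K` bounds the first velocity; each further iteration contributes a factor `C` and one more
  -- integration. The absolute value of `t` allows negative times.
  have hdiff : ∀ n t, ‖X (n + 1) t - X n t‖ ≤ K * C ^ n * |t| ^ (n + 1) / (n + 1).factorial := by
    intro n
    induction n with
    | zero =>
      intro t
      have : X 1 t - X 0 t = ∫ s in (0 : ℝ)..t, (A s x₀ + F s) := by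
        rw [hX 0]; simp [Φ, X]
      rw [this]
      refine (intervalIntegral.norm_integral_le_of_norm_le_const (C := K) fun s _ => ?_).trans ?_
      · exact (norm_add_le _ _).trans (add_le_add (hA.norm_le _ _) (hM s))
      · simp
    | succ n ih =>
      intro t
      have e : X (n + 2) t - X (n + 1) t = ∫ s in (0 : ℝ)..t, A s (X (n + 1) s - X n s) := by
        have e1 : X (n + 2) t = x₀ + ∫ s in (0 : ℝ)..t, (A s (X (n + 1) s) + F s) :=
          congrFun (hX (n + 1)) t
        have e2 : X (n + 1) t = x₀ + ∫ s in (0 : ℝ)..t, (A s (X n s) + F s) := congrFun (hX n) t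
        rw [e1, e2, add_sub_add_left_eq_sub, ← intervalIntegral.integral_sub (hii (hc _) _ _) (hii (hc _) _ _)]
        congr 1; ext s; simp
      rw [e]
      have hb : ∀ s, ‖A s (X (n + 1) s - X n s)‖ ≤
          C * (K * C ^ n * |s| ^ (n + 1) / (n + 1).factorial) := fun s =>
        (hA.norm_le _ _).trans (mul_le_mul_of_nonneg_left (ih s) hC)
      refine (intervalIntegral.norm_integral_le_abs_of_norm_le (ae_of_all _ fun s => hb s)
        (Continuous.intervalIntegrable (by fun_prop) _ _)).trans ?_
      have e2 : ∀ s : ℝ, C * (K * C ^ n * |s| ^ (n + 1) / (n + 1).factorial) =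
        (K * C ^ (n + 1) / (n + 1).factorial) * |s| ^ (n + 1) := fun s => by ring
      simp_rw [e2]
      rw [intervalIntegral.integral_const_mul, abs_mul, abs_of_nonneg (by positivity)]
      have e3 : |∫ s in (0 : ℝ)..t, |s| ^ (n + 1)| = |t| ^ (n + 2) / (n + 2) := by
        rcases le_total 0 t with h | h
        · have : ∫ s in (0 : ℝ)..t, |s| ^ (n + 1) = ∫ s in (0 : ℝ)..t, s ^ (n + 1) := by
            refine intervalIntegral.integral_congr fun s hs => ?_
            rw [uIcc_of_le h] at hs
            simp only [abs_of_nonneg hs.1]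
          rw [this, integral_pow, abs_of_nonneg h, abs_of_nonneg (by simp; positivity)]
          simp only [ne_eq, Nat.add_eq_zero_iff, one_ne_zero, and_false, not_false_eq_true, zero_pow, sub_zero]
          push_cast; ring
        · have : ∫ s in (0 : ℝ)..t, |s| ^ (n + 1) = ∫ s in (0 : ℝ)..t, (-s) ^ (n + 1) := by
            refine intervalIntegral.integral_congr fun s hs => ?_
            rw [uIcc_of_ge h] at hs
            simp only [abs_of_nonpos hs.2]
          rw [this, intervalIntegral.integral_comp_neg fun s => s ^ (n + 1), integral_pow,
            abs_of_nonpos h, neg_zero, abs_of_nonpos]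
          · simp only [ne_eq, Nat.add_eq_zero_iff, one_ne_zero, and_false, not_false_eq_true, zero_pow]
            push_cast; ring
          · have : 0 ≤ (-t) ^ (n + 1 + 1) := pow_nonneg (by linarith) _
            simp only [ne_eq, Nat.add_eq_zero_iff, one_ne_zero, and_false, not_false_eq_true, zero_pow]
            apply div_nonpos_of_nonpos_of_nonneg <;> [linarith; positivity]
      rw [e3]
      have : ((n + 1 + 1).factorial : ℝ) = (n + 2) * (n + 1).factorial := by
        rw [Nat.factorial_succ]; push_cast; ring
      rw [this]
      apply le_of_eq
      field_simp
  have hsum : ∀ T : ℝ, Summable fun n : ℕ => K * C ^ n * T ^ (n + 1) / (n + 1).factorial := by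
    intro T
    have h1 := (summable_nat_add_iff 1).2 (Real.summable_pow_div_factorial (C * T))
    have h2 := h1.mul_left K
    -- The series is `K C⁻¹` times a tail of the exponential series unless `C = 0`, where only the
    -- term `n = 0` survives.
    rcases eq_or_lt_of_le hC with h0 | h0
    · refine summable_of_ne_finset_zero (s := {0}) fun n hn => ?_
      have : n ≠ 0 := by simpa using hn
      simp [← h0, this]
    · refine (h2.mul_left C⁻¹).congr fun n => ?_
      field_simp
      ring
  have hcau : ∀ t, CauchySeq fun n => X n t := fun t =>
    cauchySeq_of_dist_le_of_summable _ (fun n => by rw [dist_comm, dist_eq_norm]; exact hdiff n t)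
      (hsum |t|)
  choose x hx using fun t => cauchySeq_tendsto_of_complete (hcau t)
  have hXb : ∀ T : ℝ, 0 ≤ T → ∀ n, ∀ t, |t| ≤ T →
      ‖X n t‖ ≤ ‖x₀‖ + ∑' n : ℕ, K * C ^ n * T ^ (n + 1) / (n + 1).factorial := by
    intro T hT n t ht
    have h1 : ‖X n t - X 0 t‖ ≤ ∑ i ∈ Finset.range n, K * C ^ i * T ^ (i + 1) / (i + 1).factorial := by
      rw [← Finset.sum_range_sub (fun i => X i t)]
      refine (norm_sum_le _ _).trans (Finset.sum_le_sum fun i _ => (hdiff i t).trans ?_)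
      gcongr
    have h2 := (hsum T).sum_le_tsum (Finset.range n) (fun i _ => by positivity)
    calc ‖X n t‖ = ‖X 0 t + (X n t - X 0 t)‖ := by simp
      _ ≤ ‖X 0 t‖ + ‖X n t - X 0 t‖ := norm_add_le _ _
      _ ≤ _ := by gcongr; exacts [le_rfl, h1.trans h2]
  -- At this stage `x` is only a pointwise limit. Measurability and local boundedness suffice to
  -- pass to the limit in the equation; continuity is recovered afterwards because `x` is then a
  -- primitive.
  have hxm : StronglyMeasurable x :=
    stronglyMeasurable_of_tendsto atTop (fun n => (hc n).stronglyMeasurable) (tendsto_pi_nhds.2 hx)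
  have hxb : ∀ T : ℝ, 0 ≤ T → ∀ t, |t| ≤ T →
      ‖x t‖ ≤ ‖x₀‖ + ∑' n : ℕ, K * C ^ n * T ^ (n + 1) / (n + 1).factorial := fun T hT t ht =>
    le_of_tendsto (hx t).norm (Eventually.of_forall fun n => hXb T hT n t ht)
  have hfix : ∀ t, x t = x₀ + ∫ s in (0 : ℝ)..t, (A s (x s) + F s) := by
    intro t
    refine tendsto_nhds_unique ((tendsto_add_atTop_iff_nat 1).2 (hx t)) ?_
    simp_rw [hX]
    refine tendsto_const_nhds.add ?_
    set N := ‖x₀‖ + ∑' n : ℕ, K * C ^ n * |t| ^ (n + 1) / (n + 1).factorial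
    refine intervalIntegral.tendsto_integral_filter_of_dominated_convergence (fun _ => C * N + M)
      (Eventually.of_forall fun n =>
        ((hA.comp (hc n).stronglyMeasurable).add hF).aestronglyMeasurable)
      (Eventually.of_forall fun n => ae_of_all _ fun s hs => ?_) intervalIntegrable_const
      (ae_of_all _ fun s _ => (((A s).continuous.tendsto _).comp (hx s)).add_const _)
    have hs' : |s| ≤ |t| := by
      have := uIoc_subset_uIcc hs
      rw [mem_uIcc] at this
      rcases this with h | h
      · rw [abs_of_nonneg h.1]; exact h.2.trans (le_abs_self t)
      · rw [abs_of_nonpos h.2]; have := neg_le_abs t; linarith [h.1]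
    refine (norm_add_le _ _).trans (add_le_add ((hA.norm_le _ _).trans ?_) (hM s))
    exact mul_le_mul_of_nonneg_left (hXb |t| (abs_nonneg _) n s hs') hC
  refine ⟨x, ?_, hfix⟩
  have hii' : ∀ a b, IntervalIntegrable (fun s => A s (x s) + F s) volume a b := by
    intro a b
    set T := max |a| |b|
    have hT : 0 ≤ T := (abs_nonneg a).trans (le_max_left _ _)
    refine intervalIntegrable_of_bounded (M := C * (‖x₀‖ + ∑' n : ℕ, K * C ^ n * T ^ (n + 1) / (n + 1).factorial) + M)
      ((hA.comp hxm).add hF) fun s hs => ?_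
    have hs' : |s| ≤ T := by
      rw [mem_uIcc] at hs
      rcases hs with h | h
      · exact abs_le_max_abs_abs h.1 h.2
      · rw [show T = max |b| |a| from max_comm _ _]; exact abs_le_max_abs_abs h.1 h.2
    refine (norm_add_le _ _).trans (add_le_add ((hA.norm_le _ _).trans ?_) (hM s))
    exact mul_le_mul_of_nonneg_left (hxb T hT s hs') hC
  have : x = fun t => x₀ + ∫ s in (0 : ℝ)..t, (A s (x s) + F s) := funext hfix
  rw [this]
  exact continuous_const.add (intervalIntegral.continuous_primitive hii' 0)

/-- Energy identity for a primitive. -/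
theorem norm_sq_primitive {f : ℝ → H} {t : ℝ} (ht : 0 ≤ t) (hf : IntervalIntegrable f volume 0 t)
    {x : ℝ → H} (hx : ∀ s ∈ Icc 0 t, x s = x 0 + ∫ r in (0 : ℝ)..s, f r) :
    ‖x t‖ ^ 2 = ‖x 0‖ ^ 2 + 2 * ∫ s in (0 : ℝ)..t, inner ℝ (x s) (f s) := by
  have h := bilin_primitive (innerSL ℝ (E := H)) ht hf hf (x 0) (x 0)
  rw [← hx t ⟨ht, le_rfl⟩] at h
  change inner ℝ (x t) (x t) = inner ℝ (x 0) (x 0) + _ at h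
  rw [real_inner_self_eq_norm_sq, real_inner_self_eq_norm_sq] at h
  rw [h, ← intervalIntegral.integral_const_mul]
  congr 1
  refine intervalIntegral.integral_congr fun s hs => ?_
  rw [uIcc_of_le ht] at hs
  have e := hx s hs
  change inner ℝ (f s) (x 0 + ∫ r in (0 : ℝ)..s, f r) + inner ℝ (x 0 + ∫ r in (0 : ℝ)..s, f r) (f s) = _
  rw [← e, real_inner_comm]; ring

theorem intervalIntegrable_inner {x f : ℝ → H} {t : ℝ} (hx : ContinuousOn x (uIcc 0 t))
    (hf : IntervalIntegrable f volume 0 t) :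
    IntervalIntegrable (fun s => inner ℝ (x s) (f s)) volume 0 t := by
  obtain ⟨C, hC⟩ := isCompact_uIcc.exists_bound_of_continuousOn hx
  rw [intervalIntegrable_iff] at hf ⊢
  have hxm : AEStronglyMeasurable x (volume.restrict (uIoc 0 t)) :=
    (hx.mono uIoc_subset_uIcc).aestronglyMeasurable measurableSet_uIoc
  refine Integrable.mono' (hf.norm.const_mul C) (hxm.inner hf.aestronglyMeasurable)
    ((ae_restrict_iff' measurableSet_uIoc).2 (ae_of_all _ fun s hs => ?_))
  exact (norm_inner_le_norm _ _).trans
    (mul_le_mul_of_nonneg_right (hC s (uIoc_subset_uIcc hs)) (norm_nonneg _))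

theorem continuousOn_of_primitive {E : Type*} [NormedAddCommGroup E] [NormedSpace ℝ E]
    {x f : ℝ → E} {T : ℝ} (hT : 0 ≤ T) (hf : IntervalIntegrable f volume 0 T)
    (hx : ∀ s ∈ Icc 0 T, x s = x 0 + ∫ r in (0 : ℝ)..s, f r) : ContinuousOn x (Icc 0 T) := by
  have : ContinuousOn (fun s => x 0 + ∫ r in (0 : ℝ)..s, f r) (Icc 0 T) := by
    refine continuousOn_const.add ?_
    have := intervalIntegral.continuousOn_primitive_interval (f := f) (a := 0) (b := T) (μ := volume)
      (by rw [uIcc_of_le hT, integrableOn_Icc_iff_integrableOn_Ioc]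
          exact (intervalIntegrable_iff_integrableOn_Ioc_of_le hT).1 hf)
    rwa [uIcc_of_le hT] at this
  exact this.congr hx

/-- Stability estimate: if the velocity is dissipative up to an error of size `ρ`, the norm grows
at most linearly. -/
theorem norm_le_of_dissipative {f : ℝ → H} {T ρ : ℝ} (hT : 0 ≤ T) (hρ : 0 ≤ ρ)
    (hf : IntervalIntegrable f volume 0 T) {x : ℝ → H}
    (hx : ∀ s ∈ Icc 0 T, x s = x 0 + ∫ r in (0 : ℝ)..s, f r)
    (hd : ∀ᵐ s, s ∈ Icc 0 T → inner ℝ (x s) (f s) ≤ ρ * ‖x s‖) :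
    ∀ t ∈ Icc 0 T, ‖x t‖ ≤ ‖x 0‖ + 2 * ρ * T := by
  have hc := continuousOn_of_primitive hT hf hx
  -- At a maximum point of the norm the energy identity reads `‖x m‖² ≤ ‖x 0‖² + 2 m ρ ‖x m‖`, and
  -- one factor `‖x m‖` can be divided out. This avoids differentiating the norm where it vanishes.
  obtain ⟨m, hm, hmax⟩ := isCompact_Icc.exists_isMaxOn (nonempty_Icc.2 hT) hc.norm
  suffices h : ‖x m‖ ≤ ‖x 0‖ + 2 * ρ * T from fun t ht => (hmax ht).trans h
  have hfm : IntervalIntegrable f volume 0 m := hf.mono_set (by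
    rw [uIcc_of_le hm.1, uIcc_of_le hT]; exact Icc_subset_Icc_right hm.2)
  have hxm : ∀ s ∈ Icc 0 m, x s = x 0 + ∫ r in (0 : ℝ)..s, f r :=
    fun s hs => hx s ⟨hs.1, hs.2.trans hm.2⟩
  have e := norm_sq_primitive hm.1 hfm hxm
  have hle : ∫ s in (0 : ℝ)..m, inner ℝ (x s) (f s) ≤ ∫ s in (0 : ℝ)..m, ρ * ‖x m‖ := by
    refine intervalIntegral.integral_mono_ae_restrict hm.1
      (intervalIntegrable_inner (by
        rw [uIcc_of_le hm.1]; exact hc.mono (Icc_subset_Icc_right hm.2)) hfm)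
      intervalIntegrable_const ((ae_restrict_iff' measurableSet_Icc).2 ?_)
    filter_upwards [hd] with s hs hsm
    have hsT : s ∈ Icc 0 T := ⟨hsm.1, hsm.2.trans hm.2⟩
    exact (hs hsT).trans (mul_le_mul_of_nonneg_left (hmax hsT) hρ)
  rw [intervalIntegral.integral_const, sub_zero, smul_eq_mul] at hle
  have h0 : ‖x 0‖ ≤ ‖x m‖ := hmax (left_mem_Icc.2 hT)
  rcases eq_or_lt_of_le (norm_nonneg (x m)) with h | h
  · rw [← h]; positivity
  · have : ‖x m‖ * ‖x m‖ ≤ (‖x 0‖ + 2 * ρ * T) * ‖x m‖ := by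
      have h1 : m * (ρ * ‖x m‖) ≤ T * (ρ * ‖x m‖) := by gcongr; exact hm.2
      have h2 : ‖x 0‖ * ‖x 0‖ ≤ ‖x 0‖ * ‖x m‖ := by gcongr
      nlinarith
    exact le_of_mul_le_mul_right this h

/-- Coercive evolution equations have periodic solutions. -/
theorem exists_periodic_evolution [SecondCountableTopology H] {A : ℝ → H →L[ℝ] H} {C : ℝ}
    (hA : BddFamily A C) {F : ℝ → H} (hF : StronglyMeasurable F) {M : ℝ} (hM : ∀ s, ‖F s‖ ≤ M)
    {lam : ℝ} (hlam : 0 < lam) (hco : ∀ s x, inner ℝ x (A s x) ≤ -lam * ‖x‖ ^ 2) :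
    ∃ x : ℝ → H, Continuous x ∧ (∀ t, x t = x 0 + ∫ s in (0 : ℝ)..t, (A s (x s) + F s)) ∧
      x 1 = x 0 := by
  choose S hSc hS using fun x₀ => exists_evolution hA hF hM x₀
  have hS0 : ∀ x₀, S x₀ 0 = x₀ := fun x₀ => by rw [hS]; simp
  have hii : ∀ x₀ a b, IntervalIntegrable (fun s => A s (S x₀ s) + F s) volume a b := by
    intro y a b
    obtain ⟨N, hN⟩ := (isCompact_uIcc (a := a) (b := b)).exists_bound_of_continuousOn (hSc y).continuousOn
    refine intervalIntegrable_of_bounded (M := C * N + M) ((hA.comp (hSc y).stronglyMeasurable).add hF) fun s hs => ?_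
    refine (norm_add_le _ _).trans (add_le_add ((hA.norm_le _ _).trans ?_) (hM s))
    exact mul_le_mul_of_nonneg_left (hN s hs) hA.nonneg
  -- The difference of two solutions has decreasing norm, so its final norm is a lower bound on the
  -- whole period. Inserting this in the integrated coercivity estimate gives the factor `1 + 2
  -- lam`.
  have hcontr : ∀ y z, (1 + 2 * lam) * ‖S y 1 - S z 1‖ ^ 2 ≤ ‖y - z‖ ^ 2 := by
    intro y z
    set x : ℝ → H := fun t => S y t - S z t with hx
    have hxc : Continuous x := (hSc y).sub (hSc z)
    have hAx : ∀ a b, IntervalIntegrable (fun s => A s (x s)) volume a b := fun a b => by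
      refine ((hii y a b).sub (hii z a b)).congr fun s _ => ?_
      simp [hx]
    have hxe : ∀ t, x t = x 0 + ∫ s in (0 : ℝ)..t, A s (x s) := by
      intro t
      have : ∫ s in (0 : ℝ)..t, A s (x s) = (∫ s in (0 : ℝ)..t, (A s (S y s) + F s)) -
          ∫ s in (0 : ℝ)..t, (A s (S z s) + F s) := by
        rw [← intervalIntegral.integral_sub (hii y _ _) (hii z _ _)]
        congr 1; ext s; simp [hx]
      rw [this]
      simp only [hx, hS0]
      rw [hS y t, hS z t]; abel
    have en : ∀ t, 0 ≤ t → ‖x t‖ ^ 2 = ‖x 0‖ ^ 2 + 2 * ∫ s in (0 : ℝ)..t, inner ℝ (x s) (A s (x s)) :=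
      fun t ht => norm_sq_primitive ht (hAx 0 t) fun s _ => hxe s
    have hin : ∀ a b, IntervalIntegrable (fun s => inner ℝ (x s) (A s (x s))) volume a b := by
      intro a b
      have h0 : ∀ c, IntervalIntegrable (fun s => inner ℝ (x s) (A s (x s))) volume 0 c := fun c =>
        intervalIntegrable_inner hxc.continuousOn (hAx 0 c)
      exact (h0 a).symm.trans (h0 b)
    have hmono : ∀ t ∈ Icc (0 : ℝ) 1, ‖x 1‖ ^ 2 ≤ ‖x t‖ ^ 2 := by
      intro t ht
      rw [en 1 zero_le_one, en t ht.1, ← intervalIntegral.integral_add_adjacent_intervals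
        (hin 0 t) (hin t 1)]
      have : ∫ s in t..1, inner ℝ (x s) (A s (x s)) ≤ 0 := by
        rw [← neg_nonneg, ← intervalIntegral.integral_neg]
        refine intervalIntegral.integral_nonneg ht.2 fun s _ => ?_
        have := hco s (x s)
        have := sq_nonneg ‖x s‖
        nlinarith
      linarith
    have hle : ∫ s in (0 : ℝ)..1, inner ℝ (x s) (A s (x s)) ≤ ∫ s in (0 : ℝ)..1, (-lam * ‖x 1‖ ^ 2) := by
      refine intervalIntegral.integral_mono_on zero_le_one (hin 0 1) intervalIntegrable_const
        fun s hs => (hco s (x s)).trans ?_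
      have := hmono s hs
      nlinarith
    simp only [intervalIntegral.integral_const, sub_zero, smul_eq_mul, one_mul] at hle
    have e1 := en 1 zero_le_one
    have hx0 : x 0 = y - z := by simp [hx, hS0]
    rw [hx0] at e1
    change (1 + 2 * lam) * ‖x 1‖ ^ 2 ≤ _
    nlinarith
  set κ : ℝ := (Real.sqrt (1 + 2 * lam))⁻¹ with hκ
  have hs1 : 1 < Real.sqrt (1 + 2 * lam) := by
    rw [show (1 : ℝ) = Real.sqrt 1 by simp]
    exact Real.sqrt_lt_sqrt (by norm_num) (by simp; linarith)
  have hκ0 : 0 ≤ κ := by positivity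
  have hlip : LipschitzWith κ.toNNReal fun y => S y 1 := by
    refine LipschitzWith.of_dist_le_mul fun y z => ?_
    rw [dist_eq_norm, dist_eq_norm]
    rw [Real.coe_toNNReal _ hκ0]
    have h1 : Real.sqrt (1 + 2 * lam) * ‖S y 1 - S z 1‖ ≤ ‖y - z‖ := by
      refine abs_le_of_sq_le_sq' ?_ (norm_nonneg _) |>.2
      rw [mul_pow, Real.sq_sqrt (by linarith)]
      exact hcontr y z
    rw [hκ, inv_mul_eq_div, le_div_iff₀ (by linarith), mul_comm]
    exact h1
  -- Banach's theorem for the period map; its fixed point is the initial value of the periodic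
  -- solution.
  have hcw : ContractingWith κ.toNNReal fun y => S y 1 :=
    ⟨by rw [Real.toNNReal_lt_one]; exact inv_lt_one_of_one_lt₀ hs1, hlip⟩
  have hfp := hcw.fixedPoint_isFixedPt
  set y := hcw.fixedPoint
  refine ⟨S y, hSc y, fun t => ?_, ?_⟩
  · rw [hS0]; exact hS y t
  · rw [hS0]; exact hfp

end AbstractEvolution

end NonlocalHomogenization

/-! ### L²-valued maps given pointwise; multiplication and translation operators -/

namespace NonlocalHomogenization

instance factTwoNeTop : Fact ((2 : ENNReal) ≠ ⊤) := ⟨ENNReal.ofNat_ne_top⟩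

/-- Balls form a basis, and in a second countable space a basis generates the Borel σ-algebra. -/
theorem measurable_of_ball {Z E : Type*} [MeasurableSpace Z] [PseudoMetricSpace E]
    [SecondCountableTopology E] [MeasurableSpace E] [BorelSpace E] {F : Z → E}
    (h : ∀ g r, MeasurableSet {z | dist (F z) g < r}) : Measurable F := by
  have hb : TopologicalSpace.IsTopologicalBasis {s : Set E | ∃ g r, s = Metric.ball g r} := by
    refine TopologicalSpace.isTopologicalBasis_of_isOpen_of_nhds ?_ ?_
    · rintro _ ⟨g, r, rfl⟩; exact Metric.isOpen_ball
    · intro x u hx hu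
      obtain ⟨r, hr, hru⟩ := Metric.isOpen_iff.1 hu x hx
      exact ⟨_, ⟨x, r, rfl⟩, Metric.mem_ball_self hr, hru⟩
  rw [BorelSpace.measurable_eq (α := E), hb.borel_eq_generateFrom]
  refine measurable_generateFrom ?_
  rintro _ ⟨g, r, rfl⟩
  exact h g r

section LpFamilies

variable {Z X 𝕜 : Type*} [MeasurableSpace Z] [MeasurableSpace X] [RCLike 𝕜]
  [MeasurableSpace.CountablyGenerated X] {ν : Measure X} [SigmaFinite ν]

/-- An `L²`-valued map given by a jointly measurable function is strongly measurable. -/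
theorem stronglyMeasurable_Lp_of_joint {F : Z → Lp 𝕜 2 ν} {G : Z × X → 𝕜}
    (hG : Measurable G) (h : ∀ z, F z =ᵐ[ν] fun x => G (z, x)) : StronglyMeasurable F := by
  borelize ↥(Lp 𝕜 2 ν)
  refine Measurable.stronglyMeasurable (measurable_of_ball fun g r => ?_)
  -- The distance to a fixed element is a parameter integral of a jointly measurable function, hence
  -- measurable by Tonelli.
  have e : ∀ z, dist (F z) g = ((∫⁻ x, ‖G (z, x) - g x‖ₑ ^ (2 : ℝ) ∂ν) ^ ((1 : ℝ) / 2)).toReal := by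
    intro z
    rw [dist_eq_norm, Lp.norm_def, eLpNorm_eq_lintegral_rpow_enorm_toReal (by simp) (by simp)]
    simp only [ENNReal.toReal_ofNat]
    congr 2
    refine lintegral_congr_ae ?_
    filter_upwards [h z, Lp.coeFn_sub (F z) g] with x hx hs
    rw [hs, Pi.sub_apply, hx]
  simp_rw [e]
  refine measurableSet_lt ?_ measurable_const
  have hg : Measurable (g : X → 𝕜) := (Lp.stronglyMeasurable g).measurable
  have : Measurable fun z => ∫⁻ x, ‖G (z, x) - g x‖ₑ ^ (2 : ℝ) ∂ν :=
    Measurable.lintegral_prod_right' (f := fun p : Z × X => ‖G p - g p.2‖ₑ ^ (2 : ℝ))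
      ((hG.sub (hg.comp measurable_snd)).enorm.pow_const _)
  exact (this.pow_const _).ennreal_toReal

/-- Hölder's inequality on a set of finite measure. It makes L² functions locally integrable, with a
bound uniform enough for Fubini. -/
theorem integral_norm_restrict_le (f : Lp 𝕜 2 ν) {B : Set X} (hB : ν B ≠ ⊤) :
    IntegrableOn f B ν ∧ ∫ x in B, ‖f x‖ ∂ν ≤ ‖f‖ * ((ν B) ^ ((1 : ℝ) / 2)).toReal := by
  have hf : MemLp f 2 (ν.restrict B) := (Lp.memLp f).restrict B
  have h1 : eLpNorm f 1 (ν.restrict B) ≤ eLpNorm f 2 ν * (ν B) ^ ((1 : ℝ) / 2) := by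
    refine (eLpNorm_le_eLpNorm_mul_rpow_measure_univ (by norm_num : (1 : ENNReal) ≤ 2)
      hf.aestronglyMeasurable).trans ?_
    rw [Measure.restrict_apply_univ]
    have : (1 / (1 : ENNReal).toReal - 1 / (2 : ENNReal).toReal) = (1 : ℝ) / 2 := by
      simp; norm_num
    rw [this]
    exact mul_le_mul_left (eLpNorm_mono_measure (f : X → 𝕜) Measure.restrict_le_self) _
  have hfin : eLpNorm f 2 ν * (ν B) ^ ((1 : ℝ) / 2) ≠ ⊤ :=
    ENNReal.mul_ne_top (Lp.eLpNorm_ne_top f) (ENNReal.rpow_ne_top_of_nonneg (by norm_num) hB)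
  refine ⟨memLp_one_iff_integrable.1 ⟨hf.aestronglyMeasurable, h1.trans_lt hfin.lt_top⟩, ?_⟩
  rw [integral_norm_eq_lintegral_enorm hf.aestronglyMeasurable, Lp.norm_def, ← ENNReal.toReal_mul]
  refine ENNReal.toReal_mono hfin ?_
  rwa [eLpNorm_one_eq_lintegral_enorm] at h1

/-- A Bochner integral in `L²` may be computed pointwise. -/
theorem integral_Lp_ae {m : Measure Z} [SigmaFinite m] {F : Z → Lp 𝕜 2 ν} {G : Z × X → 𝕜}
    (hG : Measurable G) (h : ∀ z, F z =ᵐ[ν] fun x => G (z, x)) (hF : Integrable F m) :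
    (∀ᵐ x ∂ν, Integrable (fun z => G (z, x)) m) ∧
      (∫ z, F z ∂m : Lp 𝕜 2 ν) =ᵐ[ν] fun x => ∫ z, G (z, x) ∂m := by
  have key : ∀ B : Set X, ν B < ⊤ → Integrable G (m.prod (ν.restrict B)) := by
    intro B hB
    rw [integrable_prod_iff hG.aestronglyMeasurable]
    have hz : ∀ z, (fun x => G (z, x)) =ᵐ[ν.restrict B] F z := fun z => ae_restrict_of_ae (h z).symm
    refine ⟨ae_of_all _ fun z => (integral_norm_restrict_le (F z) hB.ne).1.congr (hz z).symm, ?_⟩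
    refine Integrable.mono' (hF.norm.mul_const ((ν B) ^ ((1 : ℝ) / 2)).toReal)
      (hG.norm.stronglyMeasurable.integral_prod_right').aestronglyMeasurable
      (ae_of_all _ fun z => ?_)
    rw [Real.norm_of_nonneg (integral_nonneg fun x => norm_nonneg _)]
    rw [integral_congr_ae (g := fun x => ‖F z x‖) ((hz z).mono fun x hx => by simp only [hx])]
    exact (integral_norm_restrict_le (F z) hB.ne).2
  constructor
  · have : ∀ n, ∀ᵐ x ∂ν, x ∈ spanningSets ν n → Integrable (fun z => G (z, x)) m := fun n => by
      rw [← ae_restrict_iff' (measurableSet_spanningSets ν n)]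
      exact (integrable_prod_iff' hG.aestronglyMeasurable).1
        (key _ (measure_spanningSets_lt_top ν n)) |>.1
    filter_upwards [ae_all_iff.2 this] with x hx
    exact hx _ (mem_spanningSetsIndex ν x)
  -- Both sides have the same integral over every set of finite measure: on the left the integral is
  -- an inner product with an indicator, which commutes with the Bochner integral; on the right
  -- Fubini applies.
  · refine ae_eq_of_forall_setIntegral_eq_of_sigmaFinite
      (fun s _ hs => (integral_norm_restrict_le _ hs.ne).1)
      (fun s _ hs => (key s hs).integral_prod_right) fun s hs hfs => ?_
    rw [← L2.inner_indicatorConstLp_one hs hfs.ne, ← integral_inner hF,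
      ← integral_integral_swap (f := fun z x => G (z, x)) (key s hfs)]
    refine integral_congr_ae (ae_of_all _ fun z => ?_)
    simp only
    rw [L2.inner_indicatorConstLp_one hs hfs.ne]
    exact integral_congr_ae (ae_restrict_of_ae (h z))

variable (ν) in
/-- Multiplication by a bounded measurable function on `L²`. -/
def mulL {m : X → 𝕜} {C : ℝ} (hm : Measurable m ∧ ∀ x, ‖m x‖ ≤ C) : Lp 𝕜 2 ν →L[𝕜] Lp 𝕜 2 ν :=
  LinearMap.mkContinuous
    { toFun := fun f => (MemLp.of_le_mul (c := C) (Lp.memLp f) (f := fun x => m x * f x)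
        (hm.1.aestronglyMeasurable.mul (Lp.aestronglyMeasurable f))
        (ae_of_all _ fun x => by
          rw [norm_mul]; exact mul_le_mul_of_nonneg_right (hm.2 x) (norm_nonneg _))).toLp _
      map_add' := fun f g => by
        rw [← MemLp.toLp_add]
        refine MemLp.toLp_congr _ _ ?_
        filter_upwards [Lp.coeFn_add f g] with x hx
        simp only [hx, Pi.add_apply, mul_add]
      map_smul' := fun c f => by
        rw [RingHom.id_apply, ← MemLp.toLp_const_smul]
        refine MemLp.toLp_congr _ _ ?_
        filter_upwards [Lp.coeFn_smul c f] with x hx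
        simp only [hx, Pi.smul_apply, smul_eq_mul]; ring }
    C fun f => by
      refine Lp.norm_le_mul_norm_of_ae_le_mul ?_
      simp only [LinearMap.coe_mk, AddHom.coe_mk]
      filter_upwards [MemLp.coeFn_toLp (MemLp.of_le_mul (c := C) (Lp.memLp f) (f := fun x => m x * f x)
        (hm.1.aestronglyMeasurable.mul (Lp.aestronglyMeasurable f))
        (ae_of_all _ fun x => by
          rw [norm_mul]; exact mul_le_mul_of_nonneg_right (hm.2 x) (norm_nonneg _)))] with x hx
      rw [hx, norm_mul]
      exact mul_le_mul_of_nonneg_right (hm.2 x) (norm_nonneg _)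

theorem mulL_ae {m : X → 𝕜} {C : ℝ} (hm : Measurable m ∧ ∀ x, ‖m x‖ ≤ C) (f : Lp 𝕜 2 ν) :
    mulL ν hm f =ᵐ[ν] fun x => m x * f x :=
  MemLp.coeFn_toLp (MemLp.of_le_mul (c := C) (Lp.memLp f) (f := fun x => m x * f x)
    (hm.1.aestronglyMeasurable.mul (Lp.aestronglyMeasurable f))
    (ae_of_all _ fun x => by
      rw [norm_mul]; exact mul_le_mul_of_nonneg_right (hm.2 x) (norm_nonneg _)))

theorem mulL_norm_le {m : X → 𝕜} {C : ℝ} (hm : Measurable m ∧ ∀ x, ‖m x‖ ≤ C) (f : Lp 𝕜 2 ν) :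
    ‖mulL ν hm f‖ ≤ C * ‖f‖ := by
  refine Lp.norm_le_mul_norm_of_ae_le_mul ?_
  filter_upwards [mulL_ae hm f] with x hx
  rw [hx, norm_mul]
  exact mul_le_mul_of_nonneg_right (hm.2 x) (norm_nonneg _)

end LpFamilies

/-- The translation `f ↦ f(· - h)` on `L²`. -/
def transL {X : Type*} (𝕜 : Type*) [RCLike 𝕜] [MeasurableSpace X] [AddCommGroup X] [MeasurableAdd₂ X]
    (ν : Measure X) [ν.IsAddRightInvariant] (h : X) : Lp 𝕜 2 ν →ₗᵢ[𝕜] Lp 𝕜 2 ν :=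
  Lp.compMeasurePreservingₗᵢ 𝕜 (fun x => x - h) (measurePreserving_sub_right ν h)

theorem transL_ae {X 𝕜 : Type*} [RCLike 𝕜] [MeasurableSpace X] [AddCommGroup X] [MeasurableAdd₂ X]
    {ν : Measure X} [ν.IsAddRightInvariant] (h : X) (f : Lp 𝕜 2 ν) :
    transL 𝕜 ν h f =ᵐ[ν] fun x => f (x - h) :=
  Lp.coeFn_compMeasurePreserving f (measurePreserving_sub_right ν h)

/-! ### Symmetric jump generators and their Dirichlet forms -/

/-- Data of a jump operator on a space `X` on which `ℝ^d` acts by translations: the map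
`shift : ℝ^d → X` and a bounded symmetric jump intensity. -/
structure JumpKernel (d : ℕ) (X : Type*) [AddCommGroup X] [MeasurableSpace X] where
  shift : Space d → X
  coeff : ℝ → Space d → X → ℝ
  lo : ℝ
  hi : ℝ
  shift_meas : Measurable shift
  shift_neg : ∀ z, shift (-z) = -shift z
  coeff_meas : Measurable fun p : (ℝ × Space d) × X => coeff p.1.1 p.1.2 p.2
  lo_pos : 0 < lo
  lo_le : ∀ s z x, lo ≤ coeff s z x
  le_hi : ∀ s z x, coeff s z x ≤ hi
  symm : ∀ s z x, coeff s (-z) (x - shift z) = coeff s z x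

namespace JumpKernel

variable {d : ℕ} {X : Type*} [AddCommGroup X] [MeasurableSpace X] [MeasurableAdd₂ X]
  [MeasurableNeg X] [MeasurableSub₂ X] [MeasurableSpace.CountablyGenerated X] (J : JumpKernel d X)
  (ν : Measure X) [SigmaFinite ν] [ν.IsAddRightInvariant]

theorem hi_pos : 0 < J.hi := J.lo_pos.trans_le ((J.lo_le 0 0 0).trans (J.le_hi 0 0 0))

theorem coeff_nonneg (s : ℝ) (z : Space d) (x : X) : 0 ≤ J.coeff s z x :=
  J.lo_pos.le.trans (J.lo_le s z x)

theorem coeff_bdd (s : ℝ) (z : Space d) :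
    Measurable (J.coeff s z) ∧ ∀ x, ‖J.coeff s z x‖ ≤ J.hi :=
  ⟨J.coeff_meas.comp (measurable_prodMk_left (x := (s, z))), fun x => by
    rw [Real.norm_of_nonneg (J.coeff_nonneg s z x)]; exact J.le_hi s z x⟩

/-- Multiplication by the jump intensity. -/
def M (s : ℝ) (z : Space d) : Lp ℝ 2 ν →L[ℝ] Lp ℝ 2 ν := mulL ν (J.coeff_bdd s z)

/-- Translation along the jump `z`. -/
def tr (z : Space d) : Lp ℝ 2 ν →ₗᵢ[ℝ] Lp ℝ 2 ν := transL ℝ ν (J.shift z)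

/-- Translation followed by multiplication by the jump intensity. -/
def S (s : ℝ) (z : Space d) : Lp ℝ 2 ν →L[ℝ] Lp ℝ 2 ν :=
  J.M ν s z ∘L (J.tr ν z).toContinuousLinearMap

variable {ν}

theorem M_ae (s : ℝ) (z : Space d) (f : Lp ℝ 2 ν) :
    J.M ν s z f =ᵐ[ν] fun x => J.coeff s z x * f x := mulL_ae _ f

theorem tr_ae (z : Space d) (f : Lp ℝ 2 ν) : J.tr ν z f =ᵐ[ν] fun x => f (x - J.shift z) :=
  transL_ae _ f

theorem S_apply (s : ℝ) (z : Space d) (f : Lp ℝ 2 ν) : J.S ν s z f = J.M ν s z (J.tr ν z f) := rfl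

theorem S_ae (s : ℝ) (z : Space d) (f : Lp ℝ 2 ν) :
    J.S ν s z f =ᵐ[ν] fun x => J.coeff s z x * f (x - J.shift z) := by
  filter_upwards [J.M_ae s z (J.tr ν z f), J.tr_ae z f] with x h1 h2
  rw [S_apply, h1, h2]

theorem M_norm_le (s : ℝ) (z : Space d) (f : Lp ℝ 2 ν) : ‖J.M ν s z f‖ ≤ J.hi * ‖f‖ :=
  mulL_norm_le _ f

theorem S_norm_le (s : ℝ) (z : Space d) (f : Lp ℝ 2 ν) : ‖J.S ν s z f‖ ≤ J.hi * ‖f‖ := by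
  rw [S_apply]; simpa using J.M_norm_le s z (J.tr ν z f)

theorem jointM_meas (f : Lp ℝ 2 ν) :
    Measurable fun p : (ℝ × Space d) × X => J.coeff p.1.1 p.1.2 p.2 * f p.2 :=
  J.coeff_meas.mul ((Lp.stronglyMeasurable f).measurable.comp measurable_snd)

theorem jointS_meas (f : Lp ℝ 2 ν) :
    Measurable fun p : (ℝ × Space d) × X => J.coeff p.1.1 p.1.2 p.2 * f (p.2 - J.shift p.1.2) :=
  J.coeff_meas.mul ((Lp.stronglyMeasurable f).measurable.comp
    (measurable_snd.sub (J.shift_meas.comp (measurable_snd.comp measurable_fst))))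

theorem M_meas (f : Lp ℝ 2 ν) : StronglyMeasurable fun p : ℝ × Space d => J.M ν p.1 p.2 f :=
  stronglyMeasurable_Lp_of_joint (J.jointM_meas f) fun p => J.M_ae p.1 p.2 f

theorem S_meas (f : Lp ℝ 2 ν) : StronglyMeasurable fun p : ℝ × Space d => J.S ν p.1 p.2 f :=
  stronglyMeasurable_Lp_of_joint (J.jointS_meas f) fun p => J.S_ae p.1 p.2 f

variable {α : Space d → ℝ}

theorem M_integrable (hα : Integrable α) (s : ℝ) (f : Lp ℝ 2 ν) :
    Integrable fun z => α z • J.M ν s z f := by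
  refine Integrable.mono' (hα.norm.mul_const (J.hi * ‖f‖))
    (hα.aestronglyMeasurable.smul ((J.M_meas f).comp_measurable
      measurable_prodMk_left).aestronglyMeasurable) (ae_of_all _ fun z => ?_)
  rw [norm_smul]
  exact mul_le_mul_of_nonneg_left (J.M_norm_le s z f) (norm_nonneg _)

theorem S_integrable (hα : Integrable α) (s : ℝ) (f : Lp ℝ 2 ν) :
    Integrable fun z => α z • J.S ν s z f := by
  refine Integrable.mono' (hα.norm.mul_const (J.hi * ‖f‖))
    (hα.aestronglyMeasurable.smul ((J.S_meas f).comp_measurable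
      measurable_prodMk_left).aestronglyMeasurable) (ae_of_all _ fun z => ?_)
  rw [norm_smul]
  exact mul_le_mul_of_nonneg_left (J.S_norm_le s z f) (norm_nonneg _)

/-- A weighted integral of a uniformly bounded family of operators. -/
def weighted (hα : Integrable α) (T : Space d → Lp ℝ 2 ν →L[ℝ] Lp ℝ 2 ν) (C : ℝ)
    (hT : ∀ f, Integrable fun z => α z • T z f) (hC : ∀ z f, ‖T z f‖ ≤ C * ‖f‖) :
    Lp ℝ 2 ν →L[ℝ] Lp ℝ 2 ν :=
  LinearMap.mkContinuous
    { toFun := fun f => ∫ z, α z • T z f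
      map_add' := fun f g => by
        simp only [map_add, smul_add]; exact integral_add (hT f) (hT g)
      map_smul' := fun c f => by
        simp only [map_smul, RingHom.id_apply]
        rw [← integral_smul]
        simp_rw [smul_comm c] }
    ((∫ z, ‖α z‖) * C) fun f => by
      refine (norm_integral_le_of_norm_le (hα.norm.mul_const (C * ‖f‖)) (ae_of_all _ fun z => ?_)).trans ?_
      · rw [norm_smul]; exact mul_le_mul_of_nonneg_left (hC z f) (norm_nonneg _)
      · rw [integral_mul_const, mul_assoc]

theorem weighted_norm_le (hα : Integrable α) (T : Space d → Lp ℝ 2 ν →L[ℝ] Lp ℝ 2 ν) {C : ℝ}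
    (h0 : 0 ≤ C) (hT : ∀ f, Integrable fun z => α z • T z f) (hC : ∀ z f, ‖T z f‖ ≤ C * ‖f‖) :
    ‖weighted hα T C hT hC‖ ≤ (∫ z, ‖α z‖) * C :=
  LinearMap.mkContinuous_norm_le _ (mul_nonneg (integral_nonneg fun _ => norm_nonneg _) h0) _

/-- `K f = ∫ α(z) S_z f dz`. -/
def K (hα : Integrable α) (s : ℝ) : Lp ℝ 2 ν →L[ℝ] Lp ℝ 2 ν :=
  weighted hα (J.S ν s) J.hi (J.S_integrable hα s) (J.S_norm_le s)

/-- `N f = ∫ α(z) M_z f dz`. -/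
def N (hα : Integrable α) (s : ℝ) : Lp ℝ 2 ν →L[ℝ] Lp ℝ 2 ν :=
  weighted hα (J.M ν s) J.hi (J.M_integrable hα s) (J.M_norm_le s)

theorem K_apply (hα : Integrable α) (s : ℝ) (f : Lp ℝ 2 ν) :
    J.K hα s f = ∫ z, α z • J.S ν s z f := rfl

theorem N_apply (hα : Integrable α) (s : ℝ) (f : Lp ℝ 2 ν) :
    J.N hα s f = ∫ z, α z • J.M ν s z f := rfl

theorem K_family (hα : Integrable α) : BddFamily (J.K (ν := ν) hα) ((∫ z, ‖α z‖) * J.hi) where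
  meas f := by
    -- The weight is only a.e. strongly measurable; joint measurability in `(s, z)` needs a genuine
    -- representative.
    obtain ⟨β, hβ, hαβ⟩ := hα.aestronglyMeasurable
    have : ∀ s, J.K hα s f = ∫ z, β z • J.S ν s z f := fun s =>
      integral_congr_ae (hαβ.mono fun z hz => by simp only [hz])
    simp_rw [this]
    exact ((hβ.comp_measurable measurable_snd).smul (J.S_meas f)).integral_prod_right'
  bound s := weighted_norm_le _ _ J.hi_pos.le _ _

theorem N_family (hα : Integrable α) : BddFamily (J.N (ν := ν) hα) ((∫ z, ‖α z‖) * J.hi) where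
  meas f := by
    obtain ⟨β, hβ, hαβ⟩ := hα.aestronglyMeasurable
    have : ∀ s, J.N hα s f = ∫ z, β z • J.M ν s z f := fun s =>
      integral_congr_ae (hαβ.mono fun z hz => by simp only [hz])
    simp_rw [this]
    exact ((hβ.comp_measurable measurable_snd).smul (J.M_meas f)).integral_prod_right'
  bound s := weighted_norm_le _ _ J.hi_pos.le _ _

theorem K_ae (hαm : Measurable α) (hα : Integrable α) (s : ℝ) (f : Lp ℝ 2 ν) :
    (∀ᵐ x ∂ν, Integrable fun z => α z * (J.coeff s z x * f (x - J.shift z))) ∧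
      J.K hα s f =ᵐ[ν] fun x => ∫ z, α z * (J.coeff s z x * f (x - J.shift z)) := by
  refine integral_Lp_ae (F := fun z => α z • J.S ν s z f)
    (G := fun p : Space d × X => α p.1 * (J.coeff s p.1 p.2 * f (p.2 - J.shift p.1)))
    ((hαm.comp measurable_fst).mul ((J.jointS_meas f).comp
      ((measurable_const.prodMk measurable_fst).prodMk measurable_snd)))
    (fun z => ?_) (J.S_integrable hα s f)
  filter_upwards [Lp.coeFn_smul (α z) (J.S ν s z f), J.S_ae s z f] with x h1 h2
  rw [h1, Pi.smul_apply, h2, smul_eq_mul]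

theorem N_ae (hαm : Measurable α) (hα : Integrable α) (s : ℝ) (f : Lp ℝ 2 ν) :
    (∀ᵐ x ∂ν, Integrable fun z => α z * (J.coeff s z x * f x)) ∧
      J.N hα s f =ᵐ[ν] fun x => ∫ z, α z * (J.coeff s z x * f x) := by
  refine integral_Lp_ae (F := fun z => α z • J.M ν s z f)
    (G := fun p : Space d × X => α p.1 * (J.coeff s p.1 p.2 * f p.2))
    ((hαm.comp measurable_fst).mul ((J.jointM_meas f).comp
      ((measurable_const.prodMk measurable_fst).prodMk measurable_snd)))
    (fun z => ?_) (J.M_integrable hα s f)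
  filter_upwards [Lp.coeFn_smul (α z) (J.M ν s z f), J.M_ae s z f] with x h1 h2
  rw [h1, Pi.smul_apply, h2, smul_eq_mul]

/-- The jump generator `f ↦ ∫ α(z) (S_z f - M_z f) dz`. -/
def gen (hα : Integrable α) (s : ℝ) : Lp ℝ 2 ν →L[ℝ] Lp ℝ 2 ν := J.K hα s - J.N hα s

theorem gen_apply (hα : Integrable α) (s : ℝ) (f : Lp ℝ 2 ν) :
    J.gen hα s f = ∫ z, α z • J.M ν s z (J.tr ν z f - f) := by
  have : J.gen hα s f = J.K hα s f - J.N hα s f := rfl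
  rw [this, K_apply, N_apply, ← integral_sub (J.S_integrable hα s f) (J.M_integrable hα s f)]
  simp_rw [map_sub, smul_sub, S_apply]

theorem gen_family (hα : Integrable α) :
    BddFamily (J.gen (ν := ν) hα) ((∫ z, ‖α z‖) * J.hi + (∫ z, ‖α z‖) * J.hi) where
  meas f := (J.K_family hα).meas f |>.sub ((J.N_family hα).meas f)
  bound s := (norm_sub_le _ _).trans (add_le_add ((J.K_family hα).bound s) ((J.N_family hα).bound s))

theorem gen_ae (hαm : Measurable α) (hα : Integrable α) (s : ℝ) (f : Lp ℝ 2 ν) :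
    J.gen hα s f =ᵐ[ν] fun x => ∫ z, α z * (J.coeff s z x * (f (x - J.shift z) - f x)) := by
  have h1 := J.K_ae hαm hα s f
  have h2 := J.N_ae hαm hα s f
  filter_upwards [h1.1, h1.2, h2.1, h2.2, Lp.coeFn_sub (J.K hα s f) (J.N hα s f)] with x a1 a2 b1 b2 hs
  have : J.gen hα s f = J.K hα s f - J.N hα s f := rfl
  rw [this, hs, Pi.sub_apply, a2, b2, ← integral_sub a1 b1]
  congr 1; ext z; ring

theorem inner_M_comm (s : ℝ) (z : Space d) (f g : Lp ℝ 2 ν) :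
    inner ℝ f (J.M ν s z g) = inner ℝ (J.M ν s z f) g := by
  rw [L2.inner_def, L2.inner_def]
  refine integral_congr_ae ?_
  filter_upwards [J.M_ae s z f, J.M_ae s z g] with x h1 h2
  rw [h1, h2]
  simp only [RCLike.inner_apply, conj_trivial]
  ring

/-- This is the field `symm` in operator form: translation by `z` carries the intensity of the jump
`-z` to that of `z`. -/
theorem tr_M_neg (s : ℝ) (z : Space d) (f : Lp ℝ 2 ν) :
    J.tr ν z (J.M ν s (-z) f) = J.M ν s z (J.tr ν z f) := by
  refine Lp.ext ?_
  have hq := (measurePreserving_sub_right ν (J.shift z)).quasiMeasurePreserving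
  filter_upwards [J.tr_ae z (J.M ν s (-z) f), hq.ae (J.M_ae s (-z) f), J.M_ae s z (J.tr ν z f),
    J.tr_ae z f] with x h1 h2 h3 h4
  rw [h1, h2, h3, h4, J.symm]

theorem tr_tr_neg (z : Space d) (f : Lp ℝ 2 ν) : J.tr ν z (J.tr ν (-z) f) = f := by
  refine Lp.ext ?_
  have hq := (measurePreserving_sub_right ν (J.shift z)).quasiMeasurePreserving
  filter_upwards [J.tr_ae z (J.tr ν (-z) f), hq.ae (J.tr_ae (-z) f)] with x h1 h2
  rw [h1, h2, J.shift_neg]; simp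

/-- Jumps by `z` and `-z` are adjoint to each other. -/
theorem inner_S_neg (s : ℝ) (z : Space d) (f g : Lp ℝ 2 ν) :
    inner ℝ g (J.S ν s (-z) f) = inner ℝ (J.S ν s z g) f := by
  rw [← (J.tr ν z).inner_map_map, S_apply, tr_M_neg, tr_tr_neg, S_apply, inner_M_comm]

theorem inner_M_neg (s : ℝ) (z : Space d) (f g : Lp ℝ 2 ν) :
    inner ℝ g (J.M ν s (-z) f) = inner ℝ (J.tr ν z g) (J.M ν s z (J.tr ν z f)) := by
  rw [← (J.tr ν z).inner_map_map, tr_M_neg]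

theorem inner_M_ge (s : ℝ) (z : Space d) (f : Lp ℝ 2 ν) :
    J.lo * ‖f‖ ^ 2 ≤ inner ℝ f (J.M ν s z f) := by
  rw [← real_inner_self_eq_norm_sq, L2.inner_def, L2.inner_def, ← integral_const_mul]
  refine integral_mono_ae ((L2.integrable_inner f f).const_mul _) (L2.integrable_inner _ _) ?_
  filter_upwards [J.M_ae s z f] with x h1
  rw [h1]
  simp only [RCLike.inner_apply, conj_trivial]
  have := mul_le_mul_of_nonneg_right (J.lo_le s z x) (mul_self_nonneg (f x))
  linarith

theorem integrable_inner_M (hα : Integrable α) (s : ℝ) (f g : Lp ℝ 2 ν) :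
    Integrable fun z => α z * inner ℝ f (J.M ν s z g) := by
  have := (J.M_integrable hα s g).const_inner (𝕜 := ℝ) f
  simpa [inner_smul_right] using this

theorem integrable_inner_S (hα : Integrable α) (s : ℝ) (f g : Lp ℝ 2 ν) :
    Integrable fun z => α z * inner ℝ f (J.S ν s z g) := by
  have := (J.S_integrable hα s g).const_inner (𝕜 := ℝ) f
  simpa [inner_smul_right] using this

theorem inner_K (hα : Integrable α) (s : ℝ) (f g : Lp ℝ 2 ν) :
    inner ℝ f (J.K hα s g) = ∫ z, α z * inner ℝ f (J.S ν s z g) := by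
  rw [K_apply, ← integral_inner (J.S_integrable hα s g)]
  simp_rw [inner_smul_right]

theorem inner_N (hα : Integrable α) (s : ℝ) (f g : Lp ℝ 2 ν) :
    inner ℝ f (J.N hα s g) = ∫ z, α z * inner ℝ f (J.M ν s z g) := by
  rw [N_apply, ← integral_inner (J.M_integrable hα s g)]
  simp_rw [inner_smul_right]

/-- The jump energy `∫ coeff(z, x) (f(x - z) - f(x))² dx`. -/
def energy (s : ℝ) (z : Space d) (f : Lp ℝ 2 ν) : ℝ :=
  inner ℝ (J.tr ν z f - f) (J.M ν s z (J.tr ν z f - f))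

/-- Expanding the square, the terms in which both factors or the left factor are translated become
terms of the reverse jump `-z` by translation invariance. In this form the energy is a sum of a
function of `z` and its reflection. -/
theorem energy_eq (s : ℝ) (z : Space d) (f : Lp ℝ 2 ν) :
    J.energy s z f = inner ℝ f (J.M ν s (-z) f) - inner ℝ f (J.S ν s (-z) f) +
      (inner ℝ f (J.M ν s z f) - inner ℝ f (J.S ν s z f)) := by
  rw [inner_M_neg, inner_S_neg, energy, S_apply, map_sub, inner_sub_left, inner_sub_right,
    inner_sub_right, inner_M_comm (f := J.tr ν z f) (g := f)]
  ring

/-- Reflection `z ↦ -z` leaves the even weight and Lebesgue measure unchanged, so the two halves of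
`energy_eq` have equal integrals, each equal to minus the quadratic form of the generator. -/
theorem inner_gen (hα : Integrable α) (heven : ∀ z, α (-z) = α z) (s : ℝ) (f : Lp ℝ 2 ν) :
    Integrable (fun z => α z * J.energy s z f) ∧
      inner ℝ f (J.gen hα s f) = -(1 / 2) * ∫ z, α z * J.energy s z f := by
  set e : Space d → ℝ := fun z => α z * inner ℝ f (J.M ν s z f) - α z * inner ℝ f (J.S ν s z f) with he
  have hie : Integrable e := (J.integrable_inner_M hα s f f).sub (J.integrable_inner_S hα s f f)
  have h : ∀ z, α z * J.energy s z f = e (-z) + e z := fun z => by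
    simp only [he, heven]; rw [energy_eq]; ring
  simp_rw [h]
  refine ⟨hie.comp_neg.add hie, ?_⟩
  rw [integral_add hie.comp_neg hie, integral_neg_eq_self e volume]
  have : J.gen hα s f = J.K hα s f - J.N hα s f := rfl
  rw [this, inner_sub_right, inner_K, inner_N, he,
    integral_sub (J.integrable_inner_M hα s f f) (J.integrable_inner_S hα s f f)]
  ring

theorem energy_ge (s : ℝ) (z : Space d) (f : Lp ℝ 2 ν) :
    J.lo * ‖J.tr ν z f - f‖ ^ 2 ≤ J.energy s z f := J.inner_M_ge s z _

theorem gen_dissipative (hα : Integrable α) (hα0 : ∀ z, 0 ≤ α z) (heven : ∀ z, α (-z) = α z) (s : ℝ)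
    (f : Lp ℝ 2 ν) : inner ℝ f (J.gen hα s f) ≤ 0 := by
  rw [(J.inner_gen hα heven s f).2]
  have : 0 ≤ ∫ z, α z * J.energy s z f := integral_nonneg fun z => mul_nonneg (hα0 z)
    ((mul_nonneg J.lo_pos.le (sq_nonneg _)).trans (J.energy_ge s z f))
  linarith

end JumpKernel

end NonlocalHomogenization

/-! ### The torus, Fourier series and a nonlocal Poincaré inequality -/

namespace NonlocalHomogenization

section Torus

variable {d : ℕ}

theorem torusProj_measurable : Measurable (torusProj (d := d)) :=
  measurable_pi_lambda _ fun i => AddCircle.measurable_mk'.comp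
    (by fun_prop : Measurable fun ξ : Space d => ξ i)

theorem torusProj_add (x y : Space d) : torusProj (x + y) = torusProj x + torusProj y := by
  funext i; simp [torusProj]

theorem torusProj_neg (x : Space d) : torusProj (-x) = -torusProj x := by
  funext i; simp [torusProj]

theorem torusProj_sub (x y : Space d) : torusProj (x - y) = torusProj x - torusProj y := by
  funext i; simp [torusProj]

instance : IsProbabilityMeasure (volume : Measure (UnitAddTorus (Fin d))) := by
  have : IsProbabilityMeasure (volume : Measure UnitAddCircle) := ⟨UnitAddCircle.measure_univ⟩
  exact inferInstanceAs (IsProbabilityMeasure (Measure.pi fun _ : Fin d => (volume : Measure UnitAddCircle)))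

theorem measurableSet_unitCell : MeasurableSet (unitCell d) := by
  have : unitCell d = ⋂ i, {ξ : Space d | ξ i ∈ Ico (0 : ℝ) 1} := by
    ext; simp [unitCell]
  rw [this]
  exact MeasurableSet.iInter fun i => measurableSet_Ico.preimage
    (by fun_prop : Measurable fun ξ : Space d => ξ i)

theorem measurePreserving_torusProj :
    MeasurePreserving (torusProj (d := d)) (volume.restrict (unitCell d)) volume := by
  have h1 : MeasurePreserving (fun x : ℝ => (x : UnitAddCircle)) (volume.restrict (Ico 0 1)) volume := by
    have := UnitAddCircle.measurePreserving_mk 0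
    rwa [zero_add, ← restrict_Ico_eq_restrict_Ioc] at this
  have h2 := measurePreserving_pi (fun _ : Fin d => (volume : Measure ℝ).restrict (Ico 0 1))
    (fun _ => (volume : Measure UnitAddCircle)) (fun _ => h1)
  rw [← Measure.restrict_pi_pi] at h2
  have h3 := (PiLp.volume_preserving_ofLp (Fin d)).restrict_preimage
    (MeasurableSet.univ_pi fun _ : Fin d => measurableSet_Ico (a := (0 : ℝ)) (b := 1))
  have h4 : (WithLp.ofLp : Space d → Fin d → ℝ) ⁻¹' (univ.pi fun _ => Ico (0 : ℝ) 1) = unitCell d := by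
    ext x; simp [unitCell]
  rw [h4] at h3
  exact h2.comp h3

theorem volume_unitCell : volume (unitCell d) = 1 := by
  have := (measurePreserving_torusProj (d := d)).measure_preimage MeasurableSet.univ.nullMeasurableSet
  simpa using this

instance : IsProbabilityMeasure ((volume : Measure (Space d)).restrict (unitCell d)) :=
  ⟨by rw [Measure.restrict_apply_univ, volume_unitCell]⟩

/-- The representative in the unit cell of a point of the torus. -/
def torusLift (ξ : UnitAddTorus (Fin d)) : Space d :=
  WithLp.toLp 2 fun i => (AddCircle.measurableEquivIco 1 0 (ξ i) : ℝ)

theorem torusLift_measurable : Measurable (torusLift (d := d)) := by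
  refine (WithLp.measurable_toLp 2 (Fin d → ℝ)).comp (measurable_pi_lambda _ fun i => ?_)
  exact measurable_subtype_coe.comp ((AddCircle.measurableEquivIco 1 0).measurable.comp (measurable_pi_apply i))

theorem torusProj_torusLift (ξ : UnitAddTorus (Fin d)) : torusProj (torusLift ξ) = ξ := by
  funext i
  exact (AddCircle.equivIco 1 0).symm_apply_apply (ξ i)

theorem torusLift_torusProj (x : Space d) :
    ∃ n : Fin d → ℤ, torusLift (torusProj x) = x + WithLp.toLp 2 fun i => (n i : ℝ) := by
  refine ⟨fun i => -⌊x i⌋, ?_⟩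
  ext i
  have : torusLift (torusProj x) i = Int.fract (x i) := by
    have := AddCircle.coe_equivIco_mk_apply (1 : ℝ) (x i)
    simp only [div_one, mul_one] at this
    exact this
  rw [this]
  simp [Int.fract, sub_eq_add_neg]

theorem periodic_add_int {β : Type*} {f : Space d → β}
    (hf : ∀ i x, f (x + EuclideanSpace.single i 1) = f x) (n : Fin d → ℤ) (x : Space d) :
    f (x + WithLp.toLp 2 fun i => (n i : ℝ)) = f x := by
  have h1 : ∀ i (m : ℕ) x, f (x + (m : ℝ) • EuclideanSpace.single i 1) = f x := by
    intro i m
    induction m with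
    | zero => simp
    | succ m ih => intro x; rw [Nat.cast_succ, add_smul, one_smul, ← add_assoc, hf, ih]
  have h2 : ∀ i (m : ℤ) x, f (x + (m : ℝ) • EuclideanSpace.single i 1) = f x := by
    intro i m x
    obtain ⟨k, rfl | rfl⟩ := m.eq_nat_or_neg
    · exact_mod_cast h1 i k x
    · rw [← h1 i k (x + _)]; congr 1; push_cast; rw [neg_smul]; abel
  have h3 : ∀ (s : Finset (Fin d)) x, f (x + ∑ i ∈ s, (n i : ℝ) • EuclideanSpace.single i 1) = f x := by
    intro s
    induction s using Finset.induction_on with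
    | empty => simp
    | insert i s hi ih => intro x; rw [Finset.sum_insert hi, ← add_assoc, ih, h2]
  rw [← h3 Finset.univ x]
  congr 2
  ext j
  simp [Finset.sum_apply, Pi.single_apply]

theorem periodic_torusLift {β : Type*} {f : Space d → β}
    (hf : ∀ i x, f (x + EuclideanSpace.single i 1) = f x) (x : Space d) :
    f (torusLift (torusProj x)) = f x := by
  obtain ⟨n, hn⟩ := torusLift_torusProj x
  rw [hn, periodic_add_int hf]

/-- The preimage of a null set is covered by countably many integer translates of its part in the
unit cell, which is null. This carries a.e. statements from the torus to the whole space. -/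
theorem quasiMeasurePreserving_torusProj :
    Measure.QuasiMeasurePreserving (torusProj (d := d)) volume volume := by
  refine ⟨torusProj_measurable, Measure.AbsolutelyContinuous.mk fun N hN hN0 => ?_⟩
  rw [Measure.map_apply torusProj_measurable hN]
  have hcell : volume (torusProj ⁻¹' N ∩ unitCell d) = 0 := by
    rw [← Measure.restrict_apply (torusProj_measurable hN),
      measurePreserving_torusProj.measure_preimage hN.nullMeasurableSet, hN0]
  let v : (Fin d → ℤ) → Space d := fun n => WithLp.toLp 2 fun i => (n i : ℝ)
  have hproj : ∀ n x, torusProj (x + v n) = torusProj x := fun n x => by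
    refine periodic_add_int (fun i x => ?_) n x
    funext j
    simp only [torusProj, PiLp.add_apply, PiLp.single_apply]
    split_ifs <;> simp
  have hcov : torusProj ⁻¹' N ⊆ ⋃ n, (fun x => x + v n) ⁻¹' (torusProj ⁻¹' N ∩ unitCell d) := by
    intro x hx
    refine mem_iUnion.2 ⟨fun i => -⌊x i⌋, ?_, fun i => ?_⟩
    · rw [mem_preimage, hproj]; exact hx
    · have : (x + v fun i => -⌊x i⌋) i = Int.fract (x i) := by
        simp [v, Int.fract, sub_eq_add_neg]
      rw [this]
      exact ⟨Int.fract_nonneg _, Int.fract_lt_one _⟩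
  refine measure_mono_null hcov (measure_iUnion_null fun n => ?_)
  rw [measure_preimage_add_right, hcell]

theorem hyperplane_null {p : Space d} (hp : p ≠ 0) (c : ℝ) :
    volume {z : Space d | inner ℝ p z = c} = 0 := by
  by_cases h : ∃ z₀ : Space d, inner ℝ p z₀ = c
  · obtain ⟨z₀, hz₀⟩ := h
    have hk : (innerSL ℝ p).ker ≠ ⊤ := by
      intro hk
      have : p ∈ (innerSL ℝ p).ker := by rw [hk]; trivial
      rw [LinearMap.mem_ker] at this
      exact hp (inner_self_eq_zero.1 this)
    have h0 := Measure.addHaar_submodule (volume : Measure (Space d)) _ hk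
    have e : {z : Space d | inner ℝ p z = c} = (fun z => z + (-z₀)) ⁻¹' ((innerSL ℝ p).ker : Set (Space d)) := by
      ext z
      simp only [mem_ofPred_eq, mem_preimage, SetLike.mem_coe]
      have : (z + -z₀ ∈ (innerSL ℝ p).ker) ↔ inner ℝ p (z + -z₀) = 0 := Iff.rfl
      rw [this, inner_add_right, inner_neg_right, hz₀]
      constructor <;> intro h <;> linarith
    rw [e, measure_preimage_add_right, h0]
  · have : {z : Space d | inner ℝ p z = c} = ∅ := by
      ext z; simp only [mem_ofPred_eq, mem_empty_iff_false, iff_false]; exact fun hz => h ⟨z, hz⟩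
    simp [this]

/-- The circle has length one, so Lebesgue measure is the normalised Haar measure for which
Parseval's identity is formulated. -/
theorem parseval_torus {f : UnitAddTorus (Fin d) → ℂ} (hf : MemLp f 2 volume) :
    HasSum (fun n => ‖∫ t, UnitAddTorus.mFourier (-n) t * f t‖ ^ 2) (∫ t, ‖f t‖ ^ 2) := by
  have hc : (volume : Measure UnitAddCircle) = AddCircle.haarAddCircle := by
    rw [AddCircle.volume_eq_smul_haarAddCircle]; simp
  have hvol : (volume : Measure (UnitAddTorus (Fin d))) =
      Measure.pi fun _ : Fin d => (AddCircle.haarAddCircle : Measure UnitAddCircle) := by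
    rw [volume_pi, hc]
  rw [hvol] at hf ⊢
  have h := UnitAddTorus.hasSum_sq_mFourierCoeff (d := Fin d) (hf.toLp f)
  have e2 : ∫ t, ‖hf.toLp f t‖ ^ 2 ∂(Measure.pi fun _ : Fin d => (AddCircle.haarAddCircle : Measure UnitAddCircle)) =
      ∫ t, ‖f t‖ ^ 2 ∂(Measure.pi fun _ : Fin d => (AddCircle.haarAddCircle : Measure UnitAddCircle)) :=
    integral_congr_ae (hf.coeFn_toLp.mono fun t ht => by simp only [ht])
  have e1 : ∀ n, UnitAddTorus.mFourierCoeff (hf.toLp f) n =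
      ∫ t, UnitAddTorus.mFourier (-n) t * f t ∂(Measure.pi fun _ : Fin d => (AddCircle.haarAddCircle : Measure UnitAddCircle)) :=
    fun n => integral_congr_ae (hf.coeFn_toLp.mono fun t ht => by simp only [ht, smul_eq_mul])
  simp_rw [e1] at h
  rw [← e2]
  exact h

theorem mFourier_add_arg (n : Fin d → ℤ) (x y : UnitAddTorus (Fin d)) :
    UnitAddTorus.mFourier n (x + y) = UnitAddTorus.mFourier n x * UnitAddTorus.mFourier n y := by
  simp only [UnitAddTorus.mFourier, ContinuousMap.coe_mk, ← Finset.prod_mul_distrib, Pi.add_apply,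
    fourier_apply, smul_add, AddCircle.toCircle_add, Circle.coe_mul]

theorem mFourier_torusProj (n : Fin d → ℤ) (z : Space d) :
    UnitAddTorus.mFourier (-n) (torusProj z) =
      Real.fourierChar (-inner ℝ z (WithLp.toLp 2 fun i => (n i : ℝ) : Space d)) := by
  rw [Real.fourierChar_apply]
  simp only [UnitAddTorus.mFourier, ContinuousMap.coe_mk, torusProj, fourier_coe_apply]
  rw [← Complex.exp_sum]
  congr 1
  simp only [PiLp.inner_apply, RCLike.inner_apply, conj_trivial]
  push_cast
  rw [← Finset.sum_neg_distrib, Finset.mul_sum, Finset.sum_mul]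
  refine Finset.sum_congr rfl fun i _ => ?_
  simp
  ring

/-- The symbol of the jump operator with kernel `a` is bounded away from zero off the constants. -/
theorem exists_symbol_lower_bound {a : Space d → ℝ} (ha : Integrable a) (ha0 : ∀ z, 0 ≤ a z)
    (ha1 : ∫ z, a z = 1) : ∃ lam : ℝ, 0 < lam ∧ ∀ n : Fin d → ℤ, n ≠ 0 →
      lam ≤ ∫ z, a z * ‖UnitAddTorus.mFourier (-n) (torusProj z) - 1‖ ^ 2 := by
  set v : (Fin d → ℤ) → Space d := fun n => WithLp.toLp 2 fun i => (n i : ℝ) with hv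
  set γ : (Fin d → ℤ) → ℝ := fun n => ∫ z, a z * ‖UnitAddTorus.mFourier (-n) (torusProj z) - 1‖ ^ 2
  have hsq : ∀ n z, ‖UnitAddTorus.mFourier (-n) (torusProj z) - 1‖ ^ 2 =
      2 - 2 * ((Real.fourierChar (-inner ℝ z (v n)) : ℂ)).re := by
    intro n z
    rw [mFourier_torusProj]
    set w : Circle := Real.fourierChar (-inner ℝ z (v n))
    have h1 : ‖(w : ℂ)‖ = 1 := Circle.norm_coe w
    have h2 : (w : ℂ).re ^ 2 + (w : ℂ).im ^ 2 = 1 := by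
      have := Complex.sq_norm (w : ℂ)
      rw [h1, Complex.normSq_apply] at this; nlinarith
    rw [Complex.sq_norm, Complex.normSq_apply]
    simp only [Complex.sub_re, Complex.one_re, Complex.sub_im, Complex.one_im, sub_zero]
    nlinarith
  have hint : ∀ n, Integrable fun z => Real.fourierChar (-inner ℝ z (v n)) • (a z : ℂ) := fun n => by
    have := (Real.fourierIntegral_convergent_iff (μ := volume) (f := fun z => (a z : ℂ)) (v n)).2 ha.ofReal
    exact this
  have hγ : ∀ n, γ n = 2 - 2 * (∫ z, Real.fourierChar (-inner ℝ z (v n)) • (a z : ℂ)).re := by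
    intro n
    have : (∫ z, Real.fourierChar (-inner ℝ z (v n)) • (a z : ℂ)).re =
        ∫ z, (Real.fourierChar (-inner ℝ z (v n)) • (a z : ℂ)).re :=
      (integral_re (hint n)).symm
    have h2 : (2 : ℝ) = ∫ z, 2 * a z := by rw [integral_const_mul, ha1, mul_one]
    rw [this, ← integral_const_mul]
    nth_rw 1 [h2]
    have hre : Integrable fun z => (Real.fourierChar (-inner ℝ z (v n)) • (a z : ℂ)).re := (hint n).re
    rw [← integral_sub (ha.const_mul _) (hre.const_mul _)]
    refine integral_congr_ae (ae_of_all _ fun z => ?_)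
    simp only [hsq, Circle.smul_def, smul_eq_mul, Complex.re_mul_ofReal]
    ring
  have hpos : ∀ n, n ≠ 0 → 0 < γ n := by
    intro n hn
    have hvn : v n ≠ 0 := by
      intro h0; apply hn; funext i
      have := congrArg (fun x : Space d => x i) h0
      simpa [hv] using this
    have hnn : ∀ z, 0 ≤ a z * ‖UnitAddTorus.mFourier (-n) (torusProj z) - 1‖ ^ 2 := fun z =>
      mul_nonneg (ha0 z) (sq_nonneg _)
    refine lt_of_le_of_ne (integral_nonneg hnn) fun h0 => ?_
    have hi : Integrable fun z => a z * ‖UnitAddTorus.mFourier (-n) (torusProj z) - 1‖ ^ 2 := by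
      have : ∀ z, a z * ‖UnitAddTorus.mFourier (-n) (torusProj z) - 1‖ ^ 2 =
          2 * a z - 2 * (Real.fourierChar (-inner ℝ z (v n)) • (a z : ℂ)).re := fun z => by
        simp only [hsq, Circle.smul_def, smul_eq_mul, Complex.re_mul_ofReal]; ring
      simp_rw [this]
      exact (ha.const_mul _).sub ((hint n).re.const_mul _)
    have h1 := (integral_eq_zero_iff_of_nonneg hnn hi).1 h0.symm
    -- A character equals 1 at `z` only if `⟨v n, z⟩` is an integer. These points form countably
    -- many parallel hyperplanes, too small to carry a probability density.
    have hnull : volume (⋃ m : ℤ, {z : Space d | inner ℝ (v n) z = m}) = 0 :=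
      measure_iUnion_null fun m => hyperplane_null hvn m
    have h2 : ∀ᵐ z : Space d, z ∉ ⋃ m : ℤ, {z : Space d | inner ℝ (v n) z = m} :=
      measure_eq_zero_iff_ae_notMem.1 hnull
    have h3 : a =ᵐ[volume] 0 := by
      filter_upwards [h1, h2] with z hz1 hz2
      rcases mul_eq_zero.1 hz1 with h | h
      · exact h
      · exfalso
        apply hz2
        have h4 : UnitAddTorus.mFourier (-n) (torusProj z) = 1 := by
          have := pow_eq_zero_iff (two_ne_zero) |>.1 h
          exact sub_eq_zero.1 (norm_eq_zero.1 this)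
        rw [mFourier_torusProj, Real.fourierChar_apply, Complex.exp_eq_one_iff] at h4
        obtain ⟨k, hk⟩ := h4
        refine mem_iUnion.2 ⟨-k, ?_⟩
        have h5 : (2 * Real.pi * -inner ℝ z (v n) : ℝ) = 2 * Real.pi * k := by
          have h6 : ((2 * Real.pi * -inner ℝ z (v n) : ℝ) : ℂ) * Complex.I =
            ((2 * Real.pi * k : ℝ) : ℂ) * Complex.I := by rw [hk]; push_cast; ring
          exact_mod_cast mul_right_cancel₀ Complex.I_ne_zero h6
        have h7 := mul_left_cancel₀ (by positivity : (2 * Real.pi) ≠ 0) h5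
        show inner ℝ (v n) z = ((-k : ℤ) : ℝ)
        rw [real_inner_comm]; push_cast; linarith
    rw [integral_congr_ae h3] at ha1
    simp at ha1
  have hcof : Tendsto v cofinite (cocompact (Space d)) := by
    have h1 : Topology.IsClosedEmbedding (Pi.map fun (_ : Fin d) (m : ℤ) => (m : ℝ)) :=
      Topology.IsClosedEmbedding.piMap fun _ => Int.isClosedEmbedding_coe_real
    have h2 := h1.tendsto_cocompact
    rw [cocompact_eq_cofinite] at h2
    have h3 := (EuclideanSpace.equiv (Fin d) ℝ).symm.toHomeomorph.isClosedEmbedding.tendsto_cocompact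
    exact h3.comp h2
  -- Riemann–Lebesgue: the oscillating part of the symbol vanishes as the frequency leaves every
  -- compact set.
  have hlim : Tendsto γ cofinite (𝓝 2) := by
    have h1 := (tendsto_integral_exp_inner_smul_cocompact fun z : Space d => (a z : ℂ)).comp hcof
    have h2 := (Complex.continuous_re.tendsto _).comp h1
    have h3 := (h2.const_mul 2).const_sub 2
    simp only [Complex.zero_re, mul_zero, sub_zero] at h3
    exact h3.congr fun n => (hγ n).symm
  have hfin : {n | γ n < 1}.Finite := by
    have := hlim.eventually (lt_mem_nhds (by norm_num : (1 : ℝ) < 2))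
    refine Set.Finite.subset this fun n hn => ?_
    simp only [mem_compl_iff, mem_ofPred_eq] at hn ⊢
    exact fun h => lt_asymm hn h
  -- All but finitely many symbols are at least 1, so the bound is the smaller of 1 and the minimum
  -- over the finite exceptional set, if there is one.
  by_cases hne : ({n | γ n < 1} \ {0}).Nonempty
  · obtain ⟨m, hm, hmin⟩ := (hfin.subset sdiff_subset).exists_minimalFor γ _ hne |>.imp
      fun m hm => (⟨hm.1, fun n hn => by
        rcases le_total (γ m) (γ n) with h | h
        · exact h
        · exact hm.2 hn h⟩ : m ∈ {n | γ n < 1} \ {0} ∧ ∀ n ∈ {n | γ n < 1} \ {0}, γ m ≤ γ n)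
    refine ⟨min 1 (γ m), lt_min one_pos (hpos m hm.2), fun n hn => ?_⟩
    by_cases h : γ n < 1
    · exact (min_le_right _ _).trans (hmin n ⟨h, hn⟩)
    · exact (min_le_left _ _).trans (not_lt.1 h)
  · refine ⟨1, one_pos, fun n hn => ?_⟩
    by_contra h
    exact hne ⟨n, not_le.1 h, hn⟩

/-- Translation by `h` multiplies each Fourier coefficient by the value of the character at `h`;
Parseval's identity does the rest. -/
theorem transL_norm_sq_hasSum (f : L2Torus d) (h : UnitAddTorus (Fin d)) :
    HasSum (fun n => ‖UnitAddTorus.mFourier (-n) h - 1‖ ^ 2 *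
      ‖∫ t, UnitAddTorus.mFourier (-n) t * (f t : ℂ)‖ ^ 2) (‖transL ℝ volume h f - f‖ ^ 2) := by
  have hf : MemLp (fun t => (f t : ℂ)) 2 volume := (Lp.memLp f).ofReal
  have hmp := measurePreserving_sub_right (volume : Measure (UnitAddTorus (Fin d))) h
  have hfh : MemLp (fun t => (f (t - h) : ℂ)) 2 volume := hf.comp_measurePreserving hmp
  have hp := parseval_torus (hfh.sub hf)
  have e1 : ‖transL ℝ volume h f - f‖ ^ 2 = ∫ t, ‖((fun t => (f (t - h) : ℂ)) - fun t => (f t : ℂ)) t‖ ^ 2 := by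
    rw [← real_inner_self_eq_norm_sq, L2.inner_def]
    refine integral_congr_ae ?_
    filter_upwards [Lp.coeFn_sub (transL ℝ volume h f) f, transL_ae (𝕜 := ℝ) h f] with t h1 h2
    rw [h1, Pi.sub_apply, h2]
    simp only [Pi.sub_apply, ← Complex.ofReal_sub, Complex.norm_real, RCLike.inner_apply, conj_trivial,
      Real.norm_eq_abs, sq_abs]
    ring
  rw [e1]
  convert hp using 2 with n
  rw [← mul_pow, ← norm_mul, sub_mul, one_mul]
  have hi : ∀ {g : UnitAddTorus (Fin d) → ℂ}, MemLp g 2 volume →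
      Integrable fun t => UnitAddTorus.mFourier (-n) t * g t := fun hg => by
    refine (hg.integrable (by norm_num)).bdd_mul
      (UnitAddTorus.mFourier (-n)).continuous.aestronglyMeasurable (c := 1) (ae_of_all _ fun t => ?_)
    exact ((UnitAddTorus.mFourier (-n)).norm_coe_le_norm t).trans UnitAddTorus.mFourier_norm.le
  have e2 : ∫ t, UnitAddTorus.mFourier (-n) t * (f (t - h) : ℂ) =
      UnitAddTorus.mFourier (-n) h * ∫ t, UnitAddTorus.mFourier (-n) t * (f t : ℂ) := by
    rw [← integral_const_mul, ← integral_sub_right_eq_self (fun t => UnitAddTorus.mFourier (-n) h *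
      (UnitAddTorus.mFourier (-n) t * (f t : ℂ))) h]
    refine integral_congr_ae (ae_of_all _ fun t => ?_)
    simp only
    rw [← mul_assoc, ← mFourier_add_arg, add_sub_cancel]
  simp only [Pi.sub_apply, mul_sub]
  rw [integral_sub (hi hfh) (hi hf), e2]

theorem transL_meas {f : L2Torus d} :
    StronglyMeasurable fun z : Space d => transL ℝ volume (torusProj z) f :=
  stronglyMeasurable_Lp_of_joint (G := fun p : Space d × UnitAddTorus (Fin d) => f (p.2 - torusProj p.1))
    ((Lp.stronglyMeasurable f).measurable.comp
      (measurable_snd.sub (torusProj_measurable.comp measurable_fst))) fun _ => transL_ae _ f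

/-- Poincaré inequality for the nonlocal Dirichlet form on the torus. -/
theorem exists_spectral_gap {a : Space d → ℝ} (ha : Integrable a) (ha0 : ∀ z, 0 ≤ a z)
    (ha1 : ∫ z, a z = 1) : ∃ lam : ℝ, 0 < lam ∧ ∀ f : L2Torus d,
      lam * (‖f‖ ^ 2 - (∫ x, f x) ^ 2) ≤
        ∫ z, a z * ‖transL ℝ volume (torusProj z) f - f‖ ^ 2 := by
  obtain ⟨lam, hlam, hγ⟩ := exists_symbol_lower_bound ha ha0 ha1
  refine ⟨lam, hlam, fun f => ?_⟩
  set c : (Fin d → ℤ) → ℝ := fun n => ‖∫ t, UnitAddTorus.mFourier (-n) t * (f t : ℂ)‖ ^ 2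
  have hf : MemLp (fun t => (f t : ℂ)) 2 volume := (Lp.memLp f).ofReal
  have hpar : HasSum c (‖f‖ ^ 2) := by
    have := parseval_torus hf
    convert this using 1
    rw [← real_inner_self_eq_norm_sq, L2.inner_def]
    refine integral_congr_ae (ae_of_all _ fun t => ?_)
    simp only [Complex.norm_real, RCLike.inner_apply, conj_trivial, Real.norm_eq_abs, sq_abs]
    ring
  have hc0 : c 0 = (∫ x, f x) ^ 2 := by
    simp only [c, neg_zero, UnitAddTorus.mFourier_zero, ContinuousMap.one_apply, one_mul]
    have : ∫ t, (f t : ℂ) = ((∫ t, f t : ℝ) : ℂ) := integral_ofReal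
    rw [this, Complex.norm_real, Real.norm_eq_abs, sq_abs]
  have hint : Integrable fun z => a z * ‖transL ℝ volume (torusProj z) f - f‖ ^ 2 := by
    refine Integrable.mono' (ha.norm.mul_const ((2 * ‖f‖) ^ 2))
      (ha.aestronglyMeasurable.mul ((transL_meas.sub stronglyMeasurable_const).norm.pow 2).aestronglyMeasurable)
      (ae_of_all _ fun z => ?_)
    rw [norm_mul]
    refine mul_le_mul_of_nonneg_left ?_ (norm_nonneg _)
    rw [Real.norm_of_nonneg (by positivity)]
    gcongr
    refine (norm_sub_le _ _).trans ?_
    rw [LinearIsometry.norm_map]; linarith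
  set B := ∫ z, a z * ‖transL ℝ volume (torusProj z) f - f‖ ^ 2
  have hintn : ∀ n, Integrable fun z => a z * ‖UnitAddTorus.mFourier (-n) (torusProj z) - 1‖ ^ 2 := fun n => by
    refine ha.mul_bdd (c := 4) ?_ (ae_of_all _ fun z => ?_)
    · exact ((((UnitAddTorus.mFourier (-n)).continuous.measurable.comp torusProj_measurable).sub_const
        1).norm.pow_const 2).aestronglyMeasurable
    · rw [Real.norm_of_nonneg (by positivity)]
      have h1 : ‖UnitAddTorus.mFourier (-n) (torusProj z)‖ ≤ 1 :=
        ((UnitAddTorus.mFourier (-n)).norm_coe_le_norm _).trans UnitAddTorus.mFourier_norm.le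
      have h2 : ‖UnitAddTorus.mFourier (-n) (torusProj z) - 1‖ ≤ 2 := by
        refine (norm_sub_le _ _).trans ?_
        rw [norm_one]; linarith
      nlinarith [norm_nonneg (UnitAddTorus.mFourier (-n) (torusProj z) - 1)]
  -- Working with finite sums of modes lets sum and integral be exchanged freely. The zero mode is
  -- left out since its symbol vanishes.
  have hpart : ∀ s : Finset (Fin d → ℤ), lam * ∑ n ∈ s.erase 0, c n ≤ B := by
    intro s
    calc lam * ∑ n ∈ s.erase 0, c n = ∑ n ∈ s.erase 0, lam * c n := Finset.mul_sum _ _ _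
      _ ≤ ∑ n ∈ s.erase 0, (∫ z, a z * ‖UnitAddTorus.mFourier (-n) (torusProj z) - 1‖ ^ 2) * c n :=
        Finset.sum_le_sum fun n hn =>
          mul_le_mul_of_nonneg_right (hγ n (Finset.ne_of_mem_erase hn)) (sq_nonneg _)
      _ = ∫ z, ∑ n ∈ s.erase 0, (a z * ‖UnitAddTorus.mFourier (-n) (torusProj z) - 1‖ ^ 2) * c n := by
        rw [integral_finsetSum _ fun n _ => (hintn n).mul_const _]
        simp_rw [integral_mul_const]
      _ ≤ B := by
        refine integral_mono (integrable_finsetSum _ fun n _ => (hintn n).mul_const _) hint fun z => ?_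
        simp only [mul_assoc]
        rw [← Finset.mul_sum]
        exact mul_le_mul_of_nonneg_left
          (sum_le_hasSum _ (fun n _ => by positivity) (transL_norm_sq_hasSum f (torusProj z))) (ha0 z)
  have hfinal : ‖f‖ ^ 2 ≤ c 0 + B / lam := by
    refine hasSum_le_of_sum_le hpar fun s => ?_
    have h1 : ∑ n ∈ s, c n ≤ c 0 + ∑ n ∈ s.erase 0, c n := by
      by_cases h : (0 : Fin d → ℤ) ∈ s
      · rw [Finset.add_sum_erase s c h]
      · rw [Finset.erase_eq_of_notMem h]
        have : 0 ≤ c 0 := sq_nonneg _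
        linarith
    have h2 := hpart s
    have h3 : ∑ n ∈ s.erase 0, c n ≤ B / lam := by rw [le_div_iff₀ hlam, mul_comm]; exact h2
    linarith
  rw [hc0] at hfinal
  have h3 : ‖f‖ ^ 2 - (∫ x, f x) ^ 2 ≤ B / lam := by linarith
  rwa [le_div_iff₀ hlam, mul_comm] at h3

end Torus

end NonlocalHomogenization

/-! ### The cell problem: periodic solutions on the torus -/

namespace NonlocalHomogenization

/-- Periodicity of the primitive makes the integral of `f` over one period vanish, so an identity on
one period extends to all times. -/
theorem primitive_of_periodic {E : Type*} [NormedAddCommGroup E] [NormedSpace ℝ E] {x f : ℝ → E}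
    (hx : Function.Periodic x 1) (hf : Function.Periodic f 1) (hi : IntervalIntegrable f volume 0 1)
    (h : ∀ s ∈ Icc (0 : ℝ) 1, x s = x 0 + ∫ r in (0 : ℝ)..s, f r) :
    (∀ a b, IntervalIntegrable f volume a b) ∧ ∀ s, x s = x 0 + ∫ r in (0 : ℝ)..s, f r := by
  have hii : ∀ a b, IntervalIntegrable f volume a b := fun a b =>
    hf.intervalIntegrable₀ one_ne_zero hi a b
  refine ⟨hii, fun s => ?_⟩
  have h0 : ∫ r in (0 : ℝ)..1, f r = 0 := by
    have h1 := h 1 ⟨zero_le_one, le_rfl⟩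
    have : x 1 = x 0 := by simpa using hx 0
    rw [this] at h1
    simpa using h1
  have h1 := hf.intervalIntegral_add_zsmul_eq ⌊s⌋ (Int.fract s) hii
  have h2 : Int.fract s + ⌊s⌋ • (1 : ℝ) = s := by simp
  rw [h2, hf.intervalIntegral_add_eq _ 0, zero_add, h0, smul_zero] at h1
  have hfr : Int.fract s ∈ Icc (0 : ℝ) 1 := ⟨Int.fract_nonneg s, (Int.fract_lt_one s).le⟩
  have hxs : x (Int.fract s) = x s := by
    have := hx.sub_zsmul_eq (x := s) ⌊s⌋
    rwa [zsmul_one, Int.self_sub_floor] at this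
  rw [← intervalIntegral.integral_add_adjacent_intervals (hii 0 (Int.fract s)) (hii _ s), h1, add_zero,
    ← h _ hfr, hxs]

section Cell

variable {d : ℕ} {a : Space d → ℝ} {μ : Space d → Space d → ℝ → ℝ}

/-- Shifting `x` by a lattice vector shifts both arguments of `μ`, so for a fixed jump `z` the
intensity descends to the torus although `z` itself ranges over the whole space. -/
theorem Conditions.coeff_eq_of_sub (h : Conditions a μ) {x y : Space d}
    (hxy : torusProj x = torusProj y) (z : Space d) (s : ℝ) : μ x (x - z) s = μ y (y - z) s := by
  have hp : ∀ i x, μ (x + EuclideanSpace.single i 1) (x + EuclideanSpace.single i 1 - z) s =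
      μ x (x - z) s := fun i x => by
    rw [h.coeff_periodic_left, add_sub_right_comm, h.coeff_periodic_right]
  have hl := fun x => periodic_torusLift (f := fun x => μ x (x - z) s) hp x
  rw [← hl x, ← hl y, hxy]

/-- The jump kernel on the torus of the cell problem. -/
def cellKernel (h : Conditions a μ) : JumpKernel d (UnitAddTorus (Fin d)) where
  shift := torusProj
  coeff s z ξ := μ (torusLift ξ) (torusLift ξ - z) s
  lo := h.coeff_elliptic.choose
  hi := h.coeff_elliptic.choose_spec.choose
  shift_meas := torusProj_measurable
  shift_neg := torusProj_neg
  coeff_meas := h.coeff_measurable.comp ((torusLift_measurable.comp measurable_snd).prodMk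
    (((torusLift_measurable.comp measurable_snd).sub (measurable_snd.comp measurable_fst)).prodMk
      (measurable_fst.comp measurable_fst)))
  lo_pos := h.coeff_elliptic.choose_spec.choose_spec.1
  lo_le s z x := (h.coeff_elliptic.choose_spec.choose_spec.2.2 _ _ s).1
  le_hi s z x := (h.coeff_elliptic.choose_spec.choose_spec.2.2 _ _ s).2
  symm s z x := by
    -- The representative of the shifted point may differ from the shifted representative by a
    -- lattice vector, which periodicity removes.
    have h1 := h.coeff_eq_of_sub (x := torusLift (x - torusProj z)) (y := torusLift x - z) (by
      rw [torusProj_torusLift, torusProj_sub, torusProj_torusLift]) (-z) s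
    rw [h1, sub_neg_eq_add, sub_add_cancel, h.coeff_symm]

theorem cellKernel_coeff (h : Conditions a μ) (s : ℝ) (z x : Space d) :
    (cellKernel h).coeff s z (torusProj x) = μ x (x - z) s :=
  h.coeff_eq_of_sub (torusProj_torusLift _) z s

theorem cellKernel_coeff_periodic (h : Conditions a μ) (s : ℝ) :
    (cellKernel h).coeff (s + 1) = (cellKernel h).coeff s := by
  funext z ξ; exact h.coeff_periodic_time _ _ _

theorem abs_coord_le (z : Space d) (i : Fin d) : |z i| ≤ ‖z‖ := PiLp.norm_apply_le z i

/-- From `r ≤ 1 + r²`: the zeroth and second moments control the first. -/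
theorem Conditions.integrable_norm (h : Conditions a μ) : Integrable fun z => ‖z‖ * a z := by
  refine Integrable.mono' (h.kernel_integrable.add h.kernel_second_moment)
    (measurable_norm.aestronglyMeasurable.mul h.kernel_integrable.aestronglyMeasurable)
    (ae_of_all _ fun z => ?_)
  rw [Real.norm_of_nonneg (mul_nonneg (norm_nonneg z) (h.kernel_nonneg z)), Pi.add_apply]
  have := h.kernel_nonneg z
  nlinarith [mul_nonneg this (sq_nonneg (‖z‖ - 1)), mul_nonneg this (sq_nonneg ‖z‖)]

/-- The first-moment weight of the kernel. -/
def firstWeight (a : Space d → ℝ) (j : Fin d) (z : Space d) : ℝ := -z j * a z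

/-- The second-moment weight of the kernel. -/
def secondWeight (a : Space d → ℝ) (i j : Fin d) (z : Space d) : ℝ := 1 / 2 * z i * z j * a z

theorem Conditions.integrable_first (h : Conditions a μ) (j : Fin d) : Integrable (firstWeight a j) := by
  refine Integrable.mono' h.integrable_norm
    ((by fun_prop : Measurable fun z : Space d => -z j).aestronglyMeasurable.mul
      h.kernel_integrable.aestronglyMeasurable) (ae_of_all _ fun z => ?_)
  rw [firstWeight, norm_mul, norm_neg, Real.norm_of_nonneg (h.kernel_nonneg z)]
  exact mul_le_mul_of_nonneg_right (abs_coord_le z j) (h.kernel_nonneg z)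

theorem Conditions.integrable_second (h : Conditions a μ) (i j : Fin d) :
    Integrable (secondWeight a i j) := by
  refine Integrable.mono' h.kernel_second_moment
    ((by fun_prop : Measurable fun z : Space d => 1 / 2 * z i * z j).aestronglyMeasurable.mul
      h.kernel_integrable.aestronglyMeasurable) (ae_of_all _ fun z => ?_)
  rw [secondWeight, norm_mul, Real.norm_of_nonneg (h.kernel_nonneg z)]
  refine mul_le_mul_of_nonneg_right ?_ (h.kernel_nonneg z)
  rw [norm_mul, norm_mul, Real.norm_of_nonneg (by norm_num : (0 : ℝ) ≤ 1 / 2), sq]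
  have h1 := abs_coord_le z i
  have h2 := abs_coord_le z j
  rw [← Real.norm_eq_abs] at h1 h2
  have := mul_le_mul h1 h2 (norm_nonneg _) (norm_nonneg _)
  nlinarith [mul_nonneg (norm_nonneg (z i)) (norm_nonneg (z j))]

theorem firstWeight_measurable (hm : Measurable a) (j : Fin d) : Measurable (firstWeight a j) :=
  (by fun_prop : Measurable fun z : Space d => -z j).mul hm

theorem secondWeight_measurable (hm : Measurable a) (i j : Fin d) : Measurable (secondWeight a i j) :=
  (by fun_prop : Measurable fun z : Space d => 1 / 2 * z i * z j).mul hm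

/-- The constant function one on the torus. -/
def torusOne (d : ℕ) : L2Torus d := Lp.const 2 volume (1 : ℝ)

theorem torusOne_ae : torusOne d =ᵐ[volume] fun _ => (1 : ℝ) := Lp.coeFn_const 2 volume (1 : ℝ)

theorem inner_torusOne (f : L2Torus d) : inner ℝ (torusOne d) f = ∫ x, f x := by
  rw [L2.inner_def]
  refine integral_congr_ae ?_
  filter_upwards [torusOne_ae] with x hx
  rw [hx]; simp

theorem norm_torusOne : ‖torusOne d‖ = 1 := by
  have : ‖torusOne d‖ ^ 2 = 1 := by
    rw [← real_inner_self_eq_norm_sq, inner_torusOne, integral_congr_ae torusOne_ae]; simp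
  nlinarith [norm_nonneg (torusOne d)]

theorem tr_torusOne (h : Conditions a μ) (z : Space d) :
    (cellKernel h).tr volume z (torusOne d) = torusOne d := by
  refine Lp.ext ?_
  have hq := (measurePreserving_sub_right (volume : Measure (UnitAddTorus (Fin d)))
    ((cellKernel h).shift z)).quasiMeasurePreserving
  filter_upwards [(cellKernel h).tr_ae z (torusOne d), hq.ae torusOne_ae, torusOne_ae] with x h1 h2 h3
  rw [h1, h2, h3]

/-- The cell operator on `L²(𝕋^d)`. -/
def cellGen (h : Conditions a μ) (s : ℝ) : L2Torus d →L[ℝ] L2Torus d :=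
  (cellKernel h).gen h.kernel_integrable s

/-- The operator with the first-moment weight. -/
def cellFirst (h : Conditions a μ) (j : Fin d) (s : ℝ) : L2Torus d →L[ℝ] L2Torus d :=
  (cellKernel h).K (h.integrable_first j) s

/-- The operator with the second-moment weight. -/
def cellSecond (h : Conditions a μ) (i j : Fin d) (s : ℝ) : L2Torus d →L[ℝ] L2Torus d :=
  (cellKernel h).K (h.integrable_second i j) s

theorem K_periodic (h : Conditions a μ) {α : Space d → ℝ} (hα : Integrable α) (s : ℝ) :
    (cellKernel h).K (ν := volume) hα (s + 1) = (cellKernel h).K hα s := by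
  ext1 f
  rw [JumpKernel.K_apply, JumpKernel.K_apply]
  refine integral_congr_ae (ae_of_all _ fun z => ?_)
  have : (cellKernel h).S volume (s + 1) z f = (cellKernel h).S volume s z f := by
    refine Lp.ext ?_
    filter_upwards [(cellKernel h).S_ae (s + 1) z f, (cellKernel h).S_ae s z f] with x h1 h2
    rw [h1, h2, cellKernel_coeff_periodic]
  simp only [this]

theorem N_periodic (h : Conditions a μ) {α : Space d → ℝ} (hα : Integrable α) (s : ℝ) :
    (cellKernel h).N (ν := volume) hα (s + 1) = (cellKernel h).N hα s := by
  ext1 f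
  rw [JumpKernel.N_apply, JumpKernel.N_apply]
  refine integral_congr_ae (ae_of_all _ fun z => ?_)
  have : (cellKernel h).M volume (s + 1) z f = (cellKernel h).M volume s z f := by
    refine Lp.ext ?_
    filter_upwards [(cellKernel h).M_ae (s + 1) z f, (cellKernel h).M_ae s z f] with x h1 h2
    rw [h1, h2, cellKernel_coeff_periodic]
  simp only [this]

theorem cellGen_periodic (h : Conditions a μ) (s : ℝ) : cellGen h (s + 1) = cellGen h s := by
  rw [cellGen, cellGen, JumpKernel.gen, JumpKernel.gen, K_periodic, N_periodic]

theorem cellFirst_periodic (h : Conditions a μ) (j : Fin d) (s : ℝ) :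
    cellFirst h j (s + 1) = cellFirst h j s := K_periodic _ _ _

theorem cellSecond_periodic (h : Conditions a μ) (i j : Fin d) (s : ℝ) :
    cellSecond h i j (s + 1) = cellSecond h i j s := K_periodic _ _ _

theorem cellGen_torusOne (h : Conditions a μ) (s : ℝ) : cellGen h s (torusOne d) = 0 := by
  rw [cellGen, JumpKernel.gen_apply]
  simp [tr_torusOne]

/-- The mass brought in by jumps `z` is the mass that leaves by jumps `-z`. -/
theorem inner_one_S (h : Conditions a μ) (s : ℝ) (z : Space d) (f : L2Torus d) :
    inner ℝ (torusOne d) ((cellKernel h).S volume s z f) =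
      inner ℝ (torusOne d) ((cellKernel h).M volume s (-z) f) := by
  have := (cellKernel h).inner_S_neg s (-z) f (torusOne d)
  rw [neg_neg] at this
  rw [this, JumpKernel.S_apply, tr_torusOne, JumpKernel.inner_M_comm]

theorem inner_one_K (h : Conditions a μ) {α : Space d → ℝ} (hα : Integrable α) (s : ℝ) (f : L2Torus d) :
    inner ℝ (torusOne d) ((cellKernel h).K hα s f) =
      ∫ z, α (-z) * inner ℝ (torusOne d) ((cellKernel h).M volume s z f) := by
  rw [JumpKernel.inner_K, ← integral_neg_eq_self]
  refine integral_congr_ae (ae_of_all _ fun z => ?_)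
  simp only
  rw [inner_one_S, neg_neg]

/-- Conservation of mass: for an even weight gain and loss have the same integral. Thus the mean of
a solution is driven only by the mean of the forcing. -/
theorem inner_one_cellGen (h : Conditions a μ) (s : ℝ) (f : L2Torus d) :
    inner ℝ (torusOne d) (cellGen h s f) = 0 := by
  have : cellGen h s f = (cellKernel h).K h.kernel_integrable s f -
    (cellKernel h).N h.kernel_integrable s f := rfl
  rw [this, inner_sub_right, inner_one_K, JumpKernel.inner_N]
  simp_rw [h.kernel_even]
  exact sub_self _

theorem cellGen_family (h : Conditions a μ) : ∃ C, BddFamily (cellGen h) C :=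
  ⟨_, (cellKernel h).gen_family h.kernel_integrable⟩

theorem cellFirst_family (h : Conditions a μ) (j : Fin d) : ∃ C, BddFamily (cellFirst h j) C :=
  ⟨_, (cellKernel h).K_family (h.integrable_first j)⟩

theorem cellSecond_family (h : Conditions a μ) (i j : Fin d) : ∃ C, BddFamily (cellSecond h i j) C :=
  ⟨_, (cellKernel h).K_family (h.integrable_second i j)⟩

/-- The projection onto constants. -/
def meanProj (d : ℕ) : L2Torus d →L[ℝ] L2Torus d :=
  (innerSL ℝ (torusOne d)).smulRight (torusOne d)

theorem meanProj_apply (f : L2Torus d) :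
    meanProj d f = (inner ℝ (torusOne d) f : ℝ) • torusOne d := rfl

/-- Spectral gap of the cell operator. -/
theorem exists_cellGen_gap (h : Conditions a μ) : ∃ lam : ℝ, 0 < lam ∧ ∀ s (f : L2Torus d),
    inner ℝ f (cellGen h s f) ≤ -lam * (‖f‖ ^ 2 - (inner ℝ (torusOne d) f) ^ 2) := by
  obtain ⟨lam, hlam, hgap⟩ := exists_spectral_gap h.kernel_integrable h.kernel_nonneg h.kernel_integral
  have hlo := (cellKernel h).lo_pos
  refine ⟨1 / 2 * (cellKernel h).lo * lam, by positivity, fun s f => ?_⟩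
  obtain ⟨hi, he⟩ := (cellKernel h).inner_gen h.kernel_integrable h.kernel_even s f
  rw [cellGen, he, inner_torusOne]
  have h1 : (cellKernel h).lo * ∫ z, a z * ‖transL ℝ volume (torusProj z) f - f‖ ^ 2 ≤
      ∫ z, a z * (cellKernel h).energy s z f := by
    rw [← integral_const_mul]
    refine integral_mono_of_nonneg (ae_of_all _ fun z => ?_) hi (ae_of_all _ fun z => ?_)
    · have := h.kernel_nonneg z
      positivity
    · have := mul_le_mul_of_nonneg_left ((cellKernel h).energy_ge s z f) (h.kernel_nonneg z)
      calc _ = a z * ((cellKernel h).lo * ‖(cellKernel h).tr volume z f - f‖ ^ 2) := by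
            simp only [JumpKernel.tr, cellKernel]; ring
        _ ≤ _ := this
  have h2 := mul_le_mul_of_nonneg_left (hgap f) hlo.le
  nlinarith

theorem sq_inner_torusOne_le (f : L2Torus d) : (inner ℝ (torusOne d) f) ^ 2 ≤ ‖f‖ ^ 2 := by
  have := abs_real_inner_le_norm (torusOne d) f
  rw [norm_torusOne, one_mul] at this
  exact sq_le_sq' (abs_le.1 this).1 (abs_le.1 this).2

theorem intervalIntegrable_family {H : Type*} [NormedAddCommGroup H] [InnerProductSpace ℝ H]
    [CompleteSpace H] [SecondCountableTopology H] {A : ℝ → H →L[ℝ] H} {C : ℝ} (hA : BddFamily A C)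
    {x : ℝ → H} (hx : Continuous x) (a b : ℝ) :
    IntervalIntegrable (fun s => A s (x s)) volume a b := by
  obtain ⟨N, hN⟩ := (isCompact_uIcc (a := a) (b := b)).exists_bound_of_continuousOn hx.continuousOn
  exact intervalIntegrable_of_bounded (M := C * N) (hA.comp hx.stronglyMeasurable) fun s hs =>
    (hA.norm_le _ _).trans (mul_le_mul_of_nonneg_left (hN s hs) hA.nonneg)

/-- Periodic solutions of the cell problem for right-hand sides with zero mean at each time. -/
theorem exists_cell_solution_of_mean_zero (h : Conditions a μ) {F : ℝ → L2Torus d}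
    (hF : StronglyMeasurable F) {M : ℝ} (hM : ∀ s, ‖F s‖ ≤ M)
    (hmean : ∀ s, inner ℝ (torusOne d) (F s) = 0) :
    ∃ κ : ℝ → L2Torus d, Continuous κ ∧ κ 1 = κ 0 ∧
      (∀ t ∈ Icc (0 : ℝ) 1, inner ℝ (torusOne d) (κ t) = 0) ∧
      ∀ t ∈ Icc (0 : ℝ) 1, κ t = κ 0 + ∫ s in (0 : ℝ)..t, (cellGen h s (κ s) + F s) := by
  obtain ⟨C, hC⟩ := cellGen_family h
  obtain ⟨lam, hlam, hgap⟩ := exists_cellGen_gap h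
  -- The generator annihilates constants and so is not coercive. Subtracting the projection onto
  -- constants repairs this without affecting functions of mean zero.
  have hfam : BddFamily (fun s => cellGen h s - meanProj d) (C + ‖meanProj d‖) :=
    ⟨fun x => (hC.meas x).sub stronglyMeasurable_const, fun s =>
      (norm_sub_le _ _).trans (add_le_add_left (hC.bound s) _)⟩
  obtain ⟨κ, hκc, hκ, hκ1⟩ := exists_periodic_evolution hfam hF hM (lam := min lam 1)
    (lt_min hlam one_pos) (fun s x => by
      rw [sub_apply, inner_sub_right, meanProj_apply, inner_smul_right,
        real_inner_comm (torusOne d) x, ← sq]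
      have h1 := hgap s x
      have h2 := sq_inner_torusOne_le x
      have h3 := sq_nonneg (inner ℝ (torusOne d) x)
      have h4 : min lam 1 * (‖x‖ ^ 2 - inner ℝ (torusOne d) x ^ 2) ≤
        lam * (‖x‖ ^ 2 - inner ℝ (torusOne d) x ^ 2) :=
        mul_le_mul_of_nonneg_right (min_le_left _ _) (by linarith)
      have h5 : min lam 1 * inner ℝ (torusOne d) x ^ 2 ≤ 1 * inner ℝ (torusOne d) x ^ 2 :=
        mul_le_mul_of_nonneg_right (min_le_right _ _) h3
      nlinarith)
  have hFi : ∀ a b, IntervalIntegrable F volume a b := fun a b =>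
    intervalIntegrable_of_bounded hF fun s _ => hM s
  have hii : ∀ a b, IntervalIntegrable (fun s => (cellGen h s - meanProj d) (κ s) + F s) volume a b :=
    fun a b => (intervalIntegrable_family hfam hκc a b).add (hFi a b)
  set m : ℝ → ℝ := fun t => inner ℝ (torusOne d) (κ t) with hm
  have hmc : Continuous m := continuous_const.inner hκc
  -- The mean of the modified solution obeys `m' = -m`. Since `m` is also periodic, the energy
  -- identity forces `∫ m² = 0`; hence `m = 0` and the modification is invisible.
  have hme : ∀ t, m t = m 0 + ∫ s in (0 : ℝ)..t, -m s := by
    intro t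
    have h1 : ∀ s, -m s = innerSL ℝ (torusOne d) ((cellGen h s - meanProj d) (κ s) + F s) := by
      intro s
      rw [innerSL_apply_apply, sub_apply, inner_add_right, hmean, inner_sub_right,
        inner_one_cellGen, meanProj_apply, inner_smul_right, real_inner_self_eq_norm_sq, norm_torusOne]
      simp [hm]
    simp_rw [h1]
    rw [ContinuousLinearMap.intervalIntegral_comp_comm _ (hii 0 t)]
    change _ = m 0 + inner ℝ (torusOne d) _
    rw [hm]
    simp only
    rw [← inner_add_right, ← hκ]
  have hen := norm_sq_primitive zero_le_one (hmc.neg.intervalIntegrable 0 1) fun s _ => hme s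
  have hm1 : m 1 = m 0 := by simp only [hm, hκ1]
  have hint0 : ∫ s in (0 : ℝ)..1, m s ^ 2 = 0 := by
    rw [hm1] at hen
    have : ∀ s, inner ℝ (m s) ((-m) s) = -(m s ^ 2) := fun s => by
      rw [Pi.neg_apply, inner_neg_right, real_inner_self_eq_norm_sq, Real.norm_eq_abs, sq_abs]
    simp_rw [this] at hen
    rw [intervalIntegral.integral_neg] at hen
    linarith
  have hm0 : ∀ t ∈ Icc (0 : ℝ) 1, m t = 0 := by
    have h1 := (intervalIntegral.integral_eq_zero_iff_of_le_of_nonneg_ae zero_le_one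
      (ae_of_all _ fun s => sq_nonneg (m s)) ((hmc.pow 2).intervalIntegrable 0 1)).1 hint0
    have h2 : EqOn (fun s => m s ^ 2) 0 (Icc 0 1) :=
      Measure.eqOn_Icc_of_ae_eq volume zero_ne_one (by
        rw [← Measure.restrict_congr_set Ioc_ae_eq_Icc]; exact h1) (hmc.pow 2).continuousOn continuousOn_const
    intro t ht
    exact pow_eq_zero_iff two_ne_zero |>.1 (h2 ht)
  refine ⟨κ, hκc, hκ1, hm0, fun t ht => ?_⟩
  rw [hκ t]
  congr 1
  refine intervalIntegral.integral_congr fun s hs => ?_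
  rw [uIcc_of_le ht.1] at hs
  have hms : inner ℝ (torusOne d) (κ s) = 0 := hm0 s ⟨hs.1, hs.2.trans ht.2⟩
  simp only [sub_apply, meanProj_apply, hms, zero_smul, sub_zero]

/-- Periodic solutions of the cell problem for right-hand sides with zero space-time mean. -/
theorem exists_cell_solution (h : Conditions a μ) {F : ℝ → L2Torus d}
    (hF : StronglyMeasurable F) {M : ℝ} (hM : ∀ s, ‖F s‖ ≤ M) (hper : Function.Periodic F 1)
    (hmean : ∫ s in (0 : ℝ)..1, inner ℝ (torusOne d) (F s) = 0) :
    ∃ κ : ℝ → L2Torus d, Continuous κ ∧ (∃ R, ∀ s, ‖κ s‖ ≤ R) ∧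
      (∀ a b, IntervalIntegrable (fun s => cellGen h s (κ s) + F s) volume a b) ∧
      ∀ t, κ t = κ 0 + ∫ s in (0 : ℝ)..t, (cellGen h s (κ s) + F s) := by
  obtain ⟨C, hC⟩ := cellGen_family h
  set m : ℝ → ℝ := fun s => inner ℝ (torusOne d) (F s) with hm
  have hmm : StronglyMeasurable m := stronglyMeasurable_const.inner hF
  have hmb : ∀ s, ‖m s‖ ≤ M := fun s => by
    refine (norm_inner_le_norm _ _).trans ?_
    rw [norm_torusOne, one_mul]; exact hM s
  have hmi : ∀ a b, IntervalIntegrable m volume a b := fun a b =>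
    intervalIntegrable_of_bounded hmm fun s _ => hmb s
  obtain ⟨κ, hκc, hκ1, -, hκ⟩ := exists_cell_solution_of_mean_zero h
    (F := fun s => F s - m s • torusOne d) (hF.sub (hmm.smul_const _)) (M := M + M) (fun s => by
      refine (norm_sub_le _ _).trans (add_le_add (hM s) ?_)
      rw [norm_smul, norm_torusOne, mul_one]; exact hmb s) (fun s => by
      rw [inner_sub_right, inner_smul_right, real_inner_self_eq_norm_sq, norm_torusOne]
      simp [hm])
  -- The mean of the forcing, removed to apply the previous theorem, is restored through its
  -- primitive times the constant one. The generator does not see this term, and it is periodic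
  -- because the space-time mean vanishes.
  set y : ℝ → L2Torus d := fun t => κ t + (∫ s in (0 : ℝ)..t, m s) • torusOne d with hy
  have hyc : Continuous y := hκc.add
    ((intervalIntegral.continuous_primitive hmi 0).smul continuous_const)
  have hy1 : y 1 = y 0 := by simp only [hy, hmean, hκ1, intervalIntegral.integral_same]
  set x : ℝ → L2Torus d := fun t => y (Int.fract t) with hx
  have hxp : Function.Periodic x 1 := fun t => by simp only [hx, Int.fract_add_one]
  have hxy : ∀ t ∈ Icc (0 : ℝ) 1, x t = y t := by
    intro t ht
    rcases eq_or_lt_of_le ht.2 with rfl | h1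
    · simp only [hx, Int.fract_one, hy1]
    · simp only [hx, Int.fract_eq_self.2 ⟨ht.1, h1⟩]
  have hFi : ∀ a b, IntervalIntegrable F volume a b := fun a b =>
    intervalIntegrable_of_bounded hF fun s _ => hM s
  have hfp : Function.Periodic (fun s => cellGen h s (x s) + F s) 1 := fun s => by
    simp only [cellGen_periodic, hxp s, hper s]
  have hi01 : IntervalIntegrable (fun s => cellGen h s (x s) + F s) volume 0 1 := by
    refine ((intervalIntegrable_family hC hyc 0 1).add (hFi 0 1)).congr fun s hs => ?_
    rw [uIoc_of_le zero_le_one] at hs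
    simp only [hxy s (Ioc_subset_Icc_self hs)]
  have hprim : ∀ t ∈ Icc (0 : ℝ) 1, x t = x 0 + ∫ s in (0 : ℝ)..t, (cellGen h s (x s) + F s) := by
    intro t ht
    have e1 : ∫ s in (0 : ℝ)..t, (cellGen h s (x s) + F s) =
        ∫ s in (0 : ℝ)..t, ((cellGen h s (κ s) + (F s - m s • torusOne d)) + m s • torusOne d) := by
      refine intervalIntegral.integral_congr fun s hs => ?_
      rw [uIcc_of_le ht.1] at hs
      simp only [hxy s ⟨hs.1, hs.2.trans ht.2⟩, hy, map_add, map_smul, cellGen_torusOne, smul_zero]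
      abel
    have i2 : IntervalIntegrable (fun s => m s • torusOne d) volume 0 t :=
      intervalIntegrable_of_bounded (hmm.smul_const _) (M := M) fun s _ => by
        rw [norm_smul, norm_torusOne, mul_one]; exact hmb s
    rw [e1, intervalIntegral.integral_add ((intervalIntegrable_family hC hκc 0 t).add
      ((hFi 0 t).sub i2)) i2, intervalIntegral.integral_smul_const, hxy t ht,
      hxy 0 ⟨le_rfl, zero_le_one⟩, ← add_assoc]
    simp only [hy]
    rw [hκ t ht]
    simp
  obtain ⟨hii, hall⟩ := primitive_of_periodic hxp hfp hi01 hprim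
  refine ⟨x, ?_, ?_, hii, hall⟩
  · have : x = fun t => x 0 + ∫ s in (0 : ℝ)..t, (cellGen h s (x s) + F s) := funext hall
    rw [this]
    exact continuous_const.add (intervalIntegral.continuous_primitive hii 0)
  · obtain ⟨R, hR⟩ := (isCompact_Icc (a := (0 : ℝ)) (b := 1)).exists_bound_of_continuousOn hyc.continuousOn
    exact ⟨R, fun s => hR _ ⟨Int.fract_nonneg s, (Int.fract_lt_one s).le⟩⟩

end Cell

end NonlocalHomogenization

/-! ### Correctors and the effective matrix in operator form -/

namespace NonlocalHomogenization

section Corrector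

variable {d : ℕ} {a : Space d → ℝ} {μ : Space d → Space d → ℝ → ℝ}

/-- The substitution `η = x - z` turns integrals over targets into integrals over jumps, the form in
which operators on the torus are defined. -/
theorem integral_jump_eq (h : Conditions a μ) (s : ℝ) (x : Space d) (F : Space d → ℝ) :
    ∫ η, a (x - η) * μ x η s * F η =
      ∫ z, a z * ((cellKernel h).coeff s z (torusProj x) * F (x - z)) := by
  rw [← integral_sub_left_eq_self _ volume x]
  refine integral_congr_ae (ae_of_all _ fun z => ?_)
  simp only [sub_sub_cancel, cellKernel_coeff]
  ring

theorem cellOp_ae (h : Conditions a μ) (hm : Measurable a) (s : ℝ) (χ : L2Torus d) :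
    ∀ᵐ x : Space d, cellOp a μ s (fun η => χ (torusProj η)) x = cellGen h s χ (torusProj x) := by
  filter_upwards [quasiMeasurePreserving_torusProj.ae
    ((cellKernel h).gen_ae hm h.kernel_integrable s χ)] with x hx
  rw [cellGen, hx, cellOp, integral_jump_eq h s x fun η => χ (torusProj η) - χ (torusProj x)]
  simp_rw [torusProj_sub]
  rfl

/-- The drift in the corrector equation is the first-moment operator applied to the constant one;
the sign in `firstWeight` comes from `η - x = -z`. -/
theorem cellFirst_one_ae (h : Conditions a μ) (hm : Measurable a) (j : Fin d) (s : ℝ) :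
    ∀ᵐ x : Space d, ∫ η, a (x - η) * μ x η s * (η j - x j) =
      cellFirst h j s (torusOne d) (torusProj x) := by
  have h1 := (cellKernel h).K_ae (ν := volume) (firstWeight_measurable hm j) (h.integrable_first j) s (torusOne d)
  have h2 : ∀ᵐ x : Space d, ∀ᵐ z : Space d, torusOne d (torusProj x - torusProj z) = 1 :=
    ae_of_all _ fun x => by
      have h3 := quasiMeasurePreserving_torusProj.ae (torusOne_ae (d := d))
      have h4 := (Measure.measurePreserving_sub_left (volume : Measure (Space d)) x).quasiMeasurePreserving.ae h3
      filter_upwards [h4] with z hz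
      rw [← torusProj_sub, hz]
  filter_upwards [quasiMeasurePreserving_torusProj.ae h1.2, h2] with x hx hx2
  rw [cellFirst, hx, integral_jump_eq h s x fun η => η j - x j]
  refine integral_congr_ae ?_
  filter_upwards [hx2] with z hz
  change _ = firstWeight a j z * (_ * torusOne d (torusProj x - torusProj z))
  rw [hz, firstWeight]
  simp
  ring

theorem ae_torus_of_ae_unitCell {p : UnitAddTorus (Fin d) → Prop} (hp : MeasurableSet {ξ | p ξ})
    (h : ∀ᵐ x ∂(volume : Measure (Space d)).restrict (unitCell d), p (torusProj x)) : ∀ᵐ ξ, p ξ := by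
  rw [← measurePreserving_torusProj.map_eq, ae_map_iff torusProj_measurable.aemeasurable hp]
  exact h

theorem integral_torus_eq {f : UnitAddTorus (Fin d) → ℝ} (hf : AEStronglyMeasurable f) :
    ∫ ξ, f ξ = ∫ x in unitCell d, f (torusProj x) := by
  rw [← measurePreserving_torusProj.map_eq] at hf ⊢
  exact integral_map torusProj_measurable.aemeasurable hf

theorem ae_torus_of_ae_space {f g : L2Torus d} (hfg : ∀ᵐ x : Space d, f (torusProj x) = g (torusProj x)) :
    f = g := by
  refine Lp.ext ?_
  have hms : MeasurableSet {ξ | f ξ = g ξ} := measurableSet_eq_fun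
    (Lp.stronglyMeasurable f).measurable (Lp.stronglyMeasurable g).measurable
  exact ae_torus_of_ae_unitCell hms (ae_restrict_of_ae hfg)

/-- The corrector problem in operator form, solved by `c = -χ_j`. -/
structure IsCellFlow (h : Conditions a μ) (F : ℝ → L2Torus d) (c : ℝ → L2Torus d) : Prop where
  cont : Continuous c
  bdd : ∃ R, ∀ s, ‖c s‖ ≤ R
  integrable : ∀ a b, IntervalIntegrable (fun s => cellGen h s (c s) + F s) volume a b
  eq : ∀ t, c t = c 0 + ∫ s in (0 : ℝ)..t, (cellGen h s (c s) + F s)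

theorem cellFirst_one_meas (h : Conditions a μ) (j : Fin d) :
    StronglyMeasurable fun s => cellFirst h j s (torusOne d) := by
  obtain ⟨C, hC⟩ := cellFirst_family h j
  exact hC.meas _

theorem cellFirst_one_bdd (h : Conditions a μ) (j : Fin d) :
    ∃ C, ∀ s, ‖cellFirst h j s (torusOne d)‖ ≤ C := by
  obtain ⟨C, hC⟩ := cellFirst_family h j
  exact ⟨C * ‖torusOne d‖, fun s => hC.norm_le _ _⟩

/-- The drift enters the corrector equation with a minus sign, so `-χ_j` is driven by `+cellFirst`.
The weak time derivative is identified on `(0,1)` and the resulting identity is continued by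
periodicity; continuity and boundedness in time come from the integral equation. -/
theorem IsCorrector.isCellFlow (h : Conditions a μ) (hm : Measurable a) {χ : Fin d → ℝ → L2Torus d}
    (hχ : IsCorrector a μ χ) (j : Fin d) :
    Function.Periodic (χ j) 1 ∧
      IsCellFlow h (fun s => cellFirst h j s (torusOne d)) (fun s => -χ j s) := by
  obtain ⟨hper, -, ⟨g, hg, hprim, heq⟩, -⟩ := hχ j
  refine ⟨hper, ?_⟩
  have hgi : IntervalIntegrable g volume 0 1 := by
    rw [intervalIntegrable_iff_integrableOn_Ioo_of_le zero_le_one]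
    exact hg.integrable (by norm_num)
  have hgA : ∀ᵐ s ∂volume.restrict (Ioo (0 : ℝ) 1),
      -g s = cellGen h s (-χ j s) + cellFirst h j s (torusOne d) := by
    filter_upwards [heq] with s hs
    have : g s = cellGen h s (χ j s) - cellFirst h j s (torusOne d) := by
      refine ae_torus_of_ae_space ?_
      filter_upwards [hs, cellOp_ae h hm s (χ j s), cellFirst_one_ae h hm j s,
        quasiMeasurePreserving_torusProj.ae (Lp.coeFn_sub (cellGen h s (χ j s))
          (cellFirst h j s (torusOne d)))] with x h1 h2 h3 h4
      rw [h4, Pi.sub_apply, ← h2, ← h3]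
      linarith
    rw [this, map_neg]; abel
  have hgA' : ∀ᵐ s ∂volume.restrict (uIoc (0 : ℝ) 1),
      -g s = cellGen h s (-χ j s) + cellFirst h j s (torusOne d) := by
    rwa [uIoc_of_le zero_le_one, ← Measure.restrict_congr_set Ioo_ae_eq_Ioc]
  have hi01 : IntervalIntegrable (fun s => cellGen h s (-χ j s) + cellFirst h j s (torusOne d)) volume 0 1 :=
    hgi.neg.congr_ae hgA'
  have hp : Function.Periodic (fun s => -χ j s) 1 := fun s => by simp only [hper s]
  have hfp : Function.Periodic (fun s => cellGen h s (-χ j s) + cellFirst h j s (torusOne d)) 1 := fun s => by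
    simp only [cellGen_periodic, cellFirst_periodic, hper s]
  have hprim' : ∀ s ∈ Icc (0 : ℝ) 1, -χ j s = -χ j 0 +
      ∫ r in (0 : ℝ)..s, (cellGen h r (-χ j r) + cellFirst h j r (torusOne d)) := by
    intro s hs
    have : ∫ r in (0 : ℝ)..s, (cellGen h r (-χ j r) + cellFirst h j r (torusOne d)) =
        ∫ r in (0 : ℝ)..s, -g r := by
      refine (intervalIntegral.integral_congr_ae_restrict ?_).symm
      rw [uIoc_of_le zero_le_one] at hgA'
      rw [uIoc_of_le hs.1]
      exact ae_restrict_of_ae_restrict_of_subset (Ioc_subset_Ioc_right hs.2) hgA'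
    rw [this, intervalIntegral.integral_neg, hprim s hs]
    abel
  obtain ⟨hii, hall⟩ := primitive_of_periodic hp hfp hi01 hprim'
  have hcont : Continuous fun s => -χ j s := by
    have : (fun s => -χ j s) = fun t => -χ j 0 +
      ∫ s in (0 : ℝ)..t, (cellGen h s (-χ j s) + cellFirst h j s (torusOne d)) := funext hall
    rw [this]
    exact continuous_const.add (intervalIntegral.continuous_primitive hii 0)
  refine ⟨hcont, ?_, hii, hall⟩
  obtain ⟨R, hR⟩ := (isCompact_Icc (a := (0 : ℝ)) (b := 1)).exists_bound_of_continuousOn hcont.continuousOn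
  refine ⟨R, fun s => ?_⟩
  have := hp.sub_zsmul_eq (x := s) ⌊s⌋
  rw [zsmul_one, Int.self_sub_floor] at this
  rw [← this]
  exact hR _ ⟨Int.fract_nonneg s, (Int.fract_lt_one s).le⟩

/-- The weight is odd while translation fixes the constant one, so the integral equals its own
negative. This is the solvability condition for the corrector at each time. -/
theorem inner_one_cellFirst_one (h : Conditions a μ) (j : Fin d) (s : ℝ) :
    inner ℝ (torusOne d) (cellFirst h j s (torusOne d)) = 0 := by
  have h1 := inner_one_K h (h.integrable_first j) s (torusOne d)
  have h2 := (cellKernel h).inner_K (ν := volume) (h.integrable_first j) s (torusOne d) (torusOne d)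
  simp_rw [JumpKernel.S_apply, tr_torusOne] at h2
  have h3 : ∀ z, firstWeight a j (-z) = -firstWeight a j z := fun z => by
    simp [firstWeight, h.kernel_even]
  simp_rw [h3, neg_mul] at h1
  rw [integral_neg] at h1
  rw [cellFirst]
  linarith

theorem exists_corrector (h : Conditions a μ) (hm : Measurable a) : ∃ χ, IsCorrector a μ χ := by
  have key : ∀ j, ∃ χ : ℝ → L2Torus d, Function.Periodic χ 1 ∧
    MemLp χ ⊤ (volume.restrict (Ioo 0 1)) ∧
    (∃ g : ℝ → L2Torus d, MemLp g 2 (volume.restrict (Ioo 0 1)) ∧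
      (∀ s ∈ Icc (0 : ℝ) 1, χ s = χ 0 + ∫ r in (0 : ℝ)..s, g r) ∧
      (∀ᵐ s ∂volume.restrict (Ioo (0 : ℝ) 1), ∀ᵐ ξ : Space d,
        g s (torusProj ξ) - cellOp a μ s (fun η => χ s (torusProj η)) ξ =
          -∫ η, a (ξ - η) * μ ξ η s * (η j - ξ j))) ∧
    ∫ s in (0 : ℝ)..1, ∫ x, χ s x = 0 := by
    intro j
    obtain ⟨M, hM⟩ := cellFirst_one_bdd h j
    obtain ⟨C, hC⟩ := cellGen_family h
    obtain ⟨κ, hκc, hκ1, hκm, hκ⟩ := exists_cell_solution_of_mean_zero h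
      (F := fun s => -cellFirst h j s (torusOne d)) (cellFirst_one_meas h j).neg (M := M)
      (fun s => by rw [norm_neg]; exact hM s)
      (fun s => by rw [inner_neg_right, inner_one_cellFirst_one, neg_zero])
    set χ : ℝ → L2Torus d := fun t => κ (Int.fract t) with hχ
    have hχκ : ∀ t ∈ Icc (0 : ℝ) 1, χ t = κ t := by
      intro t ht
      rcases eq_or_lt_of_le ht.2 with rfl | h1
      · simp only [hχ, Int.fract_one, hκ1]
      · simp only [hχ, Int.fract_eq_self.2 ⟨ht.1, h1⟩]
    obtain ⟨R, hR⟩ := (isCompact_Icc (a := (0 : ℝ)) (b := 1)).exists_bound_of_continuousOn hκc.continuousOn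
    have hgm : StronglyMeasurable fun s => cellGen h s (κ s) + -cellFirst h j s (torusOne d) :=
      (hC.comp hκc.stronglyMeasurable).add (cellFirst_one_meas h j).neg
    refine ⟨χ, fun t => by simp only [hχ, Int.fract_add_one], ?_,
      ⟨fun s => cellGen h s (κ s) + -cellFirst h j s (torusOne d), ?_, ?_, ?_⟩, ?_⟩
    · refine memLp_top_of_bound
        (hκc.comp_stronglyMeasurable measurable_fract.stronglyMeasurable).aestronglyMeasurable R
        (ae_of_all _ fun s => hR _ ⟨Int.fract_nonneg s, (Int.fract_lt_one s).le⟩)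
    · refine MemLp.of_bound hgm.aestronglyMeasurable (C * R + M)
        ((ae_restrict_iff' measurableSet_Ioo).2 (ae_of_all _ fun s hs => ?_))
      refine (norm_add_le _ _).trans (add_le_add ((hC.norm_le _ _).trans
        (mul_le_mul_of_nonneg_left (hR s (Ioo_subset_Icc_self hs)) hC.nonneg)) ?_)
      rw [norm_neg]; exact hM s
    · intro s hs
      rw [hχκ s hs, hχκ 0 ⟨le_rfl, zero_le_one⟩, hκ s hs]
    · refine (ae_restrict_iff' measurableSet_Ioo).2 (ae_of_all _ fun s hs => ?_)
      filter_upwards [cellOp_ae h hm s (χ s), cellFirst_one_ae h hm j s,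
        quasiMeasurePreserving_torusProj.ae (Lp.coeFn_add (cellGen h s (κ s))
          (-cellFirst h j s (torusOne d))),
        quasiMeasurePreserving_torusProj.ae (Lp.coeFn_neg (cellFirst h j s (torusOne d)))]
        with x h2 h3 h4 h5
      rw [h4, Pi.add_apply, h5, Pi.neg_apply, h2, h3, hχκ s (Ioo_subset_Icc_self hs)]
      ring
    · have : ∀ s, ∫ x, χ s x = 0 := fun s => by
        rw [← inner_torusOne]
        exact hκm _ ⟨Int.fract_nonneg s, (Int.fract_lt_one s).le⟩
      simp [this]
  choose χ hχ using key
  exact ⟨χ, hχ⟩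

/-- This exhibits `â_ij` as the space-time mean of the forcing in the second cell problem. -/
theorem preEffMatrix_eq (h : Conditions a μ) (hm : Measurable a) (χ : Fin d → ℝ → L2Torus d) (i j : Fin d) :
    preEffMatrix a μ χ i j = ∫ s in (0 : ℝ)..1, inner ℝ (torusOne d)
      (cellSecond h i j s (torusOne d) + cellFirst h i s (-χ j s)) := by
  rw [preEffMatrix, Matrix.of_apply]
  congr 1
  ext s
  rw [inner_torusOne, integral_torus_eq (Lp.aestronglyMeasurable _)]
  refine integral_congr_ae (ae_restrict_of_ae ?_)
  have h1 := (cellKernel h).K_ae (ν := volume) (secondWeight_measurable hm i j) (h.integrable_second i j) s (torusOne d)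
  have h1' := (cellKernel h).K_ae (ν := volume) (firstWeight_measurable hm i) (h.integrable_first i) s (-χ j s)
  have h2 : ∀ᵐ x : Space d, ∀ᵐ z : Space d, torusOne d (torusProj x - torusProj z) = 1 :=
    ae_of_all _ fun x => by
      have h3 := quasiMeasurePreserving_torusProj.ae (torusOne_ae (d := d))
      have h4 := (Measure.measurePreserving_sub_left (volume : Measure (Space d)) x).quasiMeasurePreserving.ae h3
      filter_upwards [h4] with z hz
      rw [← torusProj_sub, hz]
  have h3 : ∀ᵐ x : Space d, ∀ᵐ z : Space d,
      (-χ j s) (torusProj x - torusProj z) = -(χ j s (torusProj x - torusProj z)) :=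
    ae_of_all _ fun x => by
      have h3 := quasiMeasurePreserving_torusProj.ae (Lp.coeFn_neg (χ j s))
      have h4 := (Measure.measurePreserving_sub_left (volume : Measure (Space d)) x).quasiMeasurePreserving.ae h3
      filter_upwards [h4] with z hz
      rw [← torusProj_sub, hz, Pi.neg_apply]
  filter_upwards [quasiMeasurePreserving_torusProj.ae h1.1, quasiMeasurePreserving_torusProj.ae h1.2,
    quasiMeasurePreserving_torusProj.ae h1'.1, quasiMeasurePreserving_torusProj.ae h1'.2, h2, h3,
    quasiMeasurePreserving_torusProj.ae (Lp.coeFn_add (cellSecond h i j s (torusOne d))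
      (cellFirst h i s (-χ j s)))] with x a1 a2 b1 b2 hx2 hx3 hadd
  rw [hadd, Pi.add_apply, cellSecond, cellFirst, a2, b2, ← integral_add a1 b1,
    integral_jump_eq h s x fun η => (1 / 2 * (η i - x i) * (η j - x j) - (η i - x i) * χ j s (torusProj η))]
  refine integral_congr_ae ?_
  filter_upwards [hx2, hx3] with z hz hz3
  change _ = secondWeight a i j z * (_ * torusOne d (torusProj x - torusProj z)) +
    firstWeight a i z * (_ * (-χ j s) (torusProj x - torusProj z))
  rw [hz, hz3, firstWeight, secondWeight, torusProj_sub]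
  simp
  ring

end Corrector

end NonlocalHomogenization

/-! ### Positive definiteness of the effective matrix -/

namespace NonlocalHomogenization

section Positivity

variable {d : ℕ} {a : Space d → ℝ} {μ : Space d → Space d → ℝ → ℝ}

theorem inner_one_tr (h : Conditions a μ) (z : Space d) (f : L2Torus d) :
    inner ℝ (torusOne d) ((cellKernel h).tr volume z f) = inner ℝ (torusOne d) f := by
  nth_rw 1 [← tr_torusOne h z]
  exact ((cellKernel h).tr volume z).inner_map_map _ _

/-- The right side is the energy of `w = r - (τ c - c)` weighted by the jump intensity. Translation
preserves means, so `w` has mean `r` and `‖w‖² ≥ r²` whatever `c` is. -/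
theorem cell_square_ge (h : Conditions a μ) (s : ℝ) (z : Space d) (r : ℝ) (c : L2Torus d) :
    (cellKernel h).lo * r ^ 2 ≤ r ^ 2 * inner ℝ (torusOne d) ((cellKernel h).M volume s z (torusOne d)) +
      2 * (r * inner ℝ c ((cellKernel h).M volume s z (torusOne d)) -
        r * inner ℝ (torusOne d) ((cellKernel h).S volume s z c)) + (cellKernel h).energy s z c := by
  set J := cellKernel h
  set τ := J.tr (volume : Measure (UnitAddTorus (Fin d))) z
  set w := r • torusOne d - (τ c - c) with hw
  have h1 : inner ℝ (torusOne d) w = r := by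
    rw [hw, inner_sub_right, inner_sub_right, inner_one_tr, sub_self, sub_zero, inner_smul_right,
      real_inner_self_eq_norm_sq, norm_torusOne]
    ring
  have h2 := J.inner_M_ge s z w
  have h3 := sq_inner_torusOne_le w
  rw [h1] at h3
  have h4 := J.lo_pos
  have h5 : inner ℝ w (J.M volume s z w) = r ^ 2 * inner ℝ (torusOne d) (J.M volume s z (torusOne d)) +
      2 * (r * inner ℝ c (J.M volume s z (torusOne d)) -
        r * inner ℝ (torusOne d) (J.S volume s z c)) + J.energy s z c := by
    have comm : ∀ f g, inner ℝ f (J.M volume s z g) = inner ℝ g (J.M volume s z f) := fun f g => by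
      rw [J.inner_M_comm, real_inner_comm]
    rw [hw, map_sub, map_smul, inner_sub_left, inner_sub_right, inner_sub_right, JumpKernel.energy,
      real_inner_smul_left, real_inner_smul_left, inner_smul_right, inner_smul_right,
      comm (τ c - c) (torusOne d), comm c (torusOne d), JumpKernel.S_apply, map_sub (J.M volume s z) (τ c) c,
      inner_sub_right]
    ring
  nlinarith

theorem directional_integrable (h : Conditions a μ) (p : Space d) :
    Integrable (fun z => -inner ℝ p z * a z) ∧ Integrable (fun z => (inner ℝ p z) ^ 2 * a z) := by
  constructor
  · refine Integrable.mono' (h.integrable_norm.const_mul ‖p‖)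
      ((by fun_prop : Measurable fun z : Space d => -inner ℝ p z).aestronglyMeasurable.mul
      h.kernel_integrable.aestronglyMeasurable) (ae_of_all _ fun z => ?_)
    rw [norm_mul, norm_neg, Real.norm_of_nonneg (h.kernel_nonneg z), ← mul_assoc]
    exact mul_le_mul_of_nonneg_right (norm_inner_le_norm _ _) (h.kernel_nonneg z)
  · refine Integrable.mono' (h.kernel_second_moment.const_mul (‖p‖ ^ 2))
      ((by fun_prop : Measurable fun z : Space d => (inner ℝ p z) ^ 2).aestronglyMeasurable.mul
      h.kernel_integrable.aestronglyMeasurable) (ae_of_all _ fun z => ?_)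
    rw [norm_mul, norm_pow, Real.norm_of_nonneg (h.kernel_nonneg z), ← mul_assoc, ← mul_pow]
    exact mul_le_mul_of_nonneg_right (pow_le_pow_left₀ (norm_nonneg _) (norm_inner_le_norm _ _) 2)
      (h.kernel_nonneg z)

/-- The support of a density has positive measure and the hyperplane orthogonal to `p` has none. -/
theorem directional_moment_pos (h : Conditions a μ) {p : Space d} (hp : p ≠ 0) :
    0 < ∫ z, (inner ℝ p z) ^ 2 * a z := by
  rw [integral_pos_iff_support_of_nonneg (fun z => mul_nonneg (sq_nonneg _) (h.kernel_nonneg z))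
    (directional_integrable h p).2]
  have h1 : 0 < volume (Function.support a) := by
    rw [← integral_pos_iff_support_of_nonneg h.kernel_nonneg h.kernel_integrable, h.kernel_integral]
    exact one_pos
  refine h1.trans_le ?_
  have h2 : Function.support a ⊆ (Function.support fun z => (inner ℝ p z) ^ 2 * a z) ∪ {z | inner ℝ p z = 0} := by
    intro z hz
    by_cases h0 : inner ℝ p z = 0
    · exact Or.inr h0
    · exact Or.inl (mul_ne_zero (pow_ne_zero _ h0) hz)
  refine (measure_mono h2).trans ((measure_union_le _ _).trans ?_)
  rw [hyperplane_null hp 0, add_zero]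

theorem inner_eq_coord_sum (p z : Space d) : inner ℝ p z = ∑ i, p i * z i := by
  rw [PiLp.inner_apply]
  refine Finset.sum_congr rfl fun i _ => ?_
  simp [mul_comm]

theorem sum_cellFirst (h : Conditions a μ) (p : Space d) (s : ℝ) (f : L2Torus d) :
    ∑ i, p i • cellFirst h i s f = (cellKernel h).K (directional_integrable h p).1 s f := by
  simp_rw [cellFirst, JumpKernel.K_apply, ← integral_smul]
  have hi : ∀ i, Integrable fun z => p i • firstWeight a i z • (cellKernel h).S volume s z f := fun i =>
    ((cellKernel h).S_integrable (h.integrable_first i) s f).smul (p i)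
  rw [← integral_finsetSum _ fun i _ => hi i]
  refine integral_congr_ae (ae_of_all _ fun z => ?_)
  simp_rw [smul_smul]
  rw [← Finset.sum_smul, inner_eq_coord_sum, neg_mul, Finset.sum_mul, ← Finset.sum_neg_distrib]
  congr 1
  refine Finset.sum_congr rfl fun i _ => ?_
  rw [firstWeight]; ring

theorem sum_inner_cellSecond (h : Conditions a μ) (p : Space d) (s : ℝ) :
    ∑ i, ∑ j, p i * p j * inner ℝ (torusOne d) (cellSecond h i j s (torusOne d)) =
      1 / 2 * ∫ z, ((inner ℝ p z) ^ 2 * a z) *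
        inner ℝ (torusOne d) ((cellKernel h).M volume s z (torusOne d)) := by
  simp_rw [cellSecond, JumpKernel.inner_K, ← integral_const_mul]
  have hi : ∀ i j, Integrable fun z => p i * p j * (secondWeight a i j z *
      inner ℝ (torusOne d) ((cellKernel h).S volume s z (torusOne d))) := fun i j => ((cellKernel h).integrable_inner_S (ν := volume) (h.integrable_second i j) s
    (torusOne d) (torusOne d)).const_mul (p i * p j)
  simp_rw [← integral_finsetSum _ fun j _ => hi _ j]
  rw [← integral_finsetSum _ fun i _ => integrable_finsetSum _ fun j _ => hi i j]
  refine integral_congr_ae (ae_of_all _ fun z => ?_)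
  simp only [JumpKernel.S_apply, tr_torusOne]
  rw [inner_eq_coord_sum, sq, Finset.sum_mul_sum, Finset.sum_mul, Finset.sum_mul, Finset.mul_sum]
  refine Finset.sum_congr rfl fun i _ => ?_
  rw [Finset.sum_mul, Finset.sum_mul, Finset.mul_sum]
  refine Finset.sum_congr rfl fun j _ => ?_
  rw [secondWeight]; ring

/-- `cell_square_ge` with `r = p·z`, multiplied by `a(z)/2` and integrated over the jumps. The term
subtracted on the right is the pairing of `∑ p_j c_j` with its own velocity, so it disappears after
integration over a period. -/
theorem cell_quadratic_ge (h : Conditions a μ) (p : Space d) (s : ℝ) (c : Fin d → L2Torus d) :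
    1 / 2 * (cellKernel h).lo * ∫ z, (inner ℝ p z) ^ 2 * a z ≤
      ∑ i, ∑ j, p i * p j * inner ℝ (torusOne d) (cellSecond h i j s (torusOne d) + cellFirst h i s (c j)) -
      inner ℝ (∑ j, p j • c j)
        (cellGen h s (∑ j, p j • c j) + ∑ j, p j • cellFirst h j s (torusOne d)) := by
  set C := ∑ j, p j • c j with hC
  set J := cellKernel h with hJ
  obtain ⟨hα, hβ⟩ := directional_integrable h p
  have e1 : ∑ i, ∑ j, p i * p j *
      inner ℝ (torusOne d) (cellSecond h i j s (torusOne d) + cellFirst h i s (c j)) =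
      1 / 2 * (∫ z, ((inner ℝ p z) ^ 2 * a z) * inner ℝ (torusOne d) (J.M volume s z (torusOne d))) +
      ∫ z, (-inner ℝ p z * a z) * inner ℝ (torusOne d) (J.S volume s z C) := by
    rw [← sum_inner_cellSecond, ← JumpKernel.inner_K (hα := hα), ← sum_cellFirst, inner_sum,
      ← Finset.sum_add_distrib]
    refine Finset.sum_congr rfl fun i _ => ?_
    rw [hC, map_sum, Finset.smul_sum, inner_sum, ← Finset.sum_add_distrib]
    refine Finset.sum_congr rfl fun j _ => ?_
    rw [map_smul, inner_smul_right, inner_smul_right, inner_add_right]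
    ring
  obtain ⟨hEi, hE⟩ := J.inner_gen (ν := volume) h.kernel_integrable h.kernel_even s C
  have i1 := J.integrable_inner_M (ν := volume) hβ s (torusOne d) (torusOne d)
  have i2 := J.integrable_inner_S (ν := volume) hα s (torusOne d) C
  have i3 := J.integrable_inner_S (ν := volume) hα s C (torusOne d)
  have i1' := i1.const_mul (1 / 2)
  have i4 := hEi.const_mul (-(1 / 2))
  rw [e1, inner_add_right, cellGen, ← hJ, hE, sum_cellFirst, JumpKernel.inner_K, ← integral_const_mul,
    ← integral_const_mul, ← integral_const_mul, ← integral_add i1' i2, ← integral_add i4 i3]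
  have i5 : Integrable fun z => 1 / 2 * ((inner ℝ p z) ^ 2 * a z * inner ℝ (torusOne d)
      (J.M volume s z (torusOne d))) + (-inner ℝ p z * a z) * inner ℝ (torusOne d) (J.S volume s z C) := i1'.add i2
  have i6 : Integrable fun z => -(1 / 2) * (a z * J.energy s z C) + (-inner ℝ p z * a z) *
      inner ℝ C (J.S volume s z (torusOne d)) := i4.add i3
  rw [← integral_sub i5 i6]
  refine integral_mono (hβ.const_mul _) ((i1'.add i2).sub (i4.add i3)) fun z => ?_
  have h1 := mul_le_mul_of_nonneg_left (cell_square_ge h s z (inner ℝ p z) C) (h.kernel_nonneg z)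
  rw [← hJ] at h1
  have h2 : J.S volume s z (torusOne d) = J.M volume s z (torusOne d) := by
    rw [JumpKernel.S_apply, tr_torusOne]
  simp only [h2]
  linarith

theorem effMatrix_quadratic (χ : Fin d → ℝ → L2Torus d) (p : Space d) :
    ∑ i, ∑ j, p i * p j * effMatrix a μ χ i j = ∑ i, ∑ j, p i * p j * preEffMatrix a μ χ i j := by
  have e : ∑ i, ∑ j, p i * p j * preEffMatrix a μ χ j i = ∑ i, ∑ j, p i * p j * preEffMatrix a μ χ i j := by
    rw [Finset.sum_comm]
    exact Finset.sum_congr rfl fun i _ => Finset.sum_congr rfl fun j _ => by ring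
  calc ∑ i, ∑ j, p i * p j * effMatrix a μ χ i j
      = 1 / 2 * (∑ i, ∑ j, p i * p j * preEffMatrix a μ χ i j) +
        1 / 2 * (∑ i, ∑ j, p i * p j * preEffMatrix a μ χ j i) := by
        simp_rw [Finset.mul_sum, ← Finset.sum_add_distrib]
        refine Finset.sum_congr rfl fun i _ => Finset.sum_congr rfl fun j _ => ?_
        rw [effMatrix, Matrix.of_apply]; ring
    _ = _ := by rw [e]; ring

theorem cell_mean_integrable (h : Conditions a μ) {F c : ℝ → L2Torus d} (hc : IsCellFlow h F c)
    (i j : Fin d) : IntervalIntegrable (fun s => inner ℝ (torusOne d)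
      (cellSecond h i j s (torusOne d) + cellFirst h i s (c s))) volume 0 1 := by
  obtain ⟨C1, hC1⟩ := cellSecond_family h i j
  obtain ⟨C2, hC2⟩ := cellFirst_family h i
  exact intervalIntegrable_inner continuousOn_const
    ((intervalIntegrable_family hC1 continuous_const 0 1).add (intervalIntegrable_family hC2 hc.cont 0 1))

theorem preEffMatrix_quadratic_pos (h : Conditions a μ) (hm : Measurable a) {χ : Fin d → ℝ → L2Torus d}
    (hχ : IsCorrector a μ χ) {p : Space d} (hp : p ≠ 0) :
    0 < ∑ i, ∑ j, p i * p j * preEffMatrix a μ χ i j := by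
  have hc := fun j => (hχ.isCellFlow h hm j).2
  have hper := fun j => (hχ.isCellFlow h hm j).1
  set C : ℝ → L2Torus d := fun s => ∑ j, p j • (-χ j s) with hC
  set f : ℝ → L2Torus d := fun s => cellGen h s (C s) + ∑ j, p j • cellFirst h j s (torusOne d) with hf
  have hf' : ∀ s, f s = ∑ j, p j • (cellGen h s (-χ j s) + cellFirst h j s (torusOne d)) := fun s => by
    simp only [hf, hC, map_sum, map_smul, smul_add, Finset.sum_add_distrib]
  have hfi : ∀ a b, IntervalIntegrable f volume a b := fun a b => by
    rw [show f = _ from funext hf']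
    have := IntervalIntegrable.sum Finset.univ (f := fun j s => p j • (cellGen h s (-χ j s) +
      cellFirst h j s (torusOne d))) (a := a) (b := b) (μ := volume)
      fun j _ => ((hc j).integrable a b).smul (p j)
    convert! this using 1
    ext1 s; simp
  have hprim : ∀ t, C t = C 0 + ∫ s in (0 : ℝ)..t, f s := fun t => by
    simp_rw [hf']
    have hs : ∀ j, IntervalIntegrable (fun s => p j • (cellGen h s (-χ j s) + cellFirst h j s (torusOne d)))
        volume 0 t := fun j => ((hc j).integrable 0 t).smul (p j)
    rw [intervalIntegral.integral_finsetSum fun j _ => hs j]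
    simp only [hC]
    rw [← Finset.sum_add_distrib]
    refine Finset.sum_congr rfl fun j _ => ?_
    rw [intervalIntegral.integral_smul, ← smul_add, ← (hc j).eq t]
  -- The energy of the periodic function `C` returns to its initial value, hence the work `∫ ⟨C, f⟩`
  -- over one period is zero.
  have hen := norm_sq_primitive zero_le_one (hfi 0 1) fun s _ => hprim s
  have hC1 : C 1 = C 0 := by
    simp only [hC]
    refine Finset.sum_congr rfl fun j _ => ?_
    have := hper j 0
    rw [zero_add] at this
    rw [this]
  rw [hC1] at hen
  have hz : ∫ s in (0 : ℝ)..1, inner ℝ (C s) (f s) = 0 := by linarith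
  have hCc : Continuous C := continuous_finsetSum _ fun j _ => (hc j).cont.const_smul (p j)
  have hii : ∀ i j, IntervalIntegrable (fun s => p i * p j * inner ℝ (torusOne d)
      (cellSecond h i j s (torusOne d) + cellFirst h i s (-χ j s))) volume 0 1 := fun i j =>
    (cell_mean_integrable h (hc j) i j).const_mul _
  have hi1 : IntervalIntegrable (fun s => ∑ i, ∑ j, p i * p j * inner ℝ (torusOne d)
      (cellSecond h i j s (torusOne d) + cellFirst h i s (-χ j s))) volume 0 1 := by
    have := IntervalIntegrable.sum Finset.univ (f := fun i s => ∑ j, p i * p j * inner ℝ (torusOne d)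
      (cellSecond h i j s (torusOne d) + cellFirst h i s (-χ j s))) (a := 0) (b := 1) (μ := volume)
      fun i _ => by
        have := IntervalIntegrable.sum Finset.univ (f := fun j s => p i * p j * inner ℝ (torusOne d)
          (cellSecond h i j s (torusOne d) + cellFirst h i s (-χ j s))) (a := 0) (b := 1) (μ := volume)
          fun j _ => hii i j
        convert! this using 1
        ext1 s; simp
    convert! this using 1
    ext1 s; simp
  have hi2 := intervalIntegrable_inner hCc.continuousOn (hfi 0 1)
  have hmono := intervalIntegral.integral_mono_on zero_le_one (intervalIntegrable_const (μ := volume))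
    (hi1.sub hi2) fun s _ => cell_quadratic_ge h p s fun j => -χ j s
  rw [intervalIntegral.integral_const, intervalIntegral.integral_sub hi1 hi2, hz,
    intervalIntegral.integral_finsetSum] at hmono
  · have e : ∑ i, ∫ s in (0 : ℝ)..1, ∑ j, p i * p j * inner ℝ (torusOne d)
      (cellSecond h i j s (torusOne d) + cellFirst h i s (-χ j s)) =
      ∑ i, ∑ j, p i * p j * preEffMatrix a μ χ i j := by
      refine Finset.sum_congr rfl fun i _ => ?_
      rw [intervalIntegral.integral_finsetSum fun j _ => hii i j]
      refine Finset.sum_congr rfl fun j _ => ?_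
      rw [intervalIntegral.integral_const_mul, preEffMatrix_eq h hm]
    rw [e] at hmono
    have h1 := (cellKernel h).lo_pos
    have h2 := directional_moment_pos h hp
    have h3 : 0 < 1 / 2 * (cellKernel h).lo * ∫ z, (inner ℝ p z) ^ 2 * a z := by positivity
    simp only [sub_zero, one_smul] at hmono
    linarith
  · intro i _
    have := IntervalIntegrable.sum Finset.univ (f := fun j s => p i * p j * inner ℝ (torusOne d)
      (cellSecond h i j s (torusOne d) + cellFirst h i s (-χ j s))) (a := 0) (b := 1) (μ := volume)
      fun j _ => hii i j
    convert! this using 1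
    ext1 s; simp

theorem effMatrix_isSymm (χ : Fin d → ℝ → L2Torus d) : (effMatrix a μ χ).IsSymm := by
  ext i j
  rw [Matrix.transpose_apply, effMatrix, Matrix.of_apply, Matrix.of_apply, add_comm]

theorem effMatrix_posDef (h : Conditions a μ) (hm : Measurable a) {χ : Fin d → ℝ → L2Torus d}
    (hχ : IsCorrector a μ χ) : (effMatrix a μ χ).PosDef := by
  rw [Matrix.posDef_iff_dotProduct_mulVec]
  refine ⟨?_, fun x hx => ?_⟩
  · rw [Matrix.IsHermitian, Matrix.conjTranspose_eq_transpose_of_trivial]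
    exact effMatrix_isSymm χ
  · have hp : (WithLp.toLp 2 x : Space d) ≠ 0 := fun h0 => hx (by
      have := congrArg WithLp.ofLp h0
      simpa using this)
    have := preEffMatrix_quadratic_pos h hm hχ hp
    rw [← effMatrix_quadratic] at this
    convert! this using 1
    simp only [dotProduct, Matrix.mulVec, star_trivial, Finset.mul_sum]
    exact Finset.sum_congr rfl fun i _ => Finset.sum_congr rfl fun j _ => by ring

end Positivity

end NonlocalHomogenization

namespace NonlocalHomogenization

/-! ### Replacing the kernel by a Borel representative -/

section Representative

variable {d : ℕ} {a a' : Space d → ℝ} {μ : Space d → Space d → ℝ → ℝ}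

/-- Evenness and non-negativity are required everywhere, not almost everywhere. Symmetrising the
absolute value of any measurable representative restores both. -/
theorem Conditions.exists_measurable (h : Conditions a μ) :
    ∃ a', Measurable a' ∧ a =ᵐ[volume] a' ∧ Conditions a' μ := by
  obtain ⟨b, hb, hab⟩ := h.kernel_integrable.aestronglyMeasurable
  have hab' : ∀ᵐ z : Space d, a (-z) = b (-z) :=
    (Measure.measurePreserving_neg (volume : Measure (Space d))).quasiMeasurePreserving.ae hab
  have hbm := hb.measurable
  have he : a =ᵐ[volume] fun z => (|b z| + |b (-z)|) / 2 := by
    filter_upwards [hab, hab'] with z h1 h2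
    rw [← h1, ← h2, h.kernel_even, abs_of_nonneg (h.kernel_nonneg z)]; ring
  refine ⟨fun z => (|b z| + |b (-z)|) / 2, by fun_prop, he, ?_⟩
  exact
    { kernel_nonneg := fun z => by positivity
      kernel_integrable := h.kernel_integrable.congr he
      kernel_integral := by rw [← integral_congr_ae he]; exact h.kernel_integral
      kernel_second_moment := h.kernel_second_moment.congr (he.mono fun z hz => by simp only [hz])
      coeff_measurable := h.coeff_measurable
      coeff_elliptic := h.coeff_elliptic
      coeff_periodic_left := h.coeff_periodic_left
      coeff_periodic_right := h.coeff_periodic_right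
      coeff_periodic_time := h.coeff_periodic_time
      kernel_even := fun z => by simp only [neg_neg]; rw [add_comm]
      coeff_symm := h.coeff_symm }

theorem quasiMeasurePreserving_smul_sub {ε : ℝ} (hε : ε ≠ 0) (x : Space d) :
    Measure.QuasiMeasurePreserving (fun y : Space d => ε⁻¹ • (x - y)) :=
  (Measure.quasiMeasurePreserving_smul (volume : Measure (Space d)) (inv_ne_zero hε)).comp
    (Measure.measurePreserving_sub_left (volume : Measure (Space d)) x).quasiMeasurePreserving

theorem scaledOp_congr (he : a =ᵐ[volume] a') {ε : ℝ} (hε : ε ≠ 0) : scaledOp a μ ε = scaledOp a' μ ε := by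
  funext t v x
  rw [scaledOp, scaledOp]
  congr 1
  refine integral_congr_ae ?_
  filter_upwards [(quasiMeasurePreserving_smul_sub hε x).ae he] with y hy
  rw [hy]

theorem ae_kernel_sub (he : a =ᵐ[volume] a') (x : Space d) : ∀ᵐ y : Space d, a (x - y) = a' (x - y) :=
  (Measure.measurePreserving_sub_left (volume : Measure (Space d)) x).quasiMeasurePreserving.ae he

theorem cellOp_congr (he : a =ᵐ[volume] a') : cellOp a μ = cellOp a' μ := by
  funext s β x
  refine integral_congr_ae ?_
  filter_upwards [ae_kernel_sub he x] with y hy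
  rw [hy]

theorem isCorrector_congr (he : a =ᵐ[volume] a') (χ : Fin d → ℝ → L2Torus d) :
    IsCorrector a μ χ ↔ IsCorrector a' μ χ := by
  have : ∀ s j (ξ : Space d), ∫ η, a (ξ - η) * μ ξ η s * (η j - ξ j) =
      ∫ η, a' (ξ - η) * μ ξ η s * (η j - ξ j) := fun s j ξ => by
    refine integral_congr_ae ?_
    filter_upwards [ae_kernel_sub he ξ] with y hy
    rw [hy]
  simp_rw [IsCorrector, cellOp_congr he, this]

theorem effMatrix_congr (he : a =ᵐ[volume] a') (χ : Fin d → ℝ → L2Torus d) :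
    effMatrix a μ χ = effMatrix a' μ χ := by
  have : preEffMatrix a μ χ = preEffMatrix a' μ χ := by
    ext i j
    rw [preEffMatrix, preEffMatrix, Matrix.of_apply, Matrix.of_apply]
    congr 1
    ext s
    congr 1
    ext ξ
    refine integral_congr_ae ?_
    filter_upwards [ae_kernel_sub he ξ] with y hy
    rw [hy]
  rw [effMatrix, effMatrix, this]

theorem isScaledSolution_congr (he : a =ᵐ[volume] a') {ε T : ℝ} (hε : ε ≠ 0) (u₀ : L2Space d)
    (u : ℝ → L2Space d) : IsScaledSolution a μ ε T u₀ u ↔ IsScaledSolution a' μ ε T u₀ u := by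
  rw [IsScaledSolution, IsScaledSolution, scaledOp_congr he hε]

end Representative

/-! ### The second cell problem -/

section SecondCorrector

variable {d : ℕ} {a : Space d → ℝ} {μ : Space d → Space d → ℝ → ℝ}

/-- Subtracting `â_ij` makes the space-time mean of the forcing vanish. The mean at a fixed time
need not vanish, hence the appeal to `exists_cell_solution`. -/
theorem exists_second_corrector (h : Conditions a μ) (hm : Measurable a) {χ : Fin d → ℝ → L2Torus d}
    (hχ : IsCorrector a μ χ) (i j : Fin d) : ∃ κ, IsCellFlow h (fun s => cellSecond h i j s (torusOne d) +
      cellFirst h i s (-χ j s) - preEffMatrix a μ χ i j • torusOne d) κ := by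
  obtain ⟨hper, hc⟩ := hχ.isCellFlow h hm j
  obtain ⟨C1, hC1⟩ := cellSecond_family h i j
  obtain ⟨C2, hC2⟩ := cellFirst_family h i
  obtain ⟨R, hR⟩ := hc.bdd
  have hi := cell_mean_integrable h hc i j
  obtain ⟨κ, h1, h2, h3, h4⟩ := exists_cell_solution h
    (F := fun s => cellSecond h i j s (torusOne d) +
      cellFirst h i s (-χ j s) - preEffMatrix a μ χ i j • torusOne d)
    (((hC1.meas _).add (hC2.comp hc.cont.stronglyMeasurable)).sub stronglyMeasurable_const)
    (M := C1 * ‖torusOne d‖ + C2 * R + ‖preEffMatrix a μ χ i j • torusOne d‖)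
    (fun s => (norm_sub_le _ _).trans (add_le_add_left ((norm_add_le _ _).trans
      (add_le_add (hC1.norm_le _ _) ((hC2.norm_le _ _).trans
        (mul_le_mul_of_nonneg_left (hR s) hC2.nonneg)))) _))
    (fun s => by simp only [cellSecond_periodic, cellFirst_periodic, hper s])
    (by
      simp_rw [inner_sub_right _ _ (preEffMatrix a μ χ i j • torusOne d)]
      rw [intervalIntegral.integral_sub hi intervalIntegrable_const, ← preEffMatrix_eq h hm,
        inner_smul_right, real_inner_self_eq_norm_sq, norm_torusOne]
      simp)
  exact ⟨κ, h1, h2, h3, h4⟩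

end SecondCorrector

/-! ### The rescaled operator as a jump generator -/

section Scaled

variable {d : ℕ} {a : Space d → ℝ} {μ : Space d → Space d → ℝ → ℝ}

/-- The rescaled jump kernel on `ℝ^d`. -/
def scaledKernel (h : Conditions a μ) {ε : ℝ} (hε : 0 < ε) : JumpKernel d (Space d) where
  shift z := ε • z
  coeff s z x := μ (ε⁻¹ • x) (ε⁻¹ • x - z) (s / ε ^ 2)
  lo := h.coeff_elliptic.choose
  hi := h.coeff_elliptic.choose_spec.choose
  shift_meas := by fun_prop
  shift_neg z := smul_neg _ _
  coeff_meas := by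
    have h1 : Measurable fun p : (ℝ × Space d) × Space d => ε⁻¹ • p.2 := by fun_prop
    have h2 : Measurable fun p : (ℝ × Space d) × Space d => ε⁻¹ • p.2 - p.1.2 := by fun_prop
    have h3 : Measurable fun p : (ℝ × Space d) × Space d => p.1.1 / ε ^ 2 := by fun_prop
    exact h.coeff_measurable.comp (h1.prodMk (h2.prodMk h3))
  lo_pos := h.coeff_elliptic.choose_spec.choose_spec.1
  lo_le s z x := (h.coeff_elliptic.choose_spec.choose_spec.2.2 _ _ _).1
  le_hi s z x := (h.coeff_elliptic.choose_spec.choose_spec.2.2 _ _ _).2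
  symm s z x := by
    rw [smul_sub, smul_smul, inv_mul_cancel₀ hε.ne', one_smul, sub_neg_eq_add, sub_add_cancel,
      h.coeff_symm]

/-- The operator `𝒜^ε(t)` on `L²(ℝ^d)`. -/
def scaledGen (h : Conditions a μ) {ε : ℝ} (hε : 0 < ε) (t : ℝ) : L2Space d →L[ℝ] L2Space d :=
  (ε ^ 2)⁻¹ • (scaledKernel h hε).gen h.kernel_integrable t

theorem scaledGen_family (h : Conditions a μ) {ε : ℝ} (hε : 0 < ε) : ∃ C, BddFamily (scaledGen h hε) C := by
  have := (scaledKernel h hε).gen_family (ν := volume) h.kernel_integrable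
  exact ⟨_, fun f => (this.meas f).const_smul ((ε ^ 2)⁻¹), fun s => (norm_smul_le _ _).trans
    (mul_le_mul_of_nonneg_left (this.bound s) (norm_nonneg _))⟩

theorem scaledGen_dissipative (h : Conditions a μ) {ε : ℝ} (hε : 0 < ε) (t : ℝ) (f : L2Space d) :
    inner ℝ f (scaledGen h hε t f) ≤ 0 := by
  change inner ℝ f ((ε ^ 2)⁻¹ • (scaledKernel h hε).gen h.kernel_integrable t f) ≤ 0
  rw [inner_smul_right]
  exact mul_nonpos_of_nonneg_of_nonpos (by positivity)
    ((scaledKernel h hε).gen_dissipative h.kernel_integrable h.kernel_nonneg h.kernel_even t f)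

/-- The change of variables `y = x - εz` has Jacobian `ε^d`, which leaves `ε⁻²` of the prefactor
`ε^{-(d+2)}`. -/
theorem scaledOp_ae (h : Conditions a μ) (hm : Measurable a) {ε : ℝ} (hε : 0 < ε) (t : ℝ) (f : L2Space d) :
    scaledGen h hε t f =ᵐ[volume] scaledOp a μ ε t f := by
  filter_upwards [(scaledKernel h hε).gen_ae (ν := volume) hm h.kernel_integrable t f,
    Lp.coeFn_smul (ε ^ 2)⁻¹ ((scaledKernel h hε).gen h.kernel_integrable t f)] with x h1 h2
  change ((ε ^ 2)⁻¹ • (scaledKernel h hε).gen h.kernel_integrable t f : L2Space d) x = _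
  rw [h2, Pi.smul_apply, h1, scaledOp]
  have e := Measure.integral_comp_smul (volume : Measure (Space d))
    (fun z => a (ε⁻¹ • z) * μ (ε⁻¹ • x) (ε⁻¹ • (x - z)) (t / ε ^ 2) * (f (x - z) - f x)) ε
  rw [← integral_sub_left_eq_self (fun y => a (ε⁻¹ • (x - y)) * μ (ε⁻¹ • x) (ε⁻¹ • y) (t / ε ^ 2) *
    (f y - f x)) volume x]
  simp only [sub_sub_cancel]
  have e2 : ∫ z, a z * ((scaledKernel h hε).coeff t z x * (f (x - (scaledKernel h hε).shift z) - f x)) =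
      ∫ z, a (ε⁻¹ • ε • z) * μ (ε⁻¹ • x) (ε⁻¹ • (x - ε • z)) (t / ε ^ 2) * (f (x - ε • z) - f x) := by
    refine integral_congr_ae (ae_of_all _ fun z => ?_)
    simp only [smul_sub, smul_smul, inv_mul_cancel₀ hε.ne', one_smul]
    rw [mul_assoc]; rfl
  rw [e2, e, finrank_euclideanSpace_fin, abs_of_pos (by positivity), smul_eq_mul, smul_eq_mul, ← mul_assoc,
    ← mul_inv, one_div, pow_add, mul_comm (ε ^ 2)]

end Scaled

end NonlocalHomogenization

/-! ### The rescaled Cauchy problem: existence and stability -/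

namespace NonlocalHomogenization

section ScaledSolution

variable {d : ℕ} {a : Space d → ℝ} {μ : Space d → Space d → ℝ → ℝ}

theorem exists_isScaledSolution (h : Conditions a μ) (hm : Measurable a) {ε : ℝ} (hε : 0 < ε) {T : ℝ}
    (hT : 0 < T) (u₀ : L2Space d) : ∃ u, IsScaledSolution a μ ε T u₀ u := by
  obtain ⟨C, hC⟩ := scaledGen_family h hε
  obtain ⟨x, hxc, hx⟩ := exists_evolution hC (F := fun _ => 0) stronglyMeasurable_zero (M := 0)
    (fun _ => by simp) u₀
  simp only [add_zero] at hx
  have hi := intervalIntegrable_family hC hxc 0 T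
  obtain ⟨R, hR⟩ := (isCompact_Icc (a := (0 : ℝ)) (b := T)).exists_bound_of_continuousOn hxc.continuousOn
  refine ⟨x, ?_, fun s => scaledGen h hε s (x s), ?_, ?_, ae_of_all _ hx⟩
  · refine memLp_top_of_bound hxc.aestronglyMeasurable R ((ae_restrict_iff' measurableSet_Ioo).2
      (ae_of_all _ fun s hs => hR s (Ioo_subset_Icc_self hs)))
  · exact (intervalIntegrable_iff_integrableOn_Ioo_of_le hT.le).1 hi
  · exact ae_of_all _ fun t => scaledOp_ae h hm hε t (x t)

theorem ae_Icc_of_ae_restrict_Ioo {T : ℝ} {p : ℝ → Prop} (hp : ∀ᵐ t ∂volume.restrict (Ioo (0 : ℝ) T), p t) :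
    ∀ᵐ t, t ∈ Icc 0 T → p t := by
  rw [← ae_restrict_iff' measurableSet_Icc, ← Measure.restrict_congr_set Ioo_ae_eq_Icc]
  exact hp

/-- A solution of the rescaled problem stays close to every approximate solution. -/
theorem IsScaledSolution.norm_sub_le (h : Conditions a μ) (hm : Measurable a) {ε : ℝ} (hε : 0 < ε) {T : ℝ}
    (hT : 0 < T) {u₀ : L2Space d} {u : ℝ → L2Space d} (hu : IsScaledSolution a μ ε T u₀ u) {ρ : ℝ}
    (hρ : 0 ≤ ρ) {w f : ℝ → L2Space d} (hf : IntervalIntegrable f volume 0 T)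
    (hw : ∀ s ∈ Icc 0 T, w s = w 0 + ∫ r in (0 : ℝ)..s, f r)
    (hd : ∀ᵐ s, s ∈ Icc 0 T → ‖f s - scaledGen h hε s (w s)‖ ≤ ρ) :
    ∀ᵐ t ∂volume.restrict (Ioo 0 T), ‖u t - w t‖ ≤ ‖u₀ - w 0‖ + 2 * ρ * T := by
  obtain ⟨-, g, hg, hgA, hug⟩ := hu
  have hgi : IntervalIntegrable g volume 0 T := (intervalIntegrable_iff_integrableOn_Ioo_of_le hT.le).2 hg
  -- The function `u` is determined only almost everywhere in time; the primitive of its derivative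
  -- is the continuous version to which the energy estimate applies.
  set x : ℝ → L2Space d := fun t => (u₀ + ∫ s in (0 : ℝ)..t, g s) - w t with hx
  have hx0 : x 0 = u₀ - w 0 := by simp [hx]
  have hprim : ∀ s ∈ Icc 0 T, x s = x 0 + ∫ r in (0 : ℝ)..s, (g r - f r) := fun s hs => by
    have hsub : uIcc 0 s ⊆ uIcc 0 T := by
      rw [uIcc_of_le hs.1, uIcc_of_le hT.le]; exact Icc_subset_Icc_right hs.2
    rw [intervalIntegral.integral_sub (hgi.mono_set hsub) (hf.mono_set hsub), hx0]
    simp only [hx]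
    rw [hw s hs]; abel
  have key := norm_le_of_dissipative hT.le hρ (hgi.sub hf) hprim (by
    filter_upwards [hd, ae_Icc_of_ae_restrict_Ioo hgA, ae_Icc_of_ae_restrict_Ioo hug] with s h1 h2 h3 hs
    have e : g s = scaledGen h hε s (u s) := by
      refine Lp.ext ?_
      filter_upwards [h2 hs, scaledOp_ae h hm hε s (u s)] with y hy1 hy2
      rw [hy1, hy2]
    -- The error solves the same equation with minus the residual as forcing. Dissipativity discards
    -- the first term, and Cauchy–Schwarz bounds the second by `ρ ‖x‖`.
    have e2 : g s - f s = scaledGen h hε s (x s) - (f s - scaledGen h hε s (w s)) := by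
      rw [e, h3 hs]; simp only [hx, map_sub]; abel
    rw [e2, inner_sub_right]
    have i1 := scaledGen_dissipative h hε s (x s)
    have i2 := (abs_le.1 (abs_real_inner_le_norm (x s) (f s - scaledGen h hε s (w s)))).1
    have i3 := mul_le_mul_of_nonneg_left (h1 hs) (norm_nonneg (x s))
    linarith)
  filter_upwards [hug, ae_restrict_mem measurableSet_Ioo] with t ht hts
  have := key t (Ioo_subset_Icc_self hts)
  rw [hx0] at this
  rwa [ht]

end ScaledSolution

end NonlocalHomogenization

/-! ### Products of slow functions with rapidly oscillating ones -/

namespace NonlocalHomogenization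

open scoped ENNReal

section CellProduct

variable {d : ℕ}

/-- The average of `v` over the cell `x - ε [0,1)^d`. -/
def cellAverage (ε : ℝ) (v : Space d → ℝ) (x : Space d) : ℝ := ∫ θ in unitCell d, v (x - ε • θ)

theorem cellAverage_quasi {ε : ℝ} (hε : ε ≠ 0) (x : Space d) :
    Measure.QuasiMeasurePreserving (fun θ : Space d => x - ε • θ) :=
  (Measure.measurePreserving_sub_left (volume : Measure (Space d)) x).quasiMeasurePreserving.comp
    (Measure.quasiMeasurePreserving_smul (volume : Measure (Space d)) hε)

theorem cellAverage_congr {ε : ℝ} (hε : ε ≠ 0) {v w : Space d → ℝ} (h : v =ᵐ[volume] w) (x : Space d) :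
    cellAverage ε v x = cellAverage ε w x :=
  integral_congr_ae (ae_restrict_of_ae ((cellAverage_quasi hε x).ae h))

theorem integrable_cellAverage {ε : ℝ} (hε : ε ≠ 0) (v : L2Space d) (x : Space d) :
    Integrable (fun θ => v (x - ε • θ)) (volume.restrict (unitCell d)) := by
  have h1 : AEStronglyMeasurable (fun θ : Space d => v (x - ε • θ)) volume :=
    (Lp.aestronglyMeasurable v).comp_quasiMeasurePreserving (cellAverage_quasi hε x)
  have h2 : MemLp (fun θ : Space d => v (x - ε • θ)) 2 volume := by
    rw [memLp_two_iff_integrable_sq_norm h1]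
    have h3 := (memLp_two_iff_integrable_sq_norm (Lp.aestronglyMeasurable v)).1 (Lp.memLp v)
    exact (h3.comp_sub_left x).comp_smul hε
  exact (h2.restrict _).integrable one_le_two

theorem cellAverage_measurable (ε : ℝ) (v : L2Space d) : StronglyMeasurable (cellAverage ε v) := by
  have h1 : StronglyMeasurable fun p : Space d × Space d => v (p.1 - ε • p.2) :=
    (Lp.stronglyMeasurable v).comp_measurable (by fun_prop)
  exact h1.integral_prod_right'

/-- Jensen's inequality for the square on a probability space. -/
theorem enorm_integral_sq_le {X : Type*} [MeasurableSpace X] {ν : Measure X} [IsProbabilityMeasure ν]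
    {f : X → ℝ} (hf : AEStronglyMeasurable f ν) : ‖∫ x, f x ∂ν‖ₑ ^ 2 ≤ ∫⁻ x, ‖f x‖ₑ ^ 2 ∂ν := by
  have h1 : ‖∫ x, f x ∂ν‖ₑ ≤ eLpNorm f 2 ν := by
    refine (enorm_integral_le_lintegral_enorm f).trans ?_
    rw [← eLpNorm_one_eq_lintegral_enorm]
    exact eLpNorm_le_eLpNorm_of_exponent_le one_le_two hf
  have h2 := eLpNorm_nnreal_pow_eq_lintegral (f := f) (μ := ν) (p := 2) two_ne_zero
  simp only [NNReal.coe_ofNat, ENNReal.rpow_ofNat, ENNReal.coe_ofNat] at h2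
  rw [← h2]
  exact pow_le_pow_left₀ zero_le h1 2

theorem lintegral_cell_translate {G : UnitAddTorus (Fin d) → ℝ≥0∞} (hG : Measurable G) (y : Space d) :
    ∫⁻ θ in unitCell d, G (torusProj (y + θ)) = ∫⁻ ξ, G ξ := by
  have h1 : ∀ θ : Space d, torusProj (y + θ) = torusProj θ + torusProj y := fun θ => by
    rw [torusProj_add, add_comm]
  simp_rw [h1]
  rw [measurePreserving_torusProj.lintegral_comp (f := fun ξ => G (ξ + torusProj y))
    (hG.comp (measurable_add_const _))]
  exact lintegral_add_right_eq_self G _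

/-- After Jensen, translating `x` by `εθ` moves the average over `θ` from the slow factor to the
oscillating one. That average runs over a full period, so it gives the norm on the torus
independently of `x`, and the two factors decouple. -/
theorem lintegral_cellProduct_le {ε : ℝ} (hε : 0 < ε) (v : L2Space d) (χ : L2Torus d) :
    ∫⁻ x, ‖cellAverage ε v x * χ (torusProj (ε⁻¹ • x))‖ₑ ^ 2 ≤
      (∫⁻ x, ‖v x‖ₑ ^ 2) * ∫⁻ ξ, ‖χ ξ‖ₑ ^ 2 := by
  have hv : Measurable v := (Lp.stronglyMeasurable v).measurable
  have hχ : Measurable χ := (Lp.stronglyMeasurable χ).measurable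
  set V : Space d → ℝ≥0∞ := fun x => ‖v x‖ₑ ^ 2 with hV
  set G : UnitAddTorus (Fin d) → ℝ≥0∞ := fun ξ => ‖χ ξ‖ₑ ^ 2 with hGdef
  have hVm : Measurable V := hv.enorm.pow_const 2
  have hGm : Measurable G := hχ.enorm.pow_const 2
  have hpm := torusProj_measurable (d := d)
  calc ∫⁻ x, ‖cellAverage ε v x * χ (torusProj (ε⁻¹ • x))‖ₑ ^ 2
      ≤ ∫⁻ x, ∫⁻ θ in unitCell d, V (x - ε • θ) * G (torusProj (ε⁻¹ • x)) := by
        refine lintegral_mono fun x => ?_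
        have hVx : Measurable fun θ : Space d => V (x - ε • θ) := hVm.comp (by fun_prop)
        rw [enorm_mul, mul_pow, lintegral_mul_const _ hVx]
        exact mul_le_mul_left (enorm_integral_sq_le (integrable_cellAverage hε.ne' v x).aestronglyMeasurable) _
    _ = ∫⁻ θ in unitCell d, ∫⁻ x, V (x - ε • θ) * G (torusProj (ε⁻¹ • x)) := by
        refine lintegral_lintegral_swap (Measurable.aemeasurable ?_)
        exact (hVm.comp (by fun_prop)).mul (hGm.comp (hpm.comp (by fun_prop)))
    _ = ∫⁻ θ in unitCell d, ∫⁻ x, V x * G (torusProj (ε⁻¹ • x + θ)) := by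
        refine lintegral_congr fun θ => ?_
        rw [← lintegral_add_right_eq_self (μ := (volume : Measure (Space d)))
          (fun x => V (x - ε • θ) * G (torusProj (ε⁻¹ • x))) (ε • θ)]
        simp only [add_sub_cancel_right, smul_add, smul_smul, inv_mul_cancel₀ hε.ne', one_smul]
    _ = ∫⁻ x, ∫⁻ θ in unitCell d, V x * G (torusProj (ε⁻¹ • x + θ)) := by
        refine lintegral_lintegral_swap (Measurable.aemeasurable ?_)
        exact (hVm.comp measurable_snd).mul (hGm.comp (hpm.comp (by fun_prop)))
    _ = ∫⁻ x, V x * ∫⁻ ξ, G ξ := by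
        refine lintegral_congr fun x => ?_
        have hGx : Measurable fun θ : Space d => G (torusProj (ε⁻¹ • x + θ)) :=
          hGm.comp (hpm.comp (by fun_prop))
        rw [lintegral_const_mul _ hGx, lintegral_cell_translate hGm]
    _ = _ := by rw [lintegral_mul_const _ hVm]

theorem quasi_torusProj_smul {ε : ℝ} (hε : ε ≠ 0) :
    Measure.QuasiMeasurePreserving (fun x : Space d => torusProj (ε⁻¹ • x)) :=
  quasiMeasurePreserving_torusProj.comp
    (Measure.quasiMeasurePreserving_smul (volume : Measure (Space d)) (inv_ne_zero hε))

theorem eLpNorm_two_sq {X : Type*} [MeasurableSpace X] {ν : Measure X} (f : X → ℝ) :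
    eLpNorm f 2 ν ^ 2 = ∫⁻ x, ‖f x‖ₑ ^ 2 ∂ν := by
  have h2 := eLpNorm_nnreal_pow_eq_lintegral (f := f) (μ := ν) (p := 2) two_ne_zero
  simpa only [NNReal.coe_ofNat, ENNReal.rpow_ofNat, ENNReal.coe_ofNat] using h2

theorem eLpNorm_cellProduct_le {ε : ℝ} (hε : 0 < ε) (v : L2Space d) (χ : L2Torus d) :
    eLpNorm (fun x => cellAverage ε v x * χ (torusProj (ε⁻¹ • x))) 2 volume ≤
      eLpNorm v 2 volume * eLpNorm χ 2 volume := by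
  have := lintegral_cellProduct_le hε v χ
  rw [← eLpNorm_two_sq, ← eLpNorm_two_sq, ← eLpNorm_two_sq, ← mul_pow] at this
  exact (ENNReal.pow_right_strictMono two_ne_zero).le_iff_le.1 this

theorem memLp_cellProduct {ε : ℝ} (hε : 0 < ε) (v : L2Space d) (χ : L2Torus d) :
    MemLp (fun x => cellAverage ε v x * χ (torusProj (ε⁻¹ • x))) 2 volume :=
  ⟨(cellAverage_measurable ε v).aestronglyMeasurable.mul
    ((Lp.aestronglyMeasurable χ).comp_quasiMeasurePreserving (quasi_torusProj_smul hε.ne')),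
    (eLpNorm_cellProduct_le hε v χ).trans_lt (ENNReal.mul_lt_top (Lp.eLpNorm_lt_top v) (Lp.eLpNorm_lt_top χ))⟩

/-- The bilinear map `(v, χ) ↦ (average of v over x - ε[0,1)^d) χ(x/ε)`. -/
def cellProduct {ε : ℝ} (hε : 0 < ε) : L2Space d →L[ℝ] L2Torus d →L[ℝ] L2Space d :=
  LinearMap.mkContinuous₂
    (LinearMap.mk₂ ℝ (fun v χ => (memLp_cellProduct hε v χ).toLp _)
      (fun v w χ => by
        rw [← MemLp.toLp_add]
        refine MemLp.toLp_congr _ _ (ae_of_all _ fun x => ?_)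
        beta_reduce
        rw [Pi.add_apply, cellAverage_congr hε.ne' (Lp.coeFn_add v w), ← add_mul, cellAverage, cellAverage,
          cellAverage, ← integral_add (integrable_cellAverage hε.ne' v x) (integrable_cellAverage hε.ne' w x)]
        rfl)
      (fun c v χ => by
        rw [← MemLp.toLp_const_smul]
        refine MemLp.toLp_congr _ _ (ae_of_all _ fun x => ?_)
        beta_reduce
        rw [Pi.smul_apply, cellAverage_congr hε.ne' (Lp.coeFn_smul c v), smul_eq_mul, ← mul_assoc, cellAverage,
          cellAverage, ← integral_const_mul]
        rfl)
      (fun v χ κ => by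
        rw [← MemLp.toLp_add]
        refine MemLp.toLp_congr _ _ ?_
        filter_upwards [(quasi_torusProj_smul hε.ne').ae (Lp.coeFn_add χ κ)] with x hx
        rw [Pi.add_apply, hx, Pi.add_apply, mul_add])
      (fun c v χ => by
        rw [← MemLp.toLp_const_smul]
        refine MemLp.toLp_congr _ _ ?_
        filter_upwards [(quasi_torusProj_smul hε.ne').ae (Lp.coeFn_smul c χ)] with x hx
        rw [Pi.smul_apply, hx, Pi.smul_apply, smul_eq_mul, smul_eq_mul]; ring)) 1
    fun v χ => by
      rw [LinearMap.mk₂_apply, Lp.norm_toLp, one_mul, Lp.norm_def, Lp.norm_def, ← ENNReal.toReal_mul]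
      exact ENNReal.toReal_mono (ENNReal.mul_ne_top (Lp.eLpNorm_ne_top v) (Lp.eLpNorm_ne_top χ))
        (eLpNorm_cellProduct_le hε v χ)

theorem cellProduct_ae {ε : ℝ} (hε : 0 < ε) (v : L2Space d) (χ : L2Torus d) :
    cellProduct hε v χ =ᵐ[volume] fun x => cellAverage ε v x * χ (torusProj (ε⁻¹ • x)) :=
  MemLp.coeFn_toLp (memLp_cellProduct hε v χ)

theorem cellProduct_norm_le {ε : ℝ} (hε : 0 < ε) (v : L2Space d) (χ : L2Torus d) :
    ‖cellProduct hε v χ‖ ≤ ‖v‖ * ‖χ‖ := by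
  have : cellProduct hε v χ = (memLp_cellProduct hε v χ).toLp _ := rfl
  rw [this, Lp.norm_toLp, Lp.norm_def, Lp.norm_def, ← ENNReal.toReal_mul]
  exact ENNReal.toReal_mono (ENNReal.mul_ne_top (Lp.eLpNorm_ne_top v) (Lp.eLpNorm_ne_top χ))
    (eLpNorm_cellProduct_le hε v χ)

variable {a : Space d → ℝ} {μ : Space d → Space d → ℝ → ℝ}

theorem scaledKernel_M_cellProduct (h : Conditions a μ) {ε : ℝ} (hε : 0 < ε) (t : ℝ) (z : Space d)
    (v : L2Space d) (χ : L2Torus d) :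
    (scaledKernel h hε).M volume t z (cellProduct hε v χ) =
      cellProduct hε v ((cellKernel h).M volume (t / ε ^ 2) z χ) := by
  refine Lp.ext ?_
  filter_upwards [(scaledKernel h hε).M_ae t z (cellProduct hε v χ), cellProduct_ae hε v χ,
    cellProduct_ae hε v ((cellKernel h).M volume (t / ε ^ 2) z χ),
    (quasi_torusProj_smul hε.ne').ae ((cellKernel h).M_ae (t / ε ^ 2) z χ)] with x h1 h2 h3 h4
  rw [h1, h2, h3, h4, cellKernel_coeff]
  simp only [scaledKernel]
  ring

/-- A jump by `εz` shifts the slow variable by `εz` and the fast one by `z`, and averaging over a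
cell commutes with translations. -/
theorem scaledKernel_S_cellProduct (h : Conditions a μ) {ε : ℝ} (hε : 0 < ε) (t : ℝ) (z : Space d)
    (v : L2Space d) (χ : L2Torus d) :
    (scaledKernel h hε).S volume t z (cellProduct hε v χ) =
      cellProduct hε (transL ℝ volume (ε • z) v) ((cellKernel h).S volume (t / ε ^ 2) z χ) := by
  refine Lp.ext ?_
  have hq := (measurePreserving_sub_right (volume : Measure (Space d)) (ε • z)).quasiMeasurePreserving
  filter_upwards [(scaledKernel h hε).S_ae t z (cellProduct hε v χ), hq.ae (cellProduct_ae hε v χ),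
    cellProduct_ae hε (transL ℝ volume (ε • z) v) ((cellKernel h).S volume (t / ε ^ 2) z χ),
    (quasi_torusProj_smul hε.ne').ae ((cellKernel h).S_ae (t / ε ^ 2) z χ)] with x h1 h2 h3 h4
  rw [h1, h3, h4, cellKernel_coeff, cellAverage_congr hε.ne' (transL_ae (ε • z) v)]
  have e1 : cellAverage ε (fun x => v (x - ε • z)) x = cellAverage ε v (x - ε • z) := by
    simp only [cellAverage, sub_right_comm]
  have e2 : torusProj (ε⁻¹ • (x - ε • z)) = torusProj (ε⁻¹ • x) - (cellKernel h).shift z := by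
    rw [smul_sub, smul_smul, inv_mul_cancel₀ hε.ne', one_smul, torusProj_sub]; rfl
  simp only [scaledKernel] at h2 ⊢
  rw [h2, e1, e2]
  ring

theorem norm_le_of_mem_unitCell {θ : Space d} (hθ : θ ∈ unitCell d) : ‖θ‖ ≤ Real.sqrt d := by
  rw [EuclideanSpace.norm_eq]
  refine Real.sqrt_le_sqrt ?_
  have : ∑ i : Fin d, ‖θ i‖ ^ 2 ≤ ∑ _i : Fin d, (1 : ℝ) := Finset.sum_le_sum fun i _ => by
    have := hθ i
    rw [Real.norm_of_nonneg this.1]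
    nlinarith [this.1, this.2]
  simpa using this

theorem transL_space_meas (ε : ℝ) (v : L2Space d) :
    StronglyMeasurable fun θ : Space d => transL ℝ (volume : Measure (Space d)) (ε • θ) v := by
  refine stronglyMeasurable_Lp_of_joint (G := fun p : Space d × Space d => v (p.2 - ε • p.1))
    ((Lp.stronglyMeasurable v).measurable.comp (by fun_prop)) fun θ => transL_ae _ _

/-- On slowly varying functions the cell product with the constant one is almost the identity. -/
theorem norm_cellProduct_one_sub_le {ε : ℝ} (hε : 0 < ε) (v : L2Space d) {C : ℝ} (hC0 : 0 ≤ C)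
    (hC : ∀ h, ‖transL ℝ volume h v - v‖ ≤ C * ‖h‖) :
    ‖cellProduct hε v (torusOne d) - v‖ ≤ C * (ε * Real.sqrt d) := by
  have hbd : ∀ θ ∈ unitCell d, ‖transL ℝ volume (ε • θ) v - v‖ ≤ C * (ε * Real.sqrt d) := fun θ hθ => by
    refine (hC _).trans ?_
    rw [norm_smul, Real.norm_of_nonneg hε.le]
    have := norm_le_of_mem_unitCell hθ
    gcongr
  have hm := transL_space_meas ε v
  have hi : Integrable (fun θ : Space d => transL ℝ (volume : Measure (Space d)) (ε • θ) v)
      (volume.restrict (unitCell d)) :=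
    Integrable.of_bound hm.aestronglyMeasurable ‖v‖ (ae_of_all _ fun θ => by
      rw [LinearIsometry.norm_map])
  -- Averaging over a cell is averaging the translates of `v` by `εθ`; since `‖θ‖ ≤ √d` on the unit
  -- cell, each translate is close to `v`.
  have e : cellProduct hε v (torusOne d) = ∫ θ in unitCell d, transL ℝ (volume : Measure (Space d)) (ε • θ) v := by
    refine Lp.ext ?_
    have h1 := (integral_Lp_ae (G := fun p : Space d × Space d => v (p.2 - ε • p.1))
      ((Lp.stronglyMeasurable v).measurable.comp (by fun_prop)) (fun θ => transL_ae _ _) hi).2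
    filter_upwards [h1, cellProduct_ae hε v (torusOne d), (quasi_torusProj_smul hε.ne').ae torusOne_ae]
      with x a1 a2 a3
    rw [a1, a2, a3, mul_one, cellAverage]
  have e2 : cellProduct hε v (torusOne d) - v =
      ∫ θ in unitCell d, (transL ℝ (volume : Measure (Space d)) (ε • θ) v - v) := by
    rw [integral_sub hi (integrable_const _), ← e, integral_const]
    simp
  rw [e2]
  refine (norm_integral_le_of_norm_le_const ((ae_restrict_iff' measurableSet_unitCell).2
    (ae_of_all _ hbd))).trans ?_
  simp

end CellProduct

end NonlocalHomogenization

/-! ### Bochner integrals, product rule, and expansion of the operator on products -/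

namespace NonlocalHomogenization

/-- `f` is integrable with integral `x`. -/
def HasBochnerIntegral {X E : Type*} [MeasurableSpace X] [NormedAddCommGroup E] [NormedSpace ℝ E]
    (ν : Measure X) (f : X → E) (x : E) : Prop := Integrable f ν ∧ ∫ y, f y ∂ν = x

namespace HasBochnerIntegral

variable {X E F : Type*} [MeasurableSpace X] [NormedAddCommGroup E] [NormedSpace ℝ E] [CompleteSpace E]
  [NormedAddCommGroup F] [NormedSpace ℝ F] [CompleteSpace F] {ν : Measure X} {f g : X → E} {x y : E}

theorem sub (hf : HasBochnerIntegral ν f x) (hg : HasBochnerIntegral ν g y) :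
    HasBochnerIntegral ν (fun z => f z - g z) (x - y) :=
  ⟨hf.1.sub hg.1, by rw [integral_sub hf.1 hg.1, hf.2, hg.2]⟩

theorem smul (c : ℝ) (hf : HasBochnerIntegral ν f x) : HasBochnerIntegral ν (fun z => c • f z) (c • x) :=
  ⟨hf.1.smul c, by rw [integral_smul, hf.2]⟩

theorem sum {ι : Type*} [Fintype ι] {f : ι → X → E} {x : ι → E} (hf : ∀ i, HasBochnerIntegral ν (f i) (x i)) :
    HasBochnerIntegral ν (fun z => ∑ i, f i z) (∑ i, x i) :=
  ⟨integrable_finsetSum _ fun i _ => (hf i).1, by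
    rw [integral_finsetSum _ fun i _ => (hf i).1]; exact Finset.sum_congr rfl fun i _ => (hf i).2⟩

theorem map (L : E →L[ℝ] F) (hf : HasBochnerIntegral ν f x) : HasBochnerIntegral ν (fun z => L (f z)) (L x) :=
  ⟨L.integrable_comp hf.1, by rw [L.integral_comp_comm hf.1, hf.2]⟩

end HasBochnerIntegral

theorem intervalIntegrable_bilin {E F G : Type*} [NormedAddCommGroup E] [NormedSpace ℝ E]
    [NormedAddCommGroup F] [NormedSpace ℝ F] [NormedAddCommGroup G] [NormedSpace ℝ G]
    (B : E →L[ℝ] F →L[ℝ] G) {f : ℝ → E} {y : ℝ → F} {a b : ℝ} (hf : IntervalIntegrable f volume a b)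
    (hy : ContinuousOn y (uIcc a b)) : IntervalIntegrable (fun s => B (f s) (y s)) volume a b := by
  obtain ⟨C, hC⟩ := isCompact_uIcc.exists_bound_of_continuousOn hy
  rw [intervalIntegrable_iff] at hf ⊢
  have hym : AEStronglyMeasurable y (volume.restrict (uIoc a b)) :=
    (hy.mono uIoc_subset_uIcc).aestronglyMeasurable measurableSet_uIoc
  refine Integrable.mono' (hf.norm.const_mul (‖B‖ * C)) (B.aestronglyMeasurable_comp₂ hf.aestronglyMeasurable hym)
    ((ae_restrict_iff' measurableSet_uIoc).2 (ae_of_all _ fun s hs => ?_))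
  refine (B.le_opNorm₂ _ _).trans ?_
  have := hC s (uIoc_subset_uIcc hs)
  calc ‖B‖ * ‖f s‖ * ‖y s‖ ≤ ‖B‖ * ‖f s‖ * C := by gcongr
    _ = _ := by ring

/-- Product rule for a bounded bilinear map applied to primitives. -/
theorem hasPrimitive_bilin {E F G : Type*} [NormedAddCommGroup E] [NormedSpace ℝ E] [CompleteSpace E]
    [NormedAddCommGroup F] [NormedSpace ℝ F] [CompleteSpace F] [NormedAddCommGroup G] [NormedSpace ℝ G]
    [CompleteSpace G] (B : E →L[ℝ] F →L[ℝ] G) {x f : ℝ → E} {y g : ℝ → F} {T : ℝ} (hT : 0 ≤ T)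
    (hf : IntervalIntegrable f volume 0 T) (hg : IntervalIntegrable g volume 0 T)
    (hx : ∀ t ∈ Icc 0 T, x t = x 0 + ∫ s in (0 : ℝ)..t, f s)
    (hy : ∀ t ∈ Icc 0 T, y t = y 0 + ∫ s in (0 : ℝ)..t, g s) :
    IntervalIntegrable (fun s => B (f s) (y s) + B (x s) (g s)) volume 0 T ∧
      ∀ t ∈ Icc 0 T, B (x t) (y t) = B (x 0) (y 0) +
        ∫ s in (0 : ℝ)..t, (B (f s) (y s) + B (x s) (g s)) := by
  have hxc := continuousOn_of_primitive hT hf hx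
  have hyc := continuousOn_of_primitive hT hg hy
  refine ⟨(intervalIntegrable_bilin B hf (by rwa [uIcc_of_le hT])).add
    (intervalIntegrable_bilin B.flip hg (by rwa [uIcc_of_le hT])), fun t ht => ?_⟩
  have hsub : uIcc 0 t ⊆ uIcc 0 T := by
    rw [uIcc_of_le ht.1, uIcc_of_le hT]; exact Icc_subset_Icc_right ht.2
  have h := bilin_primitive B ht.1 (hf.mono_set hsub) (hg.mono_set hsub) (x 0) (y 0)
  rw [← hx t ht, ← hy t ht] at h
  rw [h]
  congr 1
  refine intervalIntegral.integral_congr fun s hs => ?_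
  rw [uIcc_of_le ht.1] at hs
  rw [← hx s ⟨hs.1, hs.2.trans ht.2⟩, ← hy s ⟨hs.1, hs.2.trans ht.2⟩]

section Expansion

variable {d : ℕ} {a : Space d → ℝ} {μ : Space d → Space d → ℝ → ℝ}

/-- The chain rule for the fast time `t/ε²`: a velocity of size one becomes a velocity of size
`ε⁻²`. -/
theorem IsCellFlow.scaled {h : Conditions a μ} {F c : ℝ → L2Torus d} (hc : IsCellFlow h F c) {ε : ℝ}
    (hε : 0 < ε) (T : ℝ) :
    IntervalIntegrable (fun s => (ε ^ 2)⁻¹ • (cellGen h (s / ε ^ 2) (c (s / ε ^ 2)) + F (s / ε ^ 2)))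
      volume 0 T ∧
    ∀ t, c (t / ε ^ 2) = c (0 / ε ^ 2) +
      ∫ s in (0 : ℝ)..t, (ε ^ 2)⁻¹ • (cellGen h (s / ε ^ 2) (c (s / ε ^ 2)) + F (s / ε ^ 2)) := by
  have hε2 : ε ^ 2 ≠ 0 := by positivity
  constructor
  · have := (hc.integrable (0 / ε ^ 2) (T / ε ^ 2)).comp_mul_left (c := (ε ^ 2)⁻¹)
    simp only [div_eq_inv_mul] at this ⊢
    simp only [inv_mul_cancel_left₀ (inv_ne_zero hε2)] at this
    exact this.smul ((ε ^ 2)⁻¹)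
  · intro t
    rw [intervalIntegral.integral_smul,
      intervalIntegral.integral_comp_div (fun s => cellGen h s (c s) + F s) hε2, smul_smul,
      inv_mul_cancel₀ hε2, one_smul, zero_div]
    exact hc.eq _

theorem hasBochnerIntegral_cellProduct_K (h : Conditions a μ) {ε : ℝ} (hε : 0 < ε) {α : Space d → ℝ}
    (hα : Integrable α) (s : ℝ) (f : L2Space d) (χ : L2Torus d) :
    HasBochnerIntegral volume (fun z => α z • cellProduct hε f ((cellKernel h).S volume s z χ))
      (cellProduct hε f ((cellKernel h).K hα s χ)) := by
  have := HasBochnerIntegral.map (cellProduct hε f)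
    ⟨(cellKernel h).S_integrable (ν := volume) hα s χ, ((cellKernel h).K_apply hα s χ).symm⟩
  simpa only [map_smul] using this

theorem hasBochnerIntegral_cellProduct_N (h : Conditions a μ) {ε : ℝ} (hε : 0 < ε) {α : Space d → ℝ}
    (hα : Integrable α) (s : ℝ) (f : L2Space d) (χ : L2Torus d) :
    HasBochnerIntegral volume (fun z => α z • cellProduct hε f ((cellKernel h).M volume s z χ))
      (cellProduct hε f ((cellKernel h).N hα s χ)) := by
  have := HasBochnerIntegral.map (cellProduct hε f)
    ⟨(cellKernel h).M_integrable (ν := volume) hα s χ, ((cellKernel h).N_apply hα s χ).symm⟩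
  simpa only [map_smul] using this

/-- Expansion of the rescaled operator on a cell product, in terms of the Taylor expansion of the slow
factor. -/
theorem norm_scaledGen_cellProduct_sub_le (h : Conditions a μ) {ε : ℝ} (hε : 0 < ε) (t : ℝ)
    (f : L2Space d) (f1 : Fin d → L2Space d) (f2 : Fin d → Fin d → L2Space d) (χ : L2Torus d)
    {b : Space d → ℝ} (hb : Integrable fun z => a z * b z)
    (hr : ∀ z : Space d, ‖transL ℝ volume (ε • z) f - f + ∑ i, (ε * z i) • f1 i -
      ∑ i, ∑ j, (1 / 2 * (ε * z i) * (ε * z j)) • f2 i j‖ ≤ b z) :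
    ‖scaledGen h hε t (cellProduct hε f χ) - (ε ^ 2)⁻¹ • (cellProduct hε f (cellGen h (t / ε ^ 2) χ) +
      ε • ∑ i, cellProduct hε (f1 i) (cellFirst h i (t / ε ^ 2) χ) +
      ε ^ 2 • ∑ i, ∑ j, cellProduct hε (f2 i j) (cellSecond h i j (t / ε ^ 2) χ))‖ ≤
    (ε ^ 2)⁻¹ * ((cellKernel h).hi * ‖χ‖ * ∫ z, a z * b z) := by
  set s := t / ε ^ 2
  have e1 : HasBochnerIntegral volume (fun z => a z • cellProduct hε (transL ℝ volume (ε • z) f)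
      ((cellKernel h).S volume s z χ)) ((scaledKernel h hε).K h.kernel_integrable t (cellProduct hε f χ)) := by
    have : HasBochnerIntegral volume _ _ := ⟨(scaledKernel h hε).S_integrable (ν := volume) h.kernel_integrable t
      (cellProduct hε f χ), ((scaledKernel h hε).K_apply h.kernel_integrable t _).symm⟩
    simpa only [scaledKernel_S_cellProduct] using this
  have e2 : HasBochnerIntegral volume (fun z => a z • cellProduct hε f
      ((cellKernel h).M volume s z χ)) ((scaledKernel h hε).N h.kernel_integrable t (cellProduct hε f χ)) := by
    have : HasBochnerIntegral volume _ _ := ⟨(scaledKernel h hε).M_integrable (ν := volume) h.kernel_integrable t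
      (cellProduct hε f χ), ((scaledKernel h hε).N_apply h.kernel_integrable t _).symm⟩
    simpa only [scaledKernel_M_cellProduct] using this
  have e3 := hasBochnerIntegral_cellProduct_K h hε h.kernel_integrable s f χ
  have e4 := hasBochnerIntegral_cellProduct_N h hε h.kernel_integrable s f χ
  have e5 := HasBochnerIntegral.smul ε (HasBochnerIntegral.sum fun i =>
    hasBochnerIntegral_cellProduct_K h hε (h.integrable_first i) s (f1 i) χ)
  have e6 := HasBochnerIntegral.smul (ε ^ 2) (HasBochnerIntegral.sum fun i => HasBochnerIntegral.sum fun j =>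
    hasBochnerIntegral_cellProduct_K h hε (h.integrable_second i j) s (f2 i j) χ)
  -- The whole difference is a single integral over jumps. The loss terms cancel exactly since they
  -- involve no displacement, and what is left is `a(z)` times the product of the Taylor remainder
  -- of the slow factor with the jumped fast factor.
  have e := (((e1.sub e2).sub (e3.sub e4)).sub e5).sub e6
  have hG : cellProduct hε f (cellGen h s χ) = cellProduct hε f ((cellKernel h).K h.kernel_integrable s χ) -
      cellProduct hε f ((cellKernel h).N h.kernel_integrable s χ) := by
    rw [← map_sub]; rfl
  have hA : scaledGen h hε t (cellProduct hε f χ) = (ε ^ 2)⁻¹ •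
    ((scaledKernel h hε).K h.kernel_integrable t (cellProduct hε f χ) -
      (scaledKernel h hε).N h.kernel_integrable t (cellProduct hε f χ)) := rfl
  rw [hA, hG, ← smul_sub, norm_smul, Real.norm_of_nonneg (by positivity)]
  refine mul_le_mul_of_nonneg_left ?_ (by positivity)
  have e' := e.2
  simp only [cellFirst, cellSecond]
  rw [← sub_sub, ← sub_sub, ← e', ← integral_const_mul]
  refine norm_integral_le_of_norm_le (hb.const_mul _) (ae_of_all _ fun z => ?_)
  set Sχ := (cellKernel h).S volume s z χ with hS
  have hz : a z • cellProduct hε (transL ℝ volume (ε • z) f) Sχ - a z • cellProduct hε f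
      ((cellKernel h).M volume s z χ) - (a z • cellProduct hε f Sχ - a z • cellProduct hε f
      ((cellKernel h).M volume s z χ)) - ε • ∑ i, firstWeight a i z • cellProduct hε (f1 i) Sχ -
      ε ^ 2 • ∑ i, ∑ j, secondWeight a i j z • cellProduct hε (f2 i j) Sχ =
      a z • cellProduct hε (transL ℝ volume (ε • z) f - f + ∑ i, (ε * z i) • f1 i -
      ∑ i, ∑ j, (1 / 2 * (ε * z i) * (ε * z j)) • f2 i j) Sχ := by
    simp only [map_sub, map_add, map_sum, map_smul, sub_apply, add_apply, FunLike.coe_sum, Finset.sum_apply,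
      smul_apply, smul_sub, smul_add, Finset.smul_sum, smul_smul, firstWeight, secondWeight]
    have q1 : ∀ i, ε * (-z i * a z) = -(a z * (ε * z i)) := fun i => by ring
    have q2 : ∀ i j, ε ^ 2 * (1 / 2 * z i * z j * a z) = a z * (1 / 2 * (ε * z i) * (ε * z j)) :=
      fun i j => by ring
    simp only [q1, q2, neg_smul, Finset.sum_neg_distrib]
    abel
  rw [hz, norm_smul, Real.norm_of_nonneg (h.kernel_nonneg z)]
  have h1 := cellProduct_norm_le hε (transL ℝ volume (ε • z) f - f + ∑ i, (ε * z i) • f1 i -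
      ∑ i, ∑ j, (1 / 2 * (ε * z i) * (ε * z j)) • f2 i j) Sχ
  have h2 := (cellKernel h).S_norm_le (ν := volume) s z χ
  have h3 := mul_le_mul (hr z) h2 (norm_nonneg _) ((norm_nonneg _).trans (hr z))
  have h4 := mul_le_mul_of_nonneg_left (h1.trans h3) (h.kernel_nonneg z)
  calc _ ≤ _ := h4
    _ = _ := by ring

end Expansion

end NonlocalHomogenization

/-! ### The two-scale ansatz and its residual -/

namespace NonlocalHomogenization

/-- `x` is on `[0, T]` a primitive of the integrable function `f`. -/
def HasPrimitive {E : Type*} [NormedAddCommGroup E] [NormedSpace ℝ E] (T : ℝ) (x f : ℝ → E) : Prop :=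
  IntervalIntegrable f volume 0 T ∧ ∀ t ∈ Icc 0 T, x t = x 0 + ∫ s in (0 : ℝ)..t, f s

namespace HasPrimitive

variable {E F : Type*} [NormedAddCommGroup E] [NormedSpace ℝ E] {T : ℝ} {x y f g : ℝ → E}

theorem integrable_of_mem (hf : HasPrimitive T x f) {t : ℝ} (ht : t ∈ Icc 0 T) :
    IntervalIntegrable f volume 0 t := hf.1.mono_set (by
  rw [uIcc_of_le ht.1, uIcc_of_le (ht.1.trans ht.2)]; exact Icc_subset_Icc_right ht.2)

theorem add (hf : HasPrimitive T x f) (hg : HasPrimitive T y g) :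
    HasPrimitive T (fun t => x t + y t) (fun t => f t + g t) := by
  refine ⟨hf.1.add hg.1, fun t ht => ?_⟩
  beta_reduce
  rw [intervalIntegral.integral_add (hf.integrable_of_mem ht) (hg.integrable_of_mem ht), hf.2 t ht, hg.2 t ht]
  abel

theorem smul (c : ℝ) (hf : HasPrimitive T x f) : HasPrimitive T (fun t => c • x t) (fun t => c • f t) := by
  refine ⟨hf.1.smul c, fun t ht => ?_⟩
  beta_reduce
  rw [intervalIntegral.integral_smul, hf.2 t ht, smul_add]

theorem sum {ι : Type*} [Fintype ι] {x f : ι → ℝ → E} (hf : ∀ i, HasPrimitive T (x i) (f i)) :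
    HasPrimitive T (fun t => ∑ i, x i t) (fun t => ∑ i, f i t) := by
  refine ⟨?_, fun t ht => ?_⟩
  · have := IntervalIntegrable.sum Finset.univ (f := f) (a := 0) (b := T) (μ := volume) fun i _ => (hf i).1
    convert! this using 1
    ext1 s; simp
  · rw [intervalIntegral.integral_finsetSum fun i _ => (hf i).integrable_of_mem ht, ← Finset.sum_add_distrib]
    exact Finset.sum_congr rfl fun i _ => (hf i).2 t ht

end HasPrimitive

section Ansatz

variable {d : ℕ} {a : Space d → ℝ} {μ : Space d → Space d → ℝ → ℝ}

/-- `v` is a solution of `∂_t v = ∑ θ_ij ∂_i ∂_j v` on `[0, T]` with gradient `v1` and Hessian `v2`,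
and with Taylor remainders controlled by the constant `C`. -/
structure SmoothFlow (θ : Matrix (Fin d) (Fin d) ℝ) (T C : ℝ) (v : ℝ → L2Space d)
    (v1 : Fin d → ℝ → L2Space d) (v2 : Fin d → Fin d → ℝ → L2Space d) : Prop where
  nonneg : 0 ≤ C
  flow : HasPrimitive T v fun s => ∑ i, ∑ j, θ i j • v2 i j s
  grad : ∀ j, ∃ g, HasPrimitive T (v1 j) g ∧ ∀ t ∈ Icc 0 T, ‖g t‖ ≤ C
  hess : ∀ i j, ∃ g, HasPrimitive T (v2 i j) g ∧ ∀ t ∈ Icc 0 T, ‖g t‖ ≤ C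
  norm_grad : ∀ j, ∀ t ∈ Icc 0 T, ‖v1 j t‖ ≤ C
  norm_hess : ∀ i j, ∀ t ∈ Icc 0 T, ‖v2 i j t‖ ≤ C
  lipschitz : ∀ t ∈ Icc 0 T, ∀ h, ‖transL ℝ volume h (v t) - v t‖ ≤ C * ‖h‖
  taylor_two : ∀ t ∈ Icc 0 T, ∀ h : Space d, ‖transL ℝ volume h (v t) - v t + ∑ i, h i • v1 i t -
    ∑ i, ∑ j, (1 / 2 * h i * h j) • v2 i j t‖ ≤ C * (‖h‖ ^ 2 * min 1 ‖h‖)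
  taylor_one : ∀ j, ∀ t ∈ Icc 0 T, ∀ h : Space d,
    ‖transL ℝ volume h (v1 j t) - v1 j t + ∑ i, h i • v2 i j t‖ ≤ C * (‖h‖ * min 1 ‖h‖)
  taylor_zero : ∀ i j, ∀ t ∈ Icc 0 T, ∀ h : Space d,
    ‖transL ℝ volume h (v2 i j t) - v2 i j t‖ ≤ C * min 1 ‖h‖

/-- The truncated moments of the kernel that control the Taylor remainders. -/
def cutMoment (a : Space d → ℝ) (k : ℕ) (ε : ℝ) : ℝ := ∫ z, a z * (‖z‖ ^ k * min 1 ‖ε • z‖)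

theorem cutMoment_integrable {k : ℕ} (hk : Integrable fun z => ‖z‖ ^ k * a z) (ε : ℝ) :
    Integrable fun z => a z * (‖z‖ ^ k * min 1 ‖ε • z‖) := by
  have : (fun z => a z * (‖z‖ ^ k * min 1 ‖ε • z‖)) = fun z => min 1 ‖ε • z‖ * (‖z‖ ^ k * a z) := by
    ext z; ring
  rw [this]
  refine hk.norm.mono' ((by fun_prop : Continuous fun z : Space d => min 1 ‖ε • z‖).aestronglyMeasurable.mul
    hk.aestronglyMeasurable) (ae_of_all _ fun z => ?_)
  rw [norm_mul, Real.norm_of_nonneg (by positivity)]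
  exact mul_le_of_le_one_left (norm_nonneg _) (min_le_left _ _)

/-- Dominated convergence with the moment itself as majorant. The truncation replaces one further
moment, which need not exist. -/
theorem cutMoment_tendsto {k : ℕ} (hk : Integrable fun z => ‖z‖ ^ k * a z) :
    Tendsto (cutMoment a k) (𝓝[>] 0) (𝓝 0) := by
  have h0 : (0 : ℝ) = ∫ _z : Space d, (0 : ℝ) := by simp
  rw [h0]
  refine (tendsto_integral_filter_of_dominated_convergence (fun z => ‖‖z‖ ^ k * a z‖) (Eventually.of_forall
    fun ε => (cutMoment_integrable hk ε).aestronglyMeasurable) (Eventually.of_forall fun ε =>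
      ae_of_all _ fun z => ?_) hk.norm (ae_of_all _ fun z => ?_)).mono_left nhdsWithin_le_nhds
  · have : a z * (‖z‖ ^ k * min 1 ‖ε • z‖) = min 1 ‖ε • z‖ * (‖z‖ ^ k * a z) := by ring
    rw [this, norm_mul, Real.norm_of_nonneg (by positivity : 0 ≤ min 1 ‖ε • z‖)]
    exact mul_le_of_le_one_left (norm_nonneg _) (min_le_left _ _)
  · have hc : Continuous fun ε : ℝ => a z * (‖z‖ ^ k * min 1 ‖ε • z‖) := by fun_prop
    have := hc.tendsto 0
    simpa using this

theorem Conditions.integrable_moment (h : Conditions a μ) :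
    (Integrable fun z => ‖z‖ ^ 0 * a z) ∧ (Integrable fun z => ‖z‖ ^ 1 * a z) ∧
      Integrable fun z => ‖z‖ ^ 2 * a z := by
  refine ⟨?_, ?_, h.kernel_second_moment⟩
  · simpa using h.kernel_integrable
  · simpa using h.integrable_norm

/-- The left side is the residual of the ansatz: its time derivative by the product rule, with both
cell equations inserted, minus the operator applied to it. The drift terms `Y`, the second-order
terms `Z` and `W` and the diffusion term with `U` cancel across the three levels. On the right
remain the derivatives of the slow factors and one expansion error per level. -/
theorem ansatz_algebra {E : Type*} [AddCommGroup E] [Module ℝ E] {ε : ℝ} (hε : ε ≠ 0)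
    (U Z W V g2 A2 : Fin d → Fin d → E) (X Y g1 A1 : Fin d → E) (A0 : E) (θ : Fin d → Fin d → ℝ) :
    (∑ i, ∑ j, θ i j • U i j) + ε • ∑ j, (g1 j + (ε ^ 2)⁻¹ • (X j + Y j)) +
      ε ^ 2 • ∑ i, ∑ j, (g2 i j + (ε ^ 2)⁻¹ • (V i j + (Z i j + W i j - θ i j • U i j))) -
      (A0 + ε • ∑ j, A1 j + ε ^ 2 • ∑ i, ∑ j, A2 i j) =
    ε • ∑ j, g1 j + ε ^ 2 • ∑ i, ∑ j, g2 i j -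
      (A0 - (ε ^ 2)⁻¹ • (ε • ∑ j, Y j + ε ^ 2 • ∑ i, ∑ j, Z i j)) -
      ε • ∑ j, (A1 j - (ε ^ 2)⁻¹ • (X j + ε • ∑ i, W i j)) -
      ε ^ 2 • ∑ i, ∑ j, (A2 i j - (ε ^ 2)⁻¹ • V i j) := by
  have hW : ∑ j, ∑ i, W i j = ∑ i, ∑ j, W i j := Finset.sum_comm
  simp only [Finset.sum_add_distrib, Finset.sum_sub_distrib, smul_add, smul_sub, ← Finset.smul_sum, hW]
  match_scalars <;> field_simp <;> ring

theorem exists_ansatz_rate (h : Conditions a μ) (hm : Measurable a) {χ : Fin d → ℝ → L2Torus d}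
    (hχ : IsCorrector a μ χ) {T : ℝ} (hT : 0 < T) {C : ℝ} {v : ℝ → L2Space d}
    {v1 : Fin d → ℝ → L2Space d} {v2 : Fin d → Fin d → ℝ → L2Space d}
    (hv : SmoothFlow (preEffMatrix a μ χ) T C v v1 v2) :
    ∃ ρ : ℝ → ℝ, Tendsto ρ (𝓝[>] 0) (𝓝 0) ∧ ∀ ε, 0 < ε → ∀ u₀ u, IsScaledSolution a μ ε T u₀ u →
      ∀ᵐ t ∂volume.restrict (Ioo 0 T), ‖u t - v t‖ ≤ ‖u₀ - v 0‖ + ρ ε := by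
  have hc := fun j => (hχ.isCellFlow h hm j).2
  choose κ hκ using exists_second_corrector h hm hχ
  choose R1 hR1 using fun j => (hc j).bdd
  choose R2 hR2 using fun i j => (hκ i j).bdd
  choose g1 hg1 hg1C using hv.grad
  choose g2 hg2 hg2C using hv.hess
  have hC := hv.nonneg
  have hR1' : ∀ j, 0 ≤ R1 j := fun j => (norm_nonneg _).trans (hR1 j 0)
  have hR2' : ∀ i j, 0 ≤ R2 i j := fun i j => (norm_nonneg _).trans (hR2 i j 0)
  set c : Fin d → ℝ → L2Torus d := fun j s => -χ j s with hcdef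
  set θ := preEffMatrix a μ χ with hθ
  set S1 := ∑ j, R1 j with hS1
  set S2 := ∑ i, ∑ j, R2 i j with hS2
  have hS1' : 0 ≤ S1 := Finset.sum_nonneg fun j _ => hR1' j
  have hS2' : 0 ≤ S2 := Finset.sum_nonneg fun i _ => Finset.sum_nonneg fun j _ => hR2' i j
  set hi := (cellKernel h).hi with hhi
  have hhi0 : 0 < hi := (cellKernel h).hi_pos
  obtain ⟨m0, m1, m2⟩ := h.integrable_moment
  set I := cutMoment a with hI
  have hI0 : ∀ k ε, 0 ≤ I k ε := fun k ε => integral_nonneg fun z =>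
    mul_nonneg (h.kernel_nonneg z) (by positivity)
  -- the size of the residual and the distance between the ansatz and `v`
  set ρ1 : ℝ → ℝ := fun ε => ε * (C * S1) + ε ^ 2 * (C * S2) + hi * C * I 2 ε + S1 * (hi * C * I 1 ε) +
    S2 * (hi * C * I 0 ε) with hρ1
  set ρ2 : ℝ → ℝ := fun ε => C * (ε * Real.sqrt d) + ε * (C * S1) + ε ^ 2 * (C * S2) with hρ2
  -- The first term comes from the stability estimate. The distance from the ansatz to `v` enters
  -- twice, at time `t` and at time zero.
  refine ⟨fun ε => 2 * ρ1 ε * T + 2 * ρ2 ε, ?_, fun ε hε u₀ u hu => ?_⟩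
  · have t0 := cutMoment_tendsto m0
    have t1 := cutMoment_tendsto m1
    have t2 := cutMoment_tendsto m2
    have te : Tendsto (fun ε : ℝ => ε) (𝓝[>] 0) (𝓝 0) := nhdsWithin_le_nhds
    have hρ1t : Tendsto ρ1 (𝓝[>] 0) (𝓝 0) := by
      have := ((((te.mul_const (C * S1)).add ((te.pow 2).mul_const (C * S2))).add (t2.const_mul (hi * C))).add
        ((t1.const_mul (hi * C)).const_mul S1)).add ((t0.const_mul (hi * C)).const_mul S2)
      simpa using this
    have hρ2t : Tendsto ρ2 (𝓝[>] 0) (𝓝 0) := by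
      have := (((te.mul_const (Real.sqrt d)).const_mul C).add (te.mul_const (C * S1))).add
        ((te.pow 2).mul_const (C * S2))
      simpa using this
    have := ((hρ1t.const_mul 2).mul_const T).add (hρ2t.const_mul 2)
    simpa using this
  set P := cellProduct (d := d) hε with hP
  set cε : Fin d → ℝ → L2Torus d := fun j t => c j (t / ε ^ 2) with hcε
  set κε : Fin d → Fin d → ℝ → L2Torus d := fun i j t => κ i j (t / ε ^ 2) with hκε
  set w : ℝ → L2Space d := fun t => P (v t) (torusOne d) + ε • ∑ j, P (v1 j t) (cε j t) +
    ε ^ 2 • ∑ i, ∑ j, P (v2 i j t) (κε i j t) with hw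
  have hε2 : 0 < ε ^ 2 := by positivity
  have hρ10 : 0 ≤ ρ1 ε := by have := hI0 0 ε; have := hI0 1 ε; have := hI0 2 ε; positivity
  -- distance of the ansatz from `v`
  have hn1 : ∀ {x : Fin d → L2Space d}, (∀ j, ‖x j‖ ≤ C) → ∀ t, ‖∑ j, P (x j) (cε j t)‖ ≤ C * S1 :=
    fun hx t => by
      refine (norm_sum_le _ _).trans ?_
      rw [hS1, Finset.mul_sum]
      exact Finset.sum_le_sum fun j _ => (cellProduct_norm_le hε _ _).trans
        (mul_le_mul (hx j) (hR1 j _) (norm_nonneg _) hC)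
  have hn2 : ∀ {x : Fin d → Fin d → L2Space d}, (∀ i j, ‖x i j‖ ≤ C) →
      ∀ t, ‖∑ i, ∑ j, P (x i j) (κε i j t)‖ ≤ C * S2 := fun hx t => by
    refine (norm_sum_le _ _).trans ?_
    rw [hS2, Finset.mul_sum]
    refine Finset.sum_le_sum fun i _ => (norm_sum_le _ _).trans ?_
    rw [Finset.mul_sum]
    exact Finset.sum_le_sum fun j _ => (cellProduct_norm_le hε _ _).trans
      (mul_le_mul (hx i j) (hR2 i j _) (norm_nonneg _) hC)
  have hwv : ∀ t ∈ Icc 0 T, ‖w t - v t‖ ≤ ρ2 ε := fun t ht => by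
    have e : w t - v t = (P (v t) (torusOne d) - v t) + ε • ∑ j, P (v1 j t) (cε j t) +
      ε ^ 2 • ∑ i, ∑ j, P (v2 i j t) (κε i j t) := by simp only [hw]; abel
    rw [e]
    refine (norm_add₃_le).trans (add_le_add (add_le_add
      (norm_cellProduct_one_sub_le hε (v t) hC (hv.lipschitz t ht)) ?_) ?_)
    · rw [norm_smul, Real.norm_of_nonneg hε.le]
      exact mul_le_mul_of_nonneg_left (hn1 (fun j => hv.norm_grad j t ht) t) hε.le
    · rw [norm_smul, Real.norm_of_nonneg hε2.le]
      exact mul_le_mul_of_nonneg_left (hn2 (fun i j => hv.norm_hess i j t ht) t) hε2.le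
  -- the time derivative of the ansatz
  have hc' : ∀ j, HasPrimitive T (cε j) fun s => (ε ^ 2)⁻¹ •
      (cellGen h (s / ε ^ 2) (cε j s) + cellFirst h j (s / ε ^ 2) (torusOne d)) := fun j =>
    ⟨((hc j).scaled hε T).1, fun t _ => ((hc j).scaled hε T).2 t⟩
  have hκ' : ∀ i j, HasPrimitive T (κε i j) fun s => (ε ^ 2)⁻¹ • (cellGen h (s / ε ^ 2) (κε i j s) +
      (cellSecond h i j (s / ε ^ 2) (torusOne d) + cellFirst h i (s / ε ^ 2) (cε j s) -
        θ i j • torusOne d)) := fun i j =>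
    ⟨((hκ i j).scaled hε T).1, fun t _ => ((hκ i j).scaled hε T).2 t⟩
  have hone : HasPrimitive T (fun _ => torusOne d) (fun _ => (0 : L2Torus d)) :=
    ⟨intervalIntegrable_const, fun t _ => by simp⟩
  have b0 : HasPrimitive T _ _ := hasPrimitive_bilin P hT.le hv.flow.1 hone.1 hv.flow.2 hone.2
  have b1 : ∀ j, HasPrimitive T _ _ := fun j =>
    hasPrimitive_bilin P hT.le (hg1 j).1 (hc' j).1 (hg1 j).2 (hc' j).2
  have b2 : ∀ i j, HasPrimitive T _ _ := fun i j =>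
    hasPrimitive_bilin P hT.le (hg2 i j).1 (hκ' i j).1 (hg2 i j).2 (hκ' i j).2
  have hprim := (b0.add ((HasPrimitive.sum b1).smul ε)).add
    ((HasPrimitive.sum fun i => HasPrimitive.sum (b2 i)).smul (ε ^ 2))
  have main := hu.norm_sub_le h hm hε hT hρ10 (w := w) hprim.1 hprim.2 (ae_of_all _ fun s hs => ?_)
  · filter_upwards [main, ae_restrict_mem measurableSet_Ioo] with t ht htI
    have e1 := hwv t (Ioo_subset_Icc_self htI)
    have e2 := hwv 0 ⟨le_rfl, hT.le⟩
    have e3 : ‖u t - v t‖ ≤ ‖u t - w t‖ + ‖w t - v t‖ := norm_sub_le_norm_sub_add_norm_sub _ _ _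
    have e4 : ‖u₀ - w 0‖ ≤ ‖u₀ - v 0‖ + ‖v 0 - w 0‖ := norm_sub_le_norm_sub_add_norm_sub _ _ _
    rw [norm_sub_rev (v 0)] at e4
    linarith
  -- the residual
  have key : ∀ z : Space d, ‖ε • z‖ = ε * ‖z‖ := fun z => by rw [norm_smul, Real.norm_of_nonneg hε.le]
  -- The order of the Taylor expansion drops by one for each power of `ε` in the prefactor: two for
  -- `v`, one for its gradient, none for its Hessian. After multiplication by `1`, `ε`, `ε²` the
  -- errors are constants times the truncated moments of order 2, 1 and 0.
  have r0 := norm_scaledGen_cellProduct_sub_le h hε s (v s) (fun j => v1 j s) (fun i j => v2 i j s) (torusOne d)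
    (b := fun z => C * ε ^ 2 * (‖z‖ ^ 2 * min 1 ‖ε • z‖))
    (by simpa only [mul_left_comm] using (cutMoment_integrable m2 ε).const_mul (C * ε ^ 2)) (fun z => by
      have := hv.taylor_two s hs (ε • z)
      rw [key] at this
      refine this.trans (le_of_eq ?_)
      rw [key]; ring)
  have r1 := fun j => norm_scaledGen_cellProduct_sub_le h hε s (v1 j s) (fun i => v2 i j s) (fun _ _ => 0) (cε j s)
    (b := fun z => C * ε * (‖z‖ ^ 1 * min 1 ‖ε • z‖))
    (by simpa only [mul_left_comm] using (cutMoment_integrable m1 ε).const_mul (C * ε)) (fun z => by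
      have := hv.taylor_one j s hs (ε • z)
      rw [key] at this
      simp only [smul_zero, Finset.sum_const_zero, sub_zero]
      refine this.trans (le_of_eq ?_)
      rw [key]; ring)
  have r2 := fun i j => norm_scaledGen_cellProduct_sub_le h hε s (v2 i j s) (fun _ => 0) (fun _ _ => 0) (κε i j s)
    (b := fun z => C * (‖z‖ ^ 0 * min 1 ‖ε • z‖))
    (by simpa only [mul_left_comm] using (cutMoment_integrable m0 ε).const_mul C) (fun z => by
      have := hv.taylor_zero i j s hs (ε • z)
      simp only [smul_zero, Finset.sum_const_zero, sub_zero, add_zero, pow_zero, one_mul]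
      exact this)
  have hint : ∀ (k : ℕ) (x : ℝ), ∫ z, a z * (x * (‖z‖ ^ k * min 1 ‖ε • z‖)) = x * I k ε := fun k x => by
    rw [hI, cutMoment, ← integral_const_mul]
    simp only [mul_left_comm]
  rw [hint, norm_torusOne, cellGen_torusOne, map_zero, zero_add] at r0
  simp only [hint, smul_zero, Finset.sum_const_zero, add_zero, map_zero, zero_apply] at r1 r2
  have r0' := r0.trans (le_of_eq (show (ε ^ 2)⁻¹ * (hi * 1 * (C * ε ^ 2 * I 2 ε)) = hi * C * I 2 ε by
    field_simp))
  have r1' : ∀ j, _ ≤ ε⁻¹ * (R1 j * (hi * C * I 1 ε)) := fun j => (r1 j).trans (by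
    have : (ε ^ 2)⁻¹ * (hi * ‖cε j s‖ * (C * ε * I 1 ε)) = ε⁻¹ * (‖cε j s‖ * (hi * C * I 1 ε)) := by
      field_simp
    rw [this]
    have := hI0 1 ε
    exact mul_le_mul_of_nonneg_left (mul_le_mul_of_nonneg_right (hR1 j _) (by positivity)) (by positivity))
  have r2' : ∀ i j, _ ≤ (ε ^ 2)⁻¹ * (R2 i j * (hi * C * I 0 ε)) := fun i j => (r2 i j).trans (by
    have : hi * ‖κε i j s‖ * (C * I 0 ε) = ‖κε i j s‖ * (hi * C * I 0 ε) := by ring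
    rw [this]
    have := hI0 0 ε
    exact mul_le_mul_of_nonneg_left (mul_le_mul_of_nonneg_right (hR2 i j _) (by positivity)) (by positivity))
  have alg := ansatz_algebra hε.ne' (fun i j => P (v2 i j s) (torusOne d))
    (fun i j => P (v2 i j s) (cellSecond h i j (s / ε ^ 2) (torusOne d)))
    (fun i j => P (v2 i j s) (cellFirst h i (s / ε ^ 2) (cε j s)))
    (fun i j => P (v2 i j s) (cellGen h (s / ε ^ 2) (κε i j s)))
    (fun i j => P (g2 i j s) (κε i j s)) (fun i j => scaledGen h hε s (P (v2 i j s) (κε i j s)))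
    (fun j => P (v1 j s) (cellGen h (s / ε ^ 2) (cε j s)))
    (fun j => P (v1 j s) (cellFirst h j (s / ε ^ 2) (torusOne d)))
    (fun j => P (g1 j s) (cε j s)) (fun j => scaledGen h hε s (P (v1 j s) (cε j s)))
    (scaledGen h hε s (P (v s) (torusOne d))) θ
  have n1 := hn1 (fun j => hg1C j s hs) s
  have n2 := hn2 (fun i j => hg2C i j s hs) s
  have n3 : ‖∑ j, (scaledGen h hε s (P (v1 j s) (cε j s)) - (ε ^ 2)⁻¹ •
      (P (v1 j s) (cellGen h (s / ε ^ 2) (cε j s)) + ε • ∑ i, P (v2 i j s) (cellFirst h i (s / ε ^ 2) (cε j s))))‖ ≤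
      ε⁻¹ * (S1 * (hi * C * I 1 ε)) := by
    refine (norm_sum_le _ _).trans ?_
    rw [hS1, Finset.sum_mul, Finset.mul_sum]
    exact Finset.sum_le_sum fun j _ => r1' j
  have n4 : ‖∑ i, ∑ j, (scaledGen h hε s (P (v2 i j s) (κε i j s)) - (ε ^ 2)⁻¹ •
      P (v2 i j s) (cellGen h (s / ε ^ 2) (κε i j s)))‖ ≤ (ε ^ 2)⁻¹ * (S2 * (hi * C * I 0 ε)) := by
    refine (norm_sum_le _ _).trans ?_
    rw [hS2, Finset.sum_mul, Finset.mul_sum]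
    refine Finset.sum_le_sum fun i _ => (norm_sum_le _ _).trans ?_
    rw [Finset.sum_mul, Finset.mul_sum]
    exact Finset.sum_le_sum fun j _ => r2' i j
  refine (le_of_eq (congrArg norm (Eq.trans ?_ alg))).trans ?_
  · simp only [hw, map_add, map_sub, map_smul, map_sum, map_zero, add_zero, FunLike.coe_sum, Finset.sum_apply,
      smul_apply]
  refine (norm_sub_le _ _).trans ?_
  refine (add_le_add ((norm_sub_le _ _).trans (add_le_add ((norm_sub_le _ _).trans (add_le_add (norm_add_le _ _)
    r0')) le_rfl)) le_rfl).trans ?_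
  rw [norm_smul, norm_smul, norm_smul, norm_smul, Real.norm_of_nonneg hε.le, Real.norm_of_nonneg hε2.le]
  have q1 := mul_le_mul_of_nonneg_left n1 hε.le
  have q2 := mul_le_mul_of_nonneg_left n2 hε2.le
  have q3 := mul_le_mul_of_nonneg_left n3 hε.le
  have q4 := mul_le_mul_of_nonneg_left n4 hε2.le
  rw [← mul_assoc, mul_inv_cancel₀ hε.ne', one_mul] at q3
  rw [← mul_assoc, mul_inv_cancel₀ hε2.ne', one_mul] at q4
  simp only [hρ1]
  linarith

end Ansatz

end NonlocalHomogenization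

namespace NonlocalHomogenization

/-! ### Taylor bounds for the phase with a bounded last factor -/

section Symbols

/-- Taylor's bound for small `y`, the triangle inequality for large `y`. Here and in the two
analogues below, the remainder grows at infinity no faster than the degree of the polynomial
subtracted. -/
theorem norm_exp_sub_one_le_min (y : ℝ) : ‖Complex.exp ((-y : ℝ) * Complex.I) - 1‖ ≤ 2 * min 1 |y| := by
  have hn : ‖Complex.exp ((-y : ℝ) * Complex.I)‖ = 1 := Complex.norm_exp_ofReal_mul_I _
  rcases le_total |y| 1 with h | h
  · rw [min_eq_right h]
    have := Complex.norm_exp_sub_one_le (x := (-y : ℝ) * Complex.I) (by simpa using h)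
    simpa using this
  · rw [min_eq_left h]
    refine (norm_sub_le _ _).trans ?_
    rw [hn, norm_one]; norm_num

theorem norm_exp_sub_one_sub_id_le_min (y : ℝ) :
    ‖Complex.exp ((-y : ℝ) * Complex.I) - 1 - (-y : ℝ) * Complex.I‖ ≤ 3 * (|y| * min 1 |y|) := by
  have hn : ‖Complex.exp ((-y : ℝ) * Complex.I)‖ = 1 := Complex.norm_exp_ofReal_mul_I _
  have hx : ‖((-y : ℝ) : ℂ) * Complex.I‖ = |y| := by simp
  rcases le_total |y| 1 with h | h
  · rw [min_eq_right h]
    have := Complex.norm_exp_sub_one_sub_id_le (x := (-y : ℝ) * Complex.I) (by rw [hx]; exact h)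
    rw [hx] at this
    nlinarith [abs_nonneg y]
  · rw [min_eq_left h]
    refine (norm_sub_le _ _).trans ((add_le_add (norm_sub_le _ _) le_rfl).trans ?_)
    rw [hn, norm_one, hx]; linarith

theorem norm_exp_sub_quadratic_le_min (y : ℝ) :
    ‖Complex.exp ((-y : ℝ) * Complex.I) - 1 - (-y : ℝ) * Complex.I - ((-y : ℝ) * Complex.I) ^ 2 / 2‖ ≤
      4 * (|y| ^ 2 * min 1 |y|) := by
  have hn : ‖Complex.exp ((-y : ℝ) * Complex.I)‖ = 1 := Complex.norm_exp_ofReal_mul_I _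
  have hx : ‖((-y : ℝ) : ℂ) * Complex.I‖ = |y| := by simp
  rcases le_total |y| 1 with h | h
  · rw [min_eq_right h]
    have := Complex.exp_bound (x := (-y : ℝ) * Complex.I) (by rw [hx]; exact h) (n := 3) (by norm_num)
    rw [hx] at this
    simp only [Finset.sum_range_succ, Finset.sum_range_zero, pow_zero, pow_one, Nat.factorial] at this
    norm_num at this
    have h3 : 0 ≤ |y| ^ 3 := by positivity
    refine le_trans (le_of_eq ?_) (this.trans ?_)
    · congr 1
      push_cast
      ring_nf
    · have e : |y| ^ 2 * |y| = |y| ^ 3 := by ring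
      rw [e]; linarith
  · rw [min_eq_left h]
    refine (norm_sub_le _ _).trans ((add_le_add ((norm_sub_le _ _).trans
      (add_le_add (norm_sub_le _ _) le_rfl)) le_rfl).trans ?_)
    rw [hn, norm_one, hx, norm_div, norm_pow, hx, Complex.norm_ofNat]; nlinarith

end Symbols

/-! ### Fourier multipliers on L² -/

section Fourier

open FourierTransform

variable {d : ℕ}

/-- The complex Hilbert space `L²(ℝ^d; ℂ)`. -/
abbrev L2Complex (d : ℕ) : Type := Lp ℂ 2 (volume : Measure (Space d))

/-- The Fourier transform on `L²`. -/
def fourierL2 (d : ℕ) : L2Complex d ≃ₗᵢ[ℂ] L2Complex d := Lp.fourierTransformₗᵢ (Space d) ℂ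

/-- The Fourier symbol of the translation by `h`. -/
def transSymbol (h k : Space d) : ℂ := Complex.exp ((-(2 * Real.pi * inner ℝ h k) : ℝ) * Complex.I)

theorem transSymbol_bdd (h : Space d) : Measurable (transSymbol h) ∧ ∀ k, ‖transSymbol h k‖ ≤ 1 := by
  refine ⟨?_, fun k => (Complex.norm_exp_ofReal_mul_I _).le⟩
  unfold transSymbol
  fun_prop

theorem fourier_schwartz_translate (ψ : SchwartzMap (Space d) ℂ) (h k : Space d) :
    (𝓕 (ψ.compSubConstCLM ℂ h)) k = transSymbol h k * (𝓕 ψ) k := by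
  rw [SchwartzMap.fourier_coe, SchwartzMap.fourier_coe, Real.fourier_eq', Real.fourier_eq', ← integral_const_mul,
    ← integral_add_right_eq_self _ h]
  refine integral_congr_ae (ae_of_all _ fun x => ?_)
  simp only [SchwartzMap.compSubConstCLM_apply, transSymbol, smul_eq_mul, add_sub_cancel_right]
  rw [← mul_assoc, ← Complex.exp_add, inner_add_left]
  congr 2
  push_cast
  ring_nf

/-- Both sides are continuous in `f`, so the identity for Schwartz functions extends by density. -/
theorem fourierL2_transL (h : Space d) (f : L2Complex d) :
    fourierL2 d (transL ℂ volume h f) = mulL volume (transSymbol_bdd h) (fourierL2 d f) := by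
  refine (SchwartzMap.denseRange_toLpCLM (E := Space d) (F := ℂ) (p := 2) (μ := volume)
    ENNReal.ofNat_ne_top).induction_on (p := fun f : L2Complex d =>
      fourierL2 d (transL ℂ volume h f) = mulL volume (transSymbol_bdd h) (fourierL2 d f)) f ?_ fun ψ => ?_
  · exact isClosed_eq ((fourierL2 d).continuous.comp (transL ℂ volume h).continuous)
      ((mulL volume (transSymbol_bdd h)).continuous.comp (fourierL2 d).continuous)
  · rw [SchwartzMap.toLpCLM_apply]
    have e1 : transL ℂ volume h (ψ.toLp 2) = (ψ.compSubConstCLM ℂ h).toLp 2 := by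
      refine Lp.ext ?_
      have hq := (measurePreserving_sub_right (volume : Measure (Space d)) h).quasiMeasurePreserving
      filter_upwards [transL_ae h (ψ.toLp 2), hq.ae (SchwartzMap.coeFn_toLp ψ 2 volume),
        SchwartzMap.coeFn_toLp (ψ.compSubConstCLM ℂ h) 2] with x h1 h2 h3
      rw [h1, h2, h3]; rfl
    have e2 : ∀ φ : SchwartzMap (Space d) ℂ, fourierL2 d (φ.toLp 2) = (𝓕 φ).toLp 2 :=
      fun φ => SchwartzMap.toLp_fourier_eq φ
    rw [e1, e2, e2]
    refine Lp.ext ?_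
    filter_upwards [SchwartzMap.coeFn_toLp (𝓕 (ψ.compSubConstCLM ℂ h)) 2,
      mulL_ae (transSymbol_bdd h) ((𝓕 ψ).toLp 2 volume), SchwartzMap.coeFn_toLp (𝓕 ψ) 2] with x h1 h2 h3
    rw [h1, h2, h3, fourier_schwartz_translate]

/-- The real part of the inverse Fourier transform. -/
def synth (d : ℕ) : L2Complex d →L[ℝ] L2Space d :=
  (Complex.reCLM.compLpL 2 volume).comp
    ((fourierL2 d).symm.toContinuousLinearEquiv.toContinuousLinearMap.restrictScalars ℝ)

theorem synth_ae (G : L2Complex d) : synth d G =ᵐ[volume] fun x => ((fourierL2 d).symm G x).re :=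
  Complex.reCLM.coeFn_compLp _

theorem synth_norm_le (G : L2Complex d) : ‖synth d G‖ ≤ ‖G‖ := by
  rw [← (fourierL2 d).symm.norm_map G]
  refine Lp.norm_le_norm_of_ae_le ?_
  filter_upwards [synth_ae G] with x hx
  rw [hx]
  exact Complex.abs_re_le_norm _

/-- On the Fourier side translation is multiplication by a phase. This turns Taylor estimates for
translates into pointwise estimates for symbols. -/
theorem transL_synth (h : Space d) (G : L2Complex d) :
    transL ℝ volume h (synth d G) = synth d (mulL volume (transSymbol_bdd h) G) := by
  have e : (fourierL2 d).symm (mulL volume (transSymbol_bdd h) G) = transL ℂ volume h ((fourierL2 d).symm G) := by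
    rw [LinearIsometryEquiv.symm_apply_eq, fourierL2_transL, LinearIsometryEquiv.apply_symm_apply]
  refine Lp.ext ?_
  have hq := (measurePreserving_sub_right (volume : Measure (Space d)) h).quasiMeasurePreserving
  filter_upwards [transL_ae h (synth d G), hq.ae (synth_ae G),
    synth_ae (mulL volume (transSymbol_bdd h) G), transL_ae h ((fourierL2 d).symm G)] with x h1 h2 h3 h4
  rw [h1, h2, h3, e, h4]

/-- The Fourier transform of a real function. -/
def analysis (u : L2Space d) : L2Complex d := fourierL2 d (Complex.ofRealCLM.compLp u)

theorem synth_analysis (u : L2Space d) : synth d (analysis u) = u := by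
  refine Lp.ext ?_
  filter_upwards [synth_ae (analysis u), Complex.ofRealCLM.coeFn_compLp u] with x h1 h2
  rw [h1, analysis, LinearIsometryEquiv.symm_apply_apply, h2]
  exact Complex.ofReal_re _

/-- The indicator of the ball of frequencies. -/
def bandSymbol (R : ℝ) (k : Space d) : ℂ := (Metric.closedBall (0 : Space d) R).indicator 1 k

theorem bandSymbol_bdd (R : ℝ) : Measurable (bandSymbol (d := d) R) ∧ ∀ k, ‖bandSymbol (d := d) R k‖ ≤ 1 := by
  refine ⟨(measurable_const (a := (1 : ℂ))).indicator Metric.isClosed_closedBall.measurableSet, fun k => ?_⟩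
  unfold bandSymbol indicator
  split_ifs <;> simp

/-- The truncated symbol of `∂_j`. -/
def gradSymbol (R : ℝ) (j : Fin d) (k : Space d) : ℂ := bandSymbol R k * ((2 * Real.pi * k j : ℝ) * Complex.I)

theorem bandSymbol_eq_zero_or (R : ℝ) (k : Space d) : bandSymbol R k = 0 ∨ bandSymbol R k = 1 ∧ ‖k‖ ≤ R := by
  unfold bandSymbol indicator
  split_ifs with h
  · exact Or.inr ⟨rfl, by simpa using h⟩
  · exact Or.inl rfl

theorem gradSymbol_bdd {R : ℝ} (hR : 0 ≤ R) (j : Fin d) :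
    Measurable (gradSymbol (d := d) R j) ∧ ∀ k, ‖gradSymbol (d := d) R j k‖ ≤ 2 * Real.pi * R := by
  refine ⟨(bandSymbol_bdd R).1.mul (by fun_prop), fun k => ?_⟩
  rcases bandSymbol_eq_zero_or R k with h | ⟨h, hk⟩
  · rw [gradSymbol, h, zero_mul, norm_zero]; positivity
  · rw [gradSymbol, h, one_mul, norm_mul, Complex.norm_I, mul_one, Complex.norm_real, norm_mul,
      Real.norm_of_nonneg (by positivity)]
    exact mul_le_mul_of_nonneg_left ((abs_coord_le k j).trans hk) (by positivity)

theorem mulL_comm {m n : Space d → ℂ} {C D : ℝ} (hm : Measurable m ∧ ∀ x, ‖m x‖ ≤ C)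
    (hn : Measurable n ∧ ∀ x, ‖n x‖ ≤ D) (f : L2Complex d) :
    mulL volume hm (mulL volume hn f) = mulL volume hn (mulL volume hm f) := by
  refine Lp.ext ?_
  filter_upwards [mulL_ae hm (mulL volume hn f), mulL_ae hn (mulL volume hm f), mulL_ae hm f, mulL_ae hn f]
    with x h1 h2 h3 h4
  rw [h1, h2, h3, h4]; ring

/-- Dominated convergence: each frequency eventually lies inside the ball. -/
theorem tendsto_band (f : L2Complex d) :
    Tendsto (fun n : ℕ => mulL volume (bandSymbol_bdd (d := d) (n : ℝ)) f) atTop (𝓝 f) := by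
  rw [Lp.tendsto_Lp_iff_tendsto_eLpNorm']
  have hsq : ∀ g : Space d → ℂ, (∫⁻ x, ‖g x‖ₑ ^ 2) ^ (1 / 2 : ℝ) = eLpNorm g 2 volume := fun g => by
    rw [eLpNorm_eq_lintegral_rpow_enorm_toReal two_ne_zero ENNReal.ofNat_ne_top]
    simp
  have hf2 : ∫⁻ x, ‖f x‖ₑ ^ 2 ≠ ⊤ := fun h => by
    have := hsq f
    rw [h, ENNReal.top_rpow_of_pos (by norm_num)] at this
    exact Lp.eLpNorm_ne_top f this.symm
  have key : Tendsto (fun n : ℕ => ∫⁻ x, ‖(bandSymbol (n : ℝ) x - 1) * f x‖ₑ ^ 2) atTop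
      (𝓝 (∫⁻ _ : Space d, 0)) := by
    refine tendsto_lintegral_of_dominated_convergence (fun x => ‖f x‖ₑ ^ 2) (fun n => ?_) (fun n =>
      ae_of_all _ fun x => ?_) hf2 (ae_of_all _ fun x => ?_)
    · exact ((((bandSymbol_bdd (d := d) (n : ℝ)).1.sub_const 1).mul
        (Lp.stronglyMeasurable f).measurable).enorm).pow_const 2
    · rcases bandSymbol_eq_zero_or (n : ℝ) x with h | ⟨h, -⟩ <;> simp [h]
    · refine tendsto_const_nhds.congr' ?_
      filter_upwards [eventually_ge_atTop ⌈‖x‖⌉₊] with n hn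
      have hx : x ∈ Metric.closedBall (0 : Space d) n := by
        rw [mem_closedBall_zero_iff]; exact (Nat.le_ceil _).trans (by exact_mod_cast hn)
      simp [bandSymbol, indicator_of_mem hx]
  rw [lintegral_zero] at key
  have k2 := ((ENNReal.continuous_rpow_const (y := (1 / 2 : ℝ))).tendsto 0).comp key
  rw [ENNReal.zero_rpow_of_pos (by norm_num)] at k2
  refine k2.congr fun n => ?_
  simp only [Function.comp_apply]
  rw [hsq]
  refine eLpNorm_congr_ae ?_
  filter_upwards [mulL_ae (bandSymbol_bdd (d := d) (n : ℝ)) f] with x hx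
  rw [Pi.sub_apply, hx]; ring

end Fourier

end NonlocalHomogenization

/-! ### Band-limited solutions of the constant coefficient equation -/

namespace NonlocalHomogenization

/-- The flow of a bounded operator. -/
theorem exists_flow {H : Type*} [NormedAddCommGroup H] [NormedSpace ℝ H] [CompleteSpace H] (B : H →L[ℝ] H)
    (g : H) : ∃ x : ℝ → H, Continuous x ∧ x 0 = g ∧ ∀ t, HasDerivAt x (B (x t)) t := by
  have hd : ∀ t : ℝ, HasDerivAt (fun u : ℝ => NormedSpace.exp (u • B) g) (B (NormedSpace.exp (t • B) g)) t :=
    fun t => by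
      have := (hasDerivAt_exp_smul_const' (𝕂 := ℝ) B t).clm_apply (hasDerivAt_const t g)
      simpa using this
  refine ⟨fun u => NormedSpace.exp (u • B) g, ?_, ?_, hd⟩
  · exact continuous_iff_continuousAt.2 fun t => (hd t).continuousAt
  · simp [NormedSpace.exp_zero]

theorem hasPrimitive_of_hasDerivAt {H F : Type*} [NormedAddCommGroup H] [NormedSpace ℝ H]
    [NormedAddCommGroup F] [NormedSpace ℝ F] [CompleteSpace F] {B : H →L[ℝ] H} {x : ℝ → H} (hc : Continuous x)
    (hx : ∀ t, HasDerivAt x (B (x t)) t) (Λ : H →L[ℝ] F) (T : ℝ) :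
    HasPrimitive T (fun t => Λ (x t)) fun t => Λ (B (x t)) := by
  have hi : ∀ a b, IntervalIntegrable (fun t => Λ (B (x t))) volume a b := fun a b =>
    (Λ.continuous.comp (B.continuous.comp hc)).intervalIntegrable a b
  refine ⟨hi 0 T, fun t _ => ?_⟩
  rw [intervalIntegral.integral_eq_sub_of_hasDerivAt (f := fun t => Λ (x t))
    (fun s _ => (Λ.hasFDerivAt.comp_hasDerivAt s (hx s))) (hi 0 t)]
  abel

section BandLimited

variable {d : ℕ}

/-- `Z = s(k) G(k)` on the Fourier side. -/
def HasSymbol (G Z : L2Complex d) (s : Space d → ℂ) : Prop := Z =ᵐ[volume] fun k => s k * G k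

namespace HasSymbol

variable {G Z W : L2Complex d} {s r : Space d → ℂ}

theorem add (h1 : HasSymbol G Z s) (h2 : HasSymbol G W r) : HasSymbol G (Z + W) fun k => s k + r k := by
  filter_upwards [Lp.coeFn_add Z W, h1, h2] with k a b c
  rw [a, Pi.add_apply, b, c]; ring

theorem sub (h1 : HasSymbol G Z s) (h2 : HasSymbol G W r) : HasSymbol G (Z - W) fun k => s k - r k := by
  filter_upwards [Lp.coeFn_sub Z W, h1, h2] with k a b c
  rw [a, Pi.sub_apply, b, c]; ring

theorem smul (c : ℝ) (h1 : HasSymbol G Z s) : HasSymbol G (c • Z) fun k => (c : ℂ) * s k := by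
  filter_upwards [Lp.coeFn_smul c Z, h1] with k a b
  rw [a, Pi.smul_apply, b, Complex.real_smul]; ring

theorem sum {ι : Type*} [Fintype ι] {Z : ι → L2Complex d} {s : ι → Space d → ℂ}
    (h : ∀ i, HasSymbol G (Z i) (s i)) : HasSymbol G (∑ i, Z i) fun k => ∑ i, s i k := by
  filter_upwards [Lp.coeFn_finsetSum Finset.univ Z, ae_all_iff.2 h] with k a b
  rw [a, Finset.sum_apply, Finset.sum_mul]
  exact Finset.sum_congr rfl fun i _ => b i

theorem mulL {m : Space d → ℂ} {C : ℝ} (hm : Measurable m ∧ ∀ x, ‖m x‖ ≤ C) (h1 : HasSymbol G Z s) :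
    HasSymbol G (mulL volume hm Z) fun k => m k * s k := by
  filter_upwards [mulL_ae hm Z, h1] with k a b
  rw [a, b]; ring

theorem norm_le (h1 : HasSymbol G Z s) {K : ℝ} (hK : ∀ k, ‖s k‖ ≤ K) : ‖Z‖ ≤ K * ‖G‖ := by
  refine Lp.norm_le_mul_norm_of_ae_le_mul ?_
  filter_upwards [h1] with k a
  rw [a, norm_mul]
  exact mul_le_mul_of_nonneg_right (hK k) (norm_nonneg _)

end HasSymbol

/-- Frequency truncation. -/
def bandL (d : ℕ) (R : ℝ) : L2Complex d →L[ℝ] L2Complex d :=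
  (mulL volume (bandSymbol_bdd (d := d) R)).restrictScalars ℝ

/-- The truncated partial derivative on the Fourier side. -/
def gradL {R : ℝ} (hR : 0 ≤ R) (j : Fin d) : L2Complex d →L[ℝ] L2Complex d :=
  (mulL volume (gradSymbol_bdd hR j)).restrictScalars ℝ

theorem hasSymbol_bandL (R : ℝ) (G : L2Complex d) : HasSymbol G (bandL d R G) (bandSymbol R) :=
  mulL_ae (bandSymbol_bdd R) G

theorem sum_coord_mul (h k : Space d) :
    ∑ i, ((h i : ℝ) : ℂ) * ((2 * Real.pi * k i : ℝ) * Complex.I) = (2 * Real.pi * inner ℝ h k : ℝ) * Complex.I := by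
  rw [inner_eq_coord_sum]
  push_cast
  rw [Finset.mul_sum, Finset.sum_mul]
  exact Finset.sum_congr rfl fun i _ => by ring

theorem abs_phase_le {R : ℝ} {k : Space d} (hk : ‖k‖ ≤ R) (h : Space d) :
    |2 * Real.pi * inner ℝ h k| ≤ (2 * Real.pi * R + 1) * ‖h‖ := by
  rw [abs_mul, abs_of_pos (by positivity : 0 < 2 * Real.pi)]
  have h1 := abs_real_inner_le_norm h k
  have h2 : ‖h‖ * ‖k‖ ≤ ‖h‖ * R := mul_le_mul_of_nonneg_left hk (norm_nonneg _)
  calc 2 * Real.pi * |inner ℝ h k| ≤ 2 * Real.pi * (‖h‖ * R) := by gcongr; exact h1.trans h2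
    _ ≤ _ := by linarith [norm_nonneg h]

/-- The condition `1 ≤ L` is the reason for the summand 1 in `L = 2πR + 1`, the constant that bounds
phases on the band. -/
theorem min_one_mul_le {L x y : ℝ} (hL : 1 ≤ L) (hx : x ≤ L * y) : min 1 x ≤ L * min 1 y := by
  rcases le_total 1 y with h | h
  · rw [min_eq_left h]; exact (min_le_left _ _).trans (by linarith)
  · rw [min_eq_right h]; exact (min_le_right _ _).trans hx

variable {R : ℝ}

/-- Outside the band the symbol is zero. Inside, the phase is at most `(2πR + 1)‖h‖`, and the scalar
bound applies. The next two estimates follow the same pattern; their first-order sums carry a plus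
sign because translation is `f(· - h)`. -/
theorem taylor_symbol_zero (hR : 0 ≤ R) (h : Space d) (G : L2Complex d) :
    ‖mulL volume (transSymbol_bdd h) (bandL d R G) - bandL d R G‖ ≤
      2 * ((2 * Real.pi * R + 1) * min 1 ‖h‖) * ‖G‖ := by
  have hb := hasSymbol_bandL R G
  refine ((hb.mulL (transSymbol_bdd h)).sub hb).norm_le fun k => ?_
  rcases bandSymbol_eq_zero_or R k with h0 | ⟨h1, hk⟩
  · rw [h0, mul_zero, sub_zero, norm_zero]; positivity
  · rw [h1, mul_one, transSymbol]
    refine (norm_exp_sub_one_le_min _).trans ?_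
    gcongr
    exact min_one_mul_le (by have := Real.pi_pos; nlinarith [mul_nonneg Real.pi_pos.le hR]) (abs_phase_le hk h)

theorem taylor_symbol_one (hR : 0 ≤ R) (h : Space d) (G : L2Complex d) :
    ‖mulL volume (transSymbol_bdd h) (bandL d R G) - bandL d R G + ∑ i, h i • gradL hR i (bandL d R G)‖ ≤
      3 * (((2 * Real.pi * R + 1) * ‖h‖) * ((2 * Real.pi * R + 1) * min 1 ‖h‖)) * ‖G‖ := by
  have hb := hasSymbol_bandL R G
  refine (((hb.mulL (transSymbol_bdd h)).sub hb).add (HasSymbol.sum fun i =>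
    (hb.mulL (gradSymbol_bdd hR i)).smul (h i))).norm_le fun k => ?_
  have hL : 1 ≤ 2 * Real.pi * R + 1 := by nlinarith [mul_nonneg Real.pi_pos.le hR]
  rcases bandSymbol_eq_zero_or R k with h0 | ⟨h1, hk⟩
  · simp only [h0, mul_zero, Finset.sum_const_zero, sub_zero, add_zero, norm_zero]; positivity
  · simp only [gradSymbol, h1, mul_one, one_mul, transSymbol]
    rw [sum_coord_mul]
    have := norm_exp_sub_one_sub_id_le_min (2 * Real.pi * inner ℝ h k)
    refine le_trans (le_of_eq ?_) (this.trans ?_)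
    · congr 1; push_cast; ring
    · have h2 := abs_phase_le hk h
      have h3 := min_one_mul_le hL h2
      gcongr

theorem taylor_symbol_two (hR : 0 ≤ R) (h : Space d) (G : L2Complex d) :
    ‖mulL volume (transSymbol_bdd h) (bandL d R G) - bandL d R G + ∑ i, h i • gradL hR i (bandL d R G) -
      ∑ i, ∑ j, (1 / 2 * h i * h j) • gradL hR i (gradL hR j (bandL d R G))‖ ≤
      4 * (((2 * Real.pi * R + 1) * ‖h‖) ^ 2 * ((2 * Real.pi * R + 1) * min 1 ‖h‖)) * ‖G‖ := by
  have hb := hasSymbol_bandL R G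
  refine ((((hb.mulL (transSymbol_bdd h)).sub hb).add (HasSymbol.sum fun i =>
    (hb.mulL (gradSymbol_bdd hR i)).smul (h i))).sub (HasSymbol.sum fun i => HasSymbol.sum fun j =>
      ((hb.mulL (gradSymbol_bdd hR j)).mulL (gradSymbol_bdd hR i)).smul (1 / 2 * h i * h j))).norm_le fun k => ?_
  have hL : 1 ≤ 2 * Real.pi * R + 1 := by nlinarith [mul_nonneg Real.pi_pos.le hR]
  rcases bandSymbol_eq_zero_or R k with h0 | ⟨h1, hk⟩
  · simp only [h0, mul_zero, Finset.sum_const_zero, sub_zero, add_zero, norm_zero]; positivity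
  · simp only [gradSymbol, h1, mul_one, one_mul, transSymbol]
    have e2 : ∑ i, ∑ j, ((1 / 2 * h i * h j : ℝ) : ℂ) * ((2 * Real.pi * k i : ℝ) * Complex.I *
        ((2 * Real.pi * k j : ℝ) * Complex.I)) =
        ((2 * Real.pi * inner ℝ h k : ℝ) * Complex.I) ^ 2 / 2 := by
      rw [← sum_coord_mul, sq, Finset.sum_mul_sum, Finset.sum_div]
      refine Finset.sum_congr rfl fun i _ => ?_
      rw [Finset.sum_div]
      refine Finset.sum_congr rfl fun j _ => ?_
      push_cast
      ring
    rw [sum_coord_mul, e2]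
    have := norm_exp_sub_quadratic_le_min (2 * Real.pi * inner ℝ h k)
    refine le_trans (le_of_eq ?_) (this.trans ?_)
    · congr 1; push_cast; ring
    · have h2 := abs_phase_le hk h
      have h3 := min_one_mul_le hL h2
      gcongr

theorem gradL_norm_le (hR : 0 ≤ R) (j : Fin d) (G : L2Complex d) : ‖gradL hR j G‖ ≤ (2 * Real.pi * R + 1) * ‖G‖ :=
  (mulL_norm_le (gradSymbol_bdd hR j) G).trans (by gcongr; linarith)

theorem bandL_norm_le (R : ℝ) (G : L2Complex d) : ‖bandL d R G‖ ≤ ‖G‖ := by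
  have := mulL_norm_le (bandSymbol_bdd (d := d) R) G
  rwa [one_mul] at this

theorem gradL_bandL_comm (hR : 0 ≤ R) (j : Fin d) (G : L2Complex d) :
    bandL d R (gradL hR j G) = gradL hR j (bandL d R G) :=
  mulL_comm (bandSymbol_bdd R) (gradSymbol_bdd hR j) G

theorem gradL_trans_comm (hR : 0 ≤ R) (j : Fin d) (h : Space d) (G : L2Complex d) :
    mulL volume (transSymbol_bdd h) (gradL hR j G) = gradL hR j (mulL volume (transSymbol_bdd h) G) :=
  mulL_comm (transSymbol_bdd h) (gradSymbol_bdd hR j) G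

theorem gradL_gradL_comm (hR : 0 ≤ R) (i j : Fin d) (G : L2Complex d) : gradL hR i (gradL hR j G) = gradL hR j (gradL hR i G) :=
  mulL_comm (gradSymbol_bdd hR i) (gradSymbol_bdd hR j) G

set_option maxHeartbeats 1000000 in
/-- Band-limited solutions of the constant coefficient diffusion equation. -/
theorem exists_smoothFlow_band (hR : 0 ≤ R) (θ : Matrix (Fin d) (Fin d) ℝ) {T : ℝ} (hT : 0 < T) (G₀ : L2Complex d) :
    ∃ C v v1 v2, SmoothFlow θ T C v v1 v2 ∧ (∀ i j, v2 i j = v2 j i) ∧ v 0 = synth d (bandL d R G₀) := by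
  -- With truncated derivatives the diffusion operator is bounded, so its flow is an exponential and
  -- exists for any matrix, with no sign condition.
  set B : L2Complex d →L[ℝ] L2Complex d := ∑ i, ∑ j, θ i j • (gradL hR i).comp (gradL hR j) with hB
  obtain ⟨x, hxc, hx0, hxd⟩ := exists_flow B G₀
  obtain ⟨X, hX⟩ := (isCompact_Icc (a := (0 : ℝ)) (b := T)).exists_bound_of_continuousOn hxc.continuousOn
  have hX0 : 0 ≤ X := (norm_nonneg _).trans (hX 0 ⟨le_rfl, hT.le⟩)
  set L := 2 * Real.pi * R + 1 with hLdef
  have hL : 1 ≤ L := by nlinarith [mul_nonneg Real.pi_pos.le hR]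
  have hL0 : 0 ≤ L := zero_le_one.trans hL
  have hL2 : L ≤ L ^ 2 := by nlinarith
  have hL3 : L ^ 2 ≤ L ^ 3 := by nlinarith
  set N := ‖B‖ with hN
  have hN0 : 0 ≤ N := norm_nonneg B
  set E := bandL d R with hE
  have hEB : ∀ G, E (B G) = ∑ i, ∑ j, θ i j • gradL hR i (gradL hR j (E G)) := fun G => by
    simp only [hB, FunLike.coe_sum, Finset.sum_apply, smul_apply, ContinuousLinearMap.comp_apply, map_sum, map_smul, hE,
      gradL_bandL_comm]
  have hgrad : ∀ (j : Fin d) G, ‖gradL hR j G‖ ≤ L * ‖G‖ := gradL_norm_le hR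
  have hEn : ∀ G, ‖E G‖ ≤ ‖G‖ := bandL_norm_le R
  have hBX : ∀ t ∈ Icc 0 T, ‖B (x t)‖ ≤ N * X := fun t ht =>
    (B.le_opNorm _).trans (mul_le_mul_of_nonneg_left (hX t ht) hN0)
  have hle : ∀ c : ℝ, 0 ≤ c → c ≤ 4 * L ^ 3 → ∀ t ∈ Icc 0 T, c * ‖x t‖ ≤ 4 * L ^ 3 * (1 + N) * X :=
    fun c hc0 hc t ht => by
      have := hX t ht
      calc c * ‖x t‖ ≤ 4 * L ^ 3 * X := by gcongr
        _ = 4 * L ^ 3 * 1 * X := by ring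
        _ ≤ _ := by gcongr; linarith
  have hle' : ∀ c : ℝ, 0 ≤ c → c ≤ 4 * L ^ 3 → ∀ t ∈ Icc 0 T, c * ‖B (x t)‖ ≤ 4 * L ^ 3 * (1 + N) * X :=
    fun c hc0 hc t ht => by
      have := hBX t ht
      calc c * ‖B (x t)‖ ≤ 4 * L ^ 3 * (N * X) := by gcongr
        _ = 4 * L ^ 3 * N * X := by ring
        _ ≤ _ := by gcongr; linarith
  -- One constant for all bounds: 4 is the largest numerical factor of the symbol estimates, `L³`
  -- the highest power of the phase bound, `N = ‖B‖` accounts for time derivatives, and `X` bounds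
  -- the flow on `[0, T]`.
  refine ⟨4 * L ^ 3 * (1 + N) * X, fun t => synth d (E (x t)), fun j t => synth d (gradL hR j (E (x t))),
    fun i j t => synth d (gradL hR i (gradL hR j (E (x t)))), ?_, fun i j => ?_, by simp only [hx0]⟩
  swap
  · exact funext fun t => congrArg (synth d) (gradL_gradL_comm hR i j _)
  have hc0 : (0 : ℝ) ≤ L ^ 2 := by positivity
  have hs1 : ∀ j G, ‖synth d (gradL hR j (E G))‖ ≤ L * ‖G‖ := fun j G =>
    (synth_norm_le _).trans ((hgrad j _).trans (mul_le_mul_of_nonneg_left (hEn G) hL0))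
  have hs2 : ∀ i j G, ‖synth d (gradL hR i (gradL hR j (E G)))‖ ≤ L ^ 2 * ‖G‖ := fun i j G => by
    have h1 := mul_le_mul_of_nonneg_left ((hgrad j (E G)).trans (mul_le_mul_of_nonneg_left (hEn G) hL0)) hL0
    rw [← mul_assoc, ← sq] at h1
    exact (synth_norm_le _).trans ((hgrad i _).trans h1)
  have hflow : HasPrimitive T (fun t => synth d (E (x t)))
      fun s => ∑ i, ∑ j, θ i j • synth d (gradL hR i (gradL hR j (E (x s)))) := by
    have := hasPrimitive_of_hasDerivAt hxc hxd ((synth d).comp E) T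
    simp only [ContinuousLinearMap.comp_apply, hEB, map_sum, map_smul] at this
    exact this
  have hp1 : ∀ j, HasPrimitive T (fun t => synth d (gradL hR j (E (x t))))
      fun t => synth d (gradL hR j (E (B (x t)))) := fun j =>
    hasPrimitive_of_hasDerivAt hxc hxd ((synth d).comp ((gradL hR j).comp E)) T
  have hp2 : ∀ i j, HasPrimitive T (fun t => synth d (gradL hR i (gradL hR j (E (x t)))))
      fun t => synth d (gradL hR i (gradL hR j (E (B (x t))))) := fun i j =>
    hasPrimitive_of_hasDerivAt hxc hxd ((synth d).comp ((gradL hR i).comp ((gradL hR j).comp E))) T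
  exact
    { nonneg := by positivity
      flow := hflow
      grad := fun j => ⟨_, hp1 j, fun t ht => (hs1 j _).trans (hle' L hL0 (by linarith) t ht)⟩
      hess := fun i j => ⟨_, hp2 i j, fun t ht => (hs2 i j _).trans (hle' (L ^ 2) hc0 (by linarith) t ht)⟩
      norm_grad := fun j t ht => (hs1 j _).trans (hle L hL0 (by linarith) t ht)
      norm_hess := fun i j t ht => (hs2 i j _).trans (hle (L ^ 2) hc0 (by linarith) t ht)
      lipschitz := fun t ht h => by
        rw [transL_synth, ← map_sub]
        refine (synth_norm_le _).trans ((taylor_symbol_zero hR h (x t)).trans ?_)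
        have := hle (2 * L) (by linarith) (by linarith) t ht
        calc 2 * (L * min 1 ‖h‖) * ‖x t‖ = (2 * L * ‖x t‖) * min 1 ‖h‖ := by ring
          _ ≤ _ := by gcongr; exact min_le_right _ _
      taylor_two := fun t ht h => by
        have e : transL ℝ volume h (synth d (E (x t))) - synth d (E (x t)) +
            ∑ i, h i • synth d (gradL hR i (E (x t))) -
              ∑ i, ∑ j, (1 / 2 * h i * h j) • synth d (gradL hR i (gradL hR j (E (x t)))) =
            synth d (mulL volume (transSymbol_bdd h) (E (x t)) - E (x t) + ∑ i, h i • gradL hR i (E (x t)) -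
              ∑ i, ∑ j, (1 / 2 * h i * h j) • gradL hR i (gradL hR j (E (x t)))) := by
          simp only [transL_synth, map_smul, map_sum, map_sub, map_add]
        rw [e]
        refine (synth_norm_le _).trans ((taylor_symbol_two hR h (x t)).trans ?_)
        have := hle (4 * L ^ 3) (by positivity) (by linarith) t ht
        calc 4 * ((L * ‖h‖) ^ 2 * (L * min 1 ‖h‖)) * ‖x t‖ =
            (4 * L ^ 3 * ‖x t‖) * (‖h‖ ^ 2 * min 1 ‖h‖) := by ring
          _ ≤ _ := by gcongr
      taylor_one := fun j t ht h => by
        have e : transL ℝ volume h (synth d (gradL hR j (E (x t)))) - synth d (gradL hR j (E (x t))) +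
              ∑ i, h i • synth d (gradL hR i (gradL hR j (E (x t)))) =
            synth d (gradL hR j (mulL volume (transSymbol_bdd h) (E (x t)) - E (x t) +
              ∑ i, h i • gradL hR i (E (x t)))) := by
          simp only [transL_synth, map_smul, map_sum, map_sub, map_add, gradL_trans_comm, gradL_gradL_comm hR _ j]
        rw [e]
        refine (synth_norm_le _).trans ((hgrad j _).trans ((mul_le_mul_of_nonneg_left
          (taylor_symbol_one hR h (x t)) hL0).trans ?_))
        have := hle (3 * L ^ 3) (by positivity) (by nlinarith [pow_nonneg hL0 3]) t ht
        calc L * (3 * ((L * ‖h‖) * (L * min 1 ‖h‖)) * ‖x t‖) =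
            (3 * L ^ 3 * ‖x t‖) * (‖h‖ * min 1 ‖h‖) := by ring
          _ ≤ _ := by gcongr
      taylor_zero := fun i j t ht h => by
        simp only [transL_synth, ← map_sub, gradL_trans_comm]
        refine (synth_norm_le _).trans ((hgrad i _).trans ((mul_le_mul_of_nonneg_left ((hgrad j _).trans
          (mul_le_mul_of_nonneg_left (taylor_symbol_zero hR h (x t)) hL0)) hL0).trans ?_))
        have := hle (2 * L ^ 3) (by positivity) (by nlinarith [pow_nonneg hL0 3]) t ht
        calc L * (L * (2 * (L * min 1 ‖h‖) * ‖x t‖)) = (2 * L ^ 3 * ‖x t‖) * min 1 ‖h‖ := by ring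
          _ ≤ _ := by gcongr }

end BandLimited

/-- Every initial datum is approximated by initial data of smooth flows. -/
theorem exists_smoothFlow_near {d : ℕ} (θ : Matrix (Fin d) (Fin d) ℝ) {T : ℝ} (hT : 0 < T) (u₀ : L2Space d)
    {δ : ℝ} (hδ : 0 < δ) :
    ∃ C v v1 v2, SmoothFlow θ T C v v1 v2 ∧ (∀ i j, v2 i j = v2 j i) ∧ ‖u₀ - v 0‖ < δ := by
  obtain ⟨n, hn⟩ := ((Metric.tendsto_nhds.1 (tendsto_band (analysis u₀)) δ hδ)).exists
  obtain ⟨C, v, v1, v2, h, hs, h0⟩ := exists_smoothFlow_band (Nat.cast_nonneg (α := ℝ) n) θ hT (analysis u₀)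
  refine ⟨C, v, v1, v2, h, hs, ?_⟩
  rw [h0]
  nth_rw 1 [← synth_analysis u₀]
  rw [← map_sub, ← norm_neg, ← map_neg, neg_sub]
  refine (synth_norm_le _).trans_lt ?_
  rw [dist_eq_norm] at hn
  exact hn

end NonlocalHomogenization

/-! ### Test functions, convolution and dissipativity of the diffusion operator -/

namespace NonlocalHomogenization

variable {d : ℕ}

/-- Test functions. -/
structure IsTest (φ : Space d → ℝ) : Prop where
  smooth : ContDiff ℝ ∞ φ
  compact : HasCompactSupport φ

/-- Partial derivatives. -/
def partialD (j : Fin d) (φ : Space d → ℝ) (x : Space d) : ℝ := fderiv ℝ φ x (EuclideanSpace.single j 1)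

/-- Convolution of scalar functions. -/
def conv (α g : Space d → ℝ) : Space d → ℝ := convolution α g (ContinuousLinearMap.mul ℝ ℝ) volume

theorem conv_apply (α g : Space d → ℝ) (x : Space d) : conv α g x = ∫ z, α z * g (x - z) := rfl

theorem partialD_comp_neg (φ : Space d → ℝ) (j : Fin d) (x : Space d) :
    partialD j (fun y => φ (-y)) x = -partialD j φ (-x) := by
  have h := (ContinuousLinearEquiv.neg ℝ (M := Space d)).comp_right_fderiv (f := φ) (x := x)
  have h' : partialD j (fun y => φ (-y)) x = fderiv ℝ φ (-x) (-EuclideanSpace.single j 1) :=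
    congrArg (fun l : Space d →L[ℝ] ℝ => l (EuclideanSpace.single j 1)) h
  rw [h', map_neg, partialD]

theorem partialD_neg {φ : Space d → ℝ} (h : ∀ x, φ (-x) = φ x) (j : Fin d) (x : Space d) :
    partialD j φ (-x) = -partialD j φ x := by
  have := partialD_comp_neg φ j x
  simp only [h] at this
  rw [this, neg_neg]

theorem partialD_neg_of_odd {φ : Space d → ℝ} (h : ∀ x, φ (-x) = -φ x) (j : Fin d) (x : Space d) :
    partialD j φ (-x) = partialD j φ x := by
  have h1 := partialD_comp_neg φ j x
  simp only [h] at h1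
  rw [← neg_inj, ← h1, partialD, fderiv_fun_neg]
  rfl

namespace IsTest

variable {φ ψ α : Space d → ℝ}

theorem continuous (h : IsTest φ) : Continuous φ := h.smooth.continuous

theorem memLp (h : IsTest φ) (p : ENNReal) : MemLp φ p volume := h.continuous.memLp_of_hasCompactSupport h.compact

theorem integrable (h : IsTest φ) : Integrable φ := h.continuous.integrable_of_hasCompactSupport h.compact

theorem mul (h : IsTest φ) (h' : IsTest ψ) : IsTest fun x => φ x * ψ x :=
  ⟨h.smooth.mul h'.smooth, h.compact.mul_right⟩

theorem const_mul (c : ℝ) (h : IsTest φ) : IsTest fun x => c * φ x :=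
  ⟨contDiff_const.mul h.smooth, h.compact.mul_left⟩

theorem zero : IsTest fun _ : Space d => (0 : ℝ) := ⟨contDiff_const, HasCompactSupport.zero⟩

theorem sum {ι : Type*} (s : Finset ι) {φ : ι → Space d → ℝ} (h : ∀ i, IsTest (φ i)) :
    IsTest fun x => ∑ i ∈ s, φ i x := by
  induction s using Finset.cons_induction with
  | empty => simpa using zero
  | cons i s hi ih =>
    simp only [Finset.sum_cons]
    exact ⟨(h i).smooth.add ih.smooth, (h i).compact.add ih.compact⟩

theorem partialD (h : IsTest φ) (j : Fin d) : IsTest (partialD j φ) :=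
  ⟨(h.smooth.fderiv_right (m := ∞) (by simp)).clm_apply contDiff_const, h.compact.fderiv_apply ℝ _⟩

theorem differentiable (h : IsTest φ) : Differentiable ℝ φ := h.smooth.differentiable (by simp)

theorem comp_neg (h : IsTest φ) : IsTest fun x => φ (-x) :=
  ⟨h.smooth.comp contDiff_neg, h.compact.comp_homeomorph (Homeomorph.neg _)⟩

theorem conv (h : IsTest α) (h' : IsTest φ) : IsTest (conv α φ) :=
  ⟨h.compact.contDiff_convolution_left _ h.smooth h'.continuous.locallyIntegrable,
    HasCompactSupport.convolution _ h.compact h'.compact⟩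

end IsTest

theorem divGrad_eq {φ : Space d → ℝ} (h : IsTest φ) (A : Matrix (Fin d) (Fin d) ℝ) :
    divGrad A φ = fun x => ∑ i, ∑ j, A i j * partialD i (partialD j φ) x := by
  funext x
  refine Finset.sum_congr rfl fun i _ => ?_
  have : HasFDerivAt (fun y => ∑ j, A i j * fderiv ℝ φ y (EuclideanSpace.single j 1))
      (∑ j, A i j • fderiv ℝ (partialD j φ) x) x :=
    HasFDerivAt.fun_sum fun j _ => ((h.partialD j).differentiable x).hasFDerivAt.const_mul (A i j)
  rw [this.fderiv, FunLike.coe_sum, Finset.sum_apply]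
  rfl

theorem IsTest.divGrad {φ : Space d → ℝ} (h : IsTest φ) (A : Matrix (Fin d) (Fin d) ℝ) : IsTest (divGrad A φ) := by
  rw [divGrad_eq h]
  exact IsTest.sum _ fun i => IsTest.sum _ fun j => ((h.partialD j).partialD i).const_mul _

/-- Two derivatives preserve evenness, so convolution with `divGrad A α` is symmetric and can be
moved from the test function to the solution. -/
theorem divGrad_neg {φ : Space d → ℝ} (h : IsTest φ) (he : ∀ x, φ (-x) = φ x) (A : Matrix (Fin d) (Fin d) ℝ)
    (x : Space d) : divGrad A φ (-x) = divGrad A φ x := by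
  rw [divGrad_eq h]
  simp only [partialD_neg_of_odd (partialD_neg he _)]

theorem hasFDerivAt_conv {α g : Space d → ℝ} (h : IsTest α) (hg : LocallyIntegrable g) (x v : Space d) :
    HasFDerivAt (conv α g) (fderiv ℝ (conv α g) x) x ∧
      fderiv ℝ (conv α g) x v = ∫ z, fderiv ℝ α z v * g (x - z) := by
  have h1 := h.compact.hasFDerivAt_convolution_left (ContinuousLinearMap.mul ℝ ℝ)
    (h.smooth.of_le (by norm_cast)) hg x
  refine ⟨h1.differentiableAt.hasFDerivAt, ?_⟩
  have h2 : fderiv ℝ (conv α g) x = _ := h1.fderiv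
  rw [h2, convolution_def, ContinuousLinearMap.integral_apply]
  · rfl
  · exact (h.compact.fderiv ℝ).convolutionExists_left _ (h.smooth.continuous_fderiv (by simp)) hg x

theorem partialD_conv {α g : Space d → ℝ} (h : IsTest α) (hg : LocallyIntegrable g) (j : Fin d) :
    partialD j (conv α g) = conv (partialD j α) g :=
  funext fun x => (hasFDerivAt_conv h hg x _).2

theorem conv_integrable {α g : Space d → ℝ} (h : IsTest α) (hg : LocallyIntegrable g) (x : Space d) :
    Integrable fun z => α z * g (x - z) :=
  h.compact.convolutionExists_left (ContinuousLinearMap.mul ℝ ℝ) h.continuous hg x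

theorem divGrad_conv {α φ : Space d → ℝ} (h : IsTest α) (h' : IsTest φ) (A : Matrix (Fin d) (Fin d) ℝ) :
    divGrad A (conv α φ) = conv (divGrad A α) φ := by
  have hl := h'.continuous.locallyIntegrable (μ := volume)
  funext x
  rw [divGrad_eq (h.conv h'), divGrad_eq h, conv_apply]
  have hi : ∀ i j, Integrable fun z => A i j * partialD i (partialD j α) z * φ (x - z) := fun i j =>
    conv_integrable (((h.partialD j).partialD i).const_mul (A i j)) hl x
  simp only [Finset.sum_mul]
  rw [integral_finsetSum _ fun i _ => integrable_finsetSum _ fun j _ => hi i j]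
  refine Finset.sum_congr rfl fun i _ => ?_
  rw [integral_finsetSum _ fun j _ => hi i j]
  refine Finset.sum_congr rfl fun j _ => ?_
  rw [partialD_conv h hl, partialD_conv (h.partialD j) hl, conv_apply, ← integral_const_mul]
  simp only [mul_assoc]

theorem integral_mul_partialD {φ ψ : Space d → ℝ} (h : IsTest φ) (h' : IsTest ψ) (j : Fin d) :
    ∫ x, φ x * partialD j ψ x = -∫ x, partialD j φ x * ψ x :=
  integral_mul_fderiv_eq_neg_fderiv_mul_of_integrable ((h.partialD j).mul h').integrable
    (h.mul (h'.partialD j)).integrable (h.mul h').integrable (fun x _ => h.differentiable x)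
    (fun x _ => h'.differentiable x)

/-- Dissipativity of the constant coefficient diffusion operator. -/
theorem integral_mul_divGrad_nonpos {φ : Space d → ℝ} (h : IsTest φ) {A : Matrix (Fin d) (Fin d) ℝ}
    (hA : A.PosSemidef) : ∫ x, φ x * divGrad A φ x ≤ 0 := by
  rw [divGrad_eq h]
  have hi : ∀ i j, Integrable fun x => A i j * (φ x * partialD i (partialD j φ) x) := fun i j =>
    ((h.mul ((h.partialD j).partialD i)).const_mul _).integrable
  have hi' : ∀ i j, Integrable fun x => A i j * (partialD i φ x * partialD j φ x) := fun i j =>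
    (((h.partialD i).mul (h.partialD j)).const_mul _).integrable
  have e : ∫ x, φ x * ∑ i, ∑ j, A i j * partialD i (partialD j φ) x =
      -∫ x, ∑ i, ∑ j, A i j * (partialD i φ x * partialD j φ x) := by
    have : ∀ x, φ x * ∑ i, ∑ j, A i j * partialD i (partialD j φ) x =
        ∑ i, ∑ j, A i j * (φ x * partialD i (partialD j φ) x) := fun x => by
      simp only [Finset.mul_sum]
      exact Finset.sum_congr rfl fun i _ => Finset.sum_congr rfl fun j _ => by ring
    simp only [this]
    rw [integral_finsetSum _ fun i _ => integrable_finsetSum _ fun j _ => hi i j,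
      integral_finsetSum _ fun i _ => integrable_finsetSum _ fun j _ => hi' i j, ← Finset.sum_neg_distrib]
    refine Finset.sum_congr rfl fun i _ => ?_
    rw [integral_finsetSum _ fun j _ => hi i j, integral_finsetSum _ fun j _ => hi' i j, ← Finset.sum_neg_distrib]
    refine Finset.sum_congr rfl fun j _ => ?_
    rw [integral_const_mul, integral_const_mul, integral_mul_partialD h (h.partialD j)]
    ring
  rw [e, neg_nonpos]
  refine integral_nonneg fun x => ?_
  have := hA.dotProduct_mulVec_nonneg fun i => partialD i φ x
  refine this.trans_eq ?_
  simp only [dotProduct, Matrix.mulVec, Pi.star_apply, star_trivial, Finset.mul_sum]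
  exact Finset.sum_congr rfl fun i _ => Finset.sum_congr rfl fun j _ => by ring

end NonlocalHomogenization

/-! ### Mollification and contraction for weak solutions -/

namespace NonlocalHomogenization

variable {d : ℕ}

/-- The jump kernel of plain convolutions. -/
def spaceKernel (d : ℕ) : JumpKernel d (Space d) where
  shift := id
  coeff _ _ _ := 1
  lo := 1
  hi := 1
  shift_meas := measurable_id
  shift_neg _ := rfl
  coeff_meas := measurable_const
  lo_pos := one_pos
  lo_le _ _ _ := le_rfl
  le_hi _ _ _ := le_rfl
  symm _ _ _ := rfl

/-- Convolution with `α` as an operator on `L²(ℝ^d)`. -/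
def smear {α : Space d → ℝ} (hα : Integrable α) : L2Space d →L[ℝ] L2Space d := (spaceKernel d).K hα 0

theorem spaceKernel_S (s : ℝ) (z : Space d) (f : L2Space d) :
    (spaceKernel d).S volume s z f = transL ℝ volume z f := by
  refine Lp.ext ?_
  filter_upwards [(spaceKernel d).S_ae s z f, transL_ae z f] with x h1 h2
  rw [h1, h2]
  exact one_mul _

variable {α φ : Space d → ℝ}

theorem smear_integrable (hα : Integrable α) (f : L2Space d) : Integrable fun z => α z • transL ℝ volume z f := by
  have := (spaceKernel d).S_integrable (ν := volume) hα 0 f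
  simpa only [spaceKernel_S] using this

theorem smear_apply (hα : Integrable α) (f : L2Space d) : smear hα f = ∫ z, α z • transL ℝ volume z f := by
  rw [smear, JumpKernel.K_apply]
  simp only [spaceKernel_S]

theorem smear_ae (hα : Integrable α) (hm : Measurable α) (f : L2Space d) : smear hα f =ᵐ[volume] conv α f := by
  filter_upwards [((spaceKernel d).K_ae hm hα 0 f).2] with x hx
  rw [smear, hx, conv_apply]
  simp [spaceKernel]

/-- The adjoint of a translation is the opposite translation, and the weight is even. -/
theorem smear_symm (hα : Integrable α) (he : ∀ z, α (-z) = α z) (f g : L2Space d) :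
    inner ℝ (smear hα f) g = inner ℝ f (smear hα g) := by
  rw [real_inner_comm, smear, JumpKernel.inner_K, JumpKernel.inner_K, ← integral_neg_eq_self]
  refine integral_congr_ae (ae_of_all _ fun z => ?_)
  beta_reduce
  rw [JumpKernel.inner_S_neg, he, real_inner_comm]

theorem smear_norm_le (hα : Integrable α) (h0 : ∀ z, 0 ≤ α z) (h1 : ∫ z, α z = 1) (f : L2Space d) :
    ‖smear hα f‖ ≤ ‖f‖ := by
  rw [smear_apply]
  refine (norm_integral_le_of_norm_le (hα.mul_const ‖f‖) (ae_of_all _ fun z => ?_)).trans_eq ?_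
  · rw [norm_smul, LinearIsometry.norm_map, Real.norm_of_nonneg (h0 z)]
  · rw [integral_mul_const, h1, one_mul]

theorem smear_sub_norm_le (hα : Integrable α) (h0 : ∀ z, 0 ≤ α z) (h1 : ∫ z, α z = 1) (f : L2Space d) {δ : ℝ}
    (h : ∀ z, α z ≠ 0 → ‖transL ℝ volume z f - f‖ ≤ δ) : ‖smear hα f - f‖ ≤ δ := by
  have e : smear hα f - f = ∫ z, α z • (transL ℝ volume z f - f) := by
    simp only [smul_sub]
    rw [integral_sub (smear_integrable hα f) (hα.smul_const f), smear_apply, integral_smul_const, h1, one_smul]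
  rw [e]
  refine (norm_integral_le_of_norm_le (hα.mul_const δ) (ae_of_all _ fun z => ?_)).trans_eq ?_
  · rw [norm_smul, Real.norm_of_nonneg (h0 z)]
    by_cases hz : α z = 0
    · simp [hz]
    · exact mul_le_mul_of_nonneg_left (h z hz) (h0 z)
  · rw [integral_mul_const, h1, one_mul]

/-- A test function as an element of `L²`. -/
def IsTest.l2 (h : IsTest φ) : L2Space d := (h.memLp 2).toLp φ

theorem IsTest.l2_ae (h : IsTest φ) : h.l2 =ᵐ[volume] φ := (h.memLp 2).coeFn_toLp

theorem IsTest.integral_mul (h : IsTest φ) (f : L2Space d) : ∫ x, f x * φ x = inner ℝ f h.l2 := by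
  rw [L2.inner_def]
  refine integral_congr_ae ?_
  filter_upwards [h.l2_ae] with x hx
  rw [hx]
  simp [mul_comm]

theorem dense_test : Dense {f : L2Space d | ∃ φ, ∃ h : IsTest φ, f = h.l2} := by
  refine (Lp.dense_hasCompactSupport_contDiff (F := ℝ) (μ := (volume : Measure (Space d))) (p := 2)
    ENNReal.ofNat_ne_top).mono ?_
  rintro f ⟨g, hg, hc, hs⟩
  have ht : IsTest g := ⟨hs, hc⟩
  exact ⟨g, ht, Lp.ext (hg.trans ht.l2_ae.symm)⟩

theorem smear_l2 (hα : IsTest α) (h : IsTest φ) : smear hα.integrable h.l2 = (hα.conv h).l2 := by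
  refine Lp.ext ?_
  filter_upwards [smear_ae hα.integrable hα.continuous.measurable h.l2, (hα.conv h).l2_ae] with x h1 h2
  rw [h1, h2, conv_apply, conv_apply]
  refine integral_congr_ae ?_
  filter_upwards [(Measure.measurePreserving_sub_left volume x).quasiMeasurePreserving.ae h.l2_ae] with z hz
  rw [hz]

/-- For a test function `f` this is integration by parts applied to the convolution of `α` with `f`.
Both operators are bounded, so the inequality passes to all of L² by density. -/
theorem inner_smear_divGrad_nonpos (hα : IsTest α) {A : Matrix (Fin d) (Fin d) ℝ} (hA : A.PosSemidef)
    (f : L2Space d) : inner ℝ (smear hα.integrable f) (smear (hα.divGrad A).integrable f) ≤ 0 := by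
  have hc : IsClosed {f : L2Space d |
      inner ℝ (smear hα.integrable f) (smear (hα.divGrad A).integrable f) ≤ 0} :=
    isClosed_le (by fun_prop) continuous_const
  refine hc.closure_subset_iff.2 ?_ (dense_test f)
  rintro _ ⟨φ, h, rfl⟩
  rw [mem_ofPred_eq, smear_l2 hα h, smear_l2 (hα.divGrad A) h, ← IsTest.integral_mul]
  refine le_trans (le_of_eq (integral_congr_ae ?_)) (integral_mul_divGrad_nonpos (hα.conv h) hA)
  filter_upwards [(hα.conv h).l2_ae] with x hx
  rw [hx, divGrad_conv hα h]

/-- A function that is weakly zero against all test functions vanishes. -/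
theorem ae_eq_zero_of_inner_test {S : Type*} [MeasurableSpace S] {ν : Measure S} {F : S → L2Space d}
    (h : ∀ φ, ∀ hφ : IsTest φ, ∀ᵐ t ∂ν, inner ℝ (F t) hφ.l2 = 0) : ∀ᵐ t ∂ν, F t = 0 := by
  refine ae_eq_zero_of_forall_inner (𝕜 := ℝ) fun c => ?_
  -- The exceptional set of times depends on the test function; an approximating sequence involves
  -- only countably many.
  obtain ⟨u, hu, huc⟩ := mem_closure_iff_seq_limit.1 (dense_test c)
  choose φ hφ he using hu
  filter_upwards [ae_all_iff.2 fun n => h (φ n) (hφ n)] with t ht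
  have h1 : Tendsto (fun n => inner ℝ (F t) (u n)) atTop (𝓝 (inner ℝ (F t) c)) :=
    tendsto_const_nhds.inner huc
  have h2 : (fun n => inner ℝ (F t) (u n)) = fun _ => 0 := funext fun n => by rw [he, ht]
  rw [h2] at h1
  rw [real_inner_comm]
  exact (tendsto_nhds_unique h1 tendsto_const_nhds)

theorem intervalIntegrable_of_memLp_top {E : Type*} [NormedAddCommGroup E] {T : ℝ} (hT : 0 ≤ T) {u : ℝ → E}
    (hu : MemLp u ⊤ (volume.restrict (Ioo 0 T))) : IntervalIntegrable u volume 0 T := by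
  rw [intervalIntegrable_iff_integrableOn_Ioo_of_le hT]
  exact hu.integrable le_top

variable {A : Matrix (Fin d) (Fin d) ℝ} {T : ℝ} {u₀ : L2Space d} {u : ℝ → L2Space d}

/-- The mollification of a weak solution is a strong solution. -/
theorem IsDiffusionSolution.smear_eq (hT : 0 ≤ T) (hu : IsDiffusionSolution A T u₀ u) (hα : IsTest α)
    (he : ∀ z, α (-z) = α z) : ∀ᵐ t ∂volume.restrict (Ioo 0 T), smear hα.integrable (u t) =
      smear hα.integrable u₀ + ∫ s in (0 : ℝ)..t, smear (hα.divGrad A.transpose).integrable (u s) := by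
  set L := smear (hα.divGrad A.transpose).integrable with hL
  have hi : IntervalIntegrable (fun s => L (u s)) volume 0 T :=
    intervalIntegrable_of_memLp_top hT (L.comp_memLp' hu.1)
  have := ae_eq_zero_of_inner_test (ν := volume.restrict (Ioo 0 T)) (F := fun t => smear hα.integrable (u t) -
    (smear hα.integrable u₀ + ∫ s in (0 : ℝ)..t, L (u s))) fun φ hφ => ?_
  · filter_upwards [this] with t ht
    exact sub_eq_zero.1 ht
  -- The weak formulation is tested with the convolution of `α` and `φ`. Both convolutions are then
  -- transferred to `u`, where the differential operator has become the bounded operator `L`.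
  filter_upwards [hu.2 _ (hα.conv hφ).smooth (hα.conv hφ).compact, ae_restrict_mem measurableSet_Ioo] with t ht htI
  have hit : IntervalIntegrable (fun s => L (u s)) volume 0 t := hi.mono_set (by
    rw [uIcc_of_le hT, uIcc_of_le htI.1.le]; exact Icc_subset_Icc_right htI.2.le)
  rw [divGrad_conv hα hφ] at ht
  simp only [(hα.conv hφ).integral_mul, ((hα.divGrad A.transpose).conv hφ).integral_mul, ← smear_l2 hα hφ,
    ← smear_l2 (hα.divGrad A.transpose) hφ, ← smear_symm hα.integrable he,
    ← smear_symm (hα.divGrad A.transpose).integrable (divGrad_neg hα he A.transpose)] at ht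
  rw [inner_sub_left, inner_add_left, ht]
  have h3 : inner ℝ (∫ s in (0 : ℝ)..t, L (u s)) hφ.l2 = ∫ s in (0 : ℝ)..t, inner ℝ (L (u s)) hφ.l2 := by
    have := (innerSL ℝ hφ.l2).intervalIntegral_comp_comm hit
    simp only [innerSL_apply_apply] at this
    rw [real_inner_comm, ← this]
    simp only [real_inner_comm]
  rw [h3, sub_self]

/-- The mollified solution is a primitive with dissipative velocity, so the stability estimate
applies with error zero. The velocity pairing involves two mollifications of the same function,
which is the situation of `inner_smear_divGrad_nonpos`. -/
theorem IsDiffusionSolution.norm_smear_le (hT : 0 ≤ T) (hA : A.PosSemidef) (hu : IsDiffusionSolution A T u₀ u)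
    (hα : IsTest α) (he : ∀ z, α (-z) = α z) :
    ∀ᵐ t ∂volume.restrict (Ioo 0 T), ‖smear hα.integrable (u t)‖ ≤ ‖smear hα.integrable u₀‖ := by
  have hAt : A.transpose.PosSemidef := hA.transpose
  set L := smear (hα.divGrad A.transpose).integrable with hL
  have hi : IntervalIntegrable (fun s => L (u s)) volume 0 T :=
    intervalIntegrable_of_memLp_top hT (L.comp_memLp' hu.1)
  have hs := hu.smear_eq hT hα he
  have := norm_le_of_dissipative hT le_rfl (x := fun t => smear hα.integrable u₀ + ∫ s in (0 : ℝ)..t, L (u s)) hi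
    (fun s _ => by simp) (by
      filter_upwards [ae_Icc_of_ae_restrict_Ioo hs] with s h1 hI
      rw [← h1 hI, zero_mul]
      exact inner_smear_divGrad_nonpos hα hAt (u s))
  filter_upwards [hs, ae_restrict_mem measurableSet_Ioo] with t h1 h2
  rw [h1]
  simpa using this t (Ioo_subset_Icc_self h2)

/-- A sequence of smooth even approximate identities. -/
theorem exists_mollifier (d : ℕ) : ∃ α : ℕ → Space d → ℝ, ∃ h : ∀ n, IsTest (α n),
    (∀ n z, α n (-z) = α n z) ∧ (∀ n z, 0 ≤ α n z) ∧ (∀ n, ∫ z, α n z = 1) ∧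
    ∀ f, Tendsto (fun n => smear (h n).integrable f) atTop (𝓝 f) := by
  let b : ℕ → ContDiffBump (0 : Space d) := fun n => ⟨1 / (n + 1 : ℝ) / 2, 1 / (n + 1 : ℝ), by positivity,
    half_lt_self (by positivity)⟩
  have hb : ∀ n, IsTest ((b n).normed volume) := fun n => ⟨(b n).contDiff_normed, (b n).hasCompactSupport_normed⟩
  refine ⟨fun n => (b n).normed volume, hb, fun n z => (b n).normed_neg z, fun n z => (b n).nonneg_normed z,
    fun n => (b n).integral_normed, fun f => ?_⟩
  rw [Metric.tendsto_atTop]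
  intro δ hδ
  -- Strong continuity of translations in L²; the mollifiers concentrate at the origin.
  have hc : Tendsto (fun z : Space d => transL ℝ volume z f) (𝓝 0) (𝓝 f) := by
    have h1 := Filter.Tendsto.compMeasurePreservingLp (p := 2) (ν := (volume : Measure (Space d)))
      (f := fun _ : Space d => f) (g := fun z : Space d => (⟨fun x => x - z, by fun_prop⟩ : C(Space d, Space d)))
      (l := 𝓝 0) (f₀ := f) (g₀ := ⟨fun x => x - 0, by fun_prop⟩) tendsto_const_nhds
      ((ContinuousMap.continuous_of_continuous_uncurry _ (continuous_snd.sub continuous_fst)).tendsto 0)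
      (fun z => measurePreserving_sub_right volume z) (measurePreserving_sub_right volume 0) ENNReal.ofNat_ne_top
    have h2 : transL ℝ volume (0 : Space d) f = f := by
      refine Lp.ext ?_
      filter_upwards [transL_ae (0 : Space d) f] with x hx
      rw [hx, sub_zero]
    have h3 : Tendsto (fun z : Space d => transL ℝ volume z f) (𝓝 0) (𝓝 (transL ℝ volume (0 : Space d) f)) := h1
    rwa [h2] at h3
  obtain ⟨r, hr, hball⟩ := Metric.tendsto_nhds_nhds.1 hc (δ / 2) (half_pos hδ)
  obtain ⟨N, hN⟩ := exists_nat_one_div_lt hr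
  refine ⟨N, fun n hn => ?_⟩
  rw [dist_eq_norm]
  refine (smear_sub_norm_le _ (fun z => (b n).nonneg_normed z) (b n).integral_normed f fun z hz => ?_).trans_lt
    (half_lt_self hδ)
  have hz' : z ∈ Function.support ((b n).normed volume) := hz
  rw [ContDiffBump.support_normed_eq] at hz'
  have := hball (lt_of_lt_of_le hz' ((Nat.one_div_le_one_div hn).trans hN.le))
  rw [dist_eq_norm] at this
  exact this.le

/-- Contraction property of weak solutions. -/
theorem IsDiffusionSolution.norm_le (hT : 0 ≤ T) (hA : A.PosSemidef) (hu : IsDiffusionSolution A T u₀ u) :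
    ∀ᵐ t ∂volume.restrict (Ioo 0 T), ‖u t‖ ≤ ‖u₀‖ := by
  obtain ⟨α, h, he, h0, h1, hlim⟩ := exists_mollifier d
  filter_upwards [ae_all_iff.2 fun n => hu.norm_smear_le hT hA (h n) (he n)] with t ht
  refine le_of_tendsto (hlim (u t)).norm (Eventually.of_forall fun n => (ht n).trans ?_)
  exact smear_norm_le _ (h0 n) (h1 n) u₀

end NonlocalHomogenization

/-! ### Smooth flows are weak solutions -/

namespace NonlocalHomogenization

variable {d : ℕ} {φ : Space d → ℝ}

/-- A first order Taylor bound for translations identifies the weak gradient. -/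
theorem inner_eq_neg_inner_partialD {p : L2Space d} {q : Fin d → L2Space d} {C : ℝ}
    (h : ∀ z : Space d, ‖transL ℝ volume z p - p + ∑ i, z i • q i‖ ≤ C * ‖z‖ ^ 2) (hφ : IsTest φ) (j : Fin d) :
    inner ℝ (q j) hφ.l2 = -inner ℝ p (hφ.partialD j).l2 := by
  set e : Space d := EuclideanSpace.single j 1 with he
  have hp : LocallyIntegrable p volume := (Lp.memLp p).locallyIntegrable one_le_two
  -- The pairing of the translated `p` with `φ` is differentiated along a coordinate axis in two
  -- ways: here by putting the derivative on `φ` through the convolution, below from the Taylor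
  -- bound. Uniqueness of the derivative gives the claim.
  have h1 : HasDerivAt (fun r : ℝ => conv (fun x => φ (-x)) p (-(r • e))) (inner ℝ p (hφ.partialD j).l2) 0 := by
    obtain ⟨h2, h3⟩ := hasFDerivAt_conv hφ.comp_neg hp (-((0 : ℝ) • e)) (-e)
    have h4 : HasDerivAt (fun r : ℝ => -(r • e)) (-e) 0 := by
      have := ((hasDerivAt_id (0 : ℝ)).smul_const e).neg
      rw [one_smul] at this
      exact this
    have h5 := h2.comp_hasDerivAt (0 : ℝ) h4
    rw [h3] at h5
    convert! h5 using 1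
    rw [← IsTest.integral_mul, ← integral_neg_eq_self]
    refine integral_congr_ae (ae_of_all _ fun z => ?_)
    have := partialD_comp_neg φ j z
    simp only [zero_smul, neg_zero, zero_sub, map_neg]
    rw [show fderiv ℝ (fun x => φ (-x)) z e = _ from this]
    ring
  have hF : ∀ z : Space d, inner ℝ (transL ℝ volume z p) hφ.l2 = conv (fun x => φ (-x)) p (-z) := fun z => by
    rw [← IsTest.integral_mul, conv_apply, ← integral_neg_eq_self]
    refine integral_congr_ae ?_
    filter_upwards [(Measure.measurePreserving_neg (volume : Measure (Space d))).quasiMeasurePreserving.ae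
      (transL_ae z p)] with x hx
    rw [hx, mul_comm, neg_sub_comm, neg_sub_left]
  have h2 : HasDerivAt (fun r : ℝ => conv (fun x => φ (-x)) p (-(r • e))) (-inner ℝ (q j) hφ.l2) 0 := by
    rw [hasDerivAt_iff_isLittleO_nhds_zero]
    refine Asymptotics.IsBigO.trans_isLittleO (Asymptotics.IsBigO.of_bound (C * ‖hφ.l2‖)
      (Eventually.of_forall fun r => ?_)) (Asymptotics.isLittleO_pow_id one_lt_two)
    have h3 := h (r • e)
    have h4 : ∑ i, (r • e) i • q i = r • q j := by
      rw [Finset.sum_eq_single j]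
      · simp [he]
      · intro i _ hij; simp [he, hij]
      · simp
    have h5 : ‖r • e‖ = |r| := by rw [norm_smul, he, PiLp.norm_single]; simp
    rw [h4, h5] at h3
    have h6 : transL ℝ volume (0 : Space d) p = p := by
      refine Lp.ext ?_
      filter_upwards [transL_ae (0 : Space d) p] with x hx
      rw [hx, sub_zero]
    rw [← hF, ← hF, zero_add, zero_smul, h6]
    have h7 : inner ℝ (transL ℝ volume (r • e) p) hφ.l2 - inner ℝ p hφ.l2 - r • -inner ℝ (q j) hφ.l2 =
        inner ℝ (transL ℝ volume (r • e) p - p + r • q j) hφ.l2 := by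
      rw [inner_add_left, inner_sub_left, real_inner_smul_left, smul_eq_mul]; ring
    rw [h7]
    refine (norm_inner_le_norm _ _).trans ((mul_le_mul_of_nonneg_right h3 (norm_nonneg _)).trans_eq ?_)
    rw [norm_pow, Real.norm_eq_abs]; ring
  rw [h1.unique h2, neg_neg]

variable {A θ : Matrix (Fin d) (Fin d) ℝ} {T C : ℝ} {u₀ w₀ : L2Space d} {u w v : ℝ → L2Space d}
  {v1 : Fin d → ℝ → L2Space d} {v2 : Fin d → Fin d → ℝ → L2Space d}

/-- The weak formulation in terms of inner products in `L²`. -/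
theorem isDiffusionSolution_iff : IsDiffusionSolution A T u₀ u ↔ MemLp u ⊤ (volume.restrict (Ioo 0 T)) ∧
    ∀ φ : Space d → ℝ, ∀ hφ : IsTest φ, ∀ᵐ t ∂volume.restrict (Ioo 0 T), inner ℝ (u t) hφ.l2 =
      inner ℝ u₀ hφ.l2 + ∫ s in (0 : ℝ)..t, inner ℝ (u s) (hφ.divGrad A.transpose).l2 := by
  refine and_congr_right fun _ => ⟨fun h φ hφ => ?_, fun h φ hs hc => ?_⟩
  · simpa only [hφ.integral_mul, (hφ.divGrad A.transpose).integral_mul] using h φ hφ.smooth hφ.compact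
  · have hφ : IsTest φ := ⟨hs, hc⟩
    simpa only [hφ.integral_mul, (hφ.divGrad A.transpose).integral_mul] using h φ hφ

theorem intervalIntegrable_inner_const (hT : 0 ≤ T) (hu : MemLp u ⊤ (volume.restrict (Ioo 0 T))) (g : L2Space d) {t : ℝ}
    (ht : t ∈ Icc 0 T) : IntervalIntegrable (fun s => inner ℝ (u s) g) volume 0 t := by
  have h1 : IntervalIntegrable (fun s => inner ℝ (u s) g) volume 0 T := by
    refine intervalIntegrable_of_memLp_top hT ?_
    have := (innerSL ℝ g).comp_memLp' hu
    refine this.congr_norm ?_ (ae_of_all _ fun s => ?_)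
    · exact (hu.1.inner aestronglyMeasurable_const)
    · simp [real_inner_comm]
  exact h1.mono_set (by rw [uIcc_of_le hT, uIcc_of_le ht.1]; exact Icc_subset_Icc_right ht.2)

theorem IsDiffusionSolution.sub (hT : 0 ≤ T) (hu : IsDiffusionSolution A T u₀ u)
    (hw : IsDiffusionSolution A T w₀ w) : IsDiffusionSolution A T (u₀ - w₀) fun t => u t - w t := by
  rw [isDiffusionSolution_iff] at hu hw ⊢
  refine ⟨hu.1.sub hw.1, fun φ hφ => ?_⟩
  filter_upwards [hu.2 φ hφ, hw.2 φ hφ, ae_restrict_mem measurableSet_Ioo] with t h1 h2 ht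
  simp only [inner_sub_left]
  have hI := Ioo_subset_Icc_self ht
  rw [intervalIntegral.integral_sub (intervalIntegrable_inner_const hT hu.1 _ hI) (intervalIntegrable_inner_const hT hw.1 _ hI),
    h1, h2]
  ring

theorem inner_divGrad_l2 {φ : Space d → ℝ} (hφ : IsTest φ) (p : L2Space d) :
    inner ℝ p (hφ.divGrad A).l2 = ∑ i, ∑ j, A i j * inner ℝ p ((hφ.partialD j).partialD i).l2 := by
  have e : (hφ.divGrad A).l2 = ∑ i, ∑ j, A i j • ((hφ.partialD j).partialD i).l2 := by
    refine Lp.ext ?_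
    have h1 : ∀ i, (∑ j, A i j • ((hφ.partialD j).partialD i).l2 : L2Space d) =ᵐ[volume]
        fun x => ∑ j, A i j * partialD i (partialD j φ) x := fun i => by
      filter_upwards [Lp.coeFn_finsetSum Finset.univ fun j => A i j • ((hφ.partialD j).partialD i).l2,
        ae_all_iff.2 fun j => Lp.coeFn_smul (A i j) ((hφ.partialD j).partialD i).l2,
        ae_all_iff.2 fun j => ((hφ.partialD j).partialD i).l2_ae] with x h1 h2 h3
      rw [h1, Finset.sum_apply]
      exact Finset.sum_congr rfl fun j _ => by rw [h2, Pi.smul_apply, h3, smul_eq_mul]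
    filter_upwards [Lp.coeFn_finsetSum Finset.univ fun i => ∑ j, A i j • ((hφ.partialD j).partialD i).l2,
      ae_all_iff.2 h1, (hφ.divGrad A).l2_ae] with x h2 h3 h4
    rw [h4, h2, Finset.sum_apply, divGrad_eq hφ]
    exact Finset.sum_congr rfl fun i _ => (h3 i).symm
  rw [e]
  simp only [inner_sum, inner_smul_right]

namespace SmoothFlow

/-- The weak gradient is identified twice, for the gradient and for the flow itself. In the second
case the quadratic part of the expansion is absorbed into the error, since the Hessian is bounded.
-/
theorem inner_hess (hv : SmoothFlow θ T C v v1 v2) (hφ : IsTest φ) {t : ℝ} (ht : t ∈ Icc 0 T) (i j : Fin d) :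
    inner ℝ (v2 i j t) hφ.l2 = inner ℝ (v t) ((hφ.partialD i).partialD j).l2 := by
  have hC := hv.nonneg
  have h1 : ∀ z : Space d, ‖transL ℝ volume z (v1 j t) - v1 j t + ∑ i, z i • v2 i j t‖ ≤ C * ‖z‖ ^ 2 := fun z => by
    refine (hv.taylor_one j t ht z).trans ?_
    rw [sq]
    gcongr
    exact min_le_right _ _
  have h2 : ∀ z : Space d, ‖transL ℝ volume z (v t) - v t + ∑ i, z i • v1 i t‖ ≤
      (C + ∑ _i : Fin d, ∑ _j : Fin d, 1 / 2 * C) * ‖z‖ ^ 2 := fun z => by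
    have h3 := hv.taylor_two t ht z
    have h4 : ‖∑ i, ∑ j, (1 / 2 * z i * z j) • v2 i j t‖ ≤ (∑ _i : Fin d, ∑ _j : Fin d, 1 / 2 * C) * ‖z‖ ^ 2 := by
      simp only [Finset.sum_mul]
      refine (norm_sum_le _ _).trans (Finset.sum_le_sum fun i _ => (norm_sum_le _ _).trans
        (Finset.sum_le_sum fun j _ => ?_))
      rw [norm_smul, norm_mul, norm_mul]
      have h5 : ‖z i‖ ≤ ‖z‖ := PiLp.norm_apply_le z i
      have h6 : ‖z j‖ ≤ ‖z‖ := PiLp.norm_apply_le z j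
      have h7 := hv.norm_hess i j t ht
      calc ‖(1 / 2 : ℝ)‖ * ‖z i‖ * ‖z j‖ * ‖v2 i j t‖ ≤ 1 / 2 * ‖z‖ * ‖z‖ * C := by
            gcongr
            norm_num
        _ = _ := by ring
    have h8 : C * (‖z‖ ^ 2 * min 1 ‖z‖) ≤ C * ‖z‖ ^ 2 := by
      gcongr
      exact mul_le_of_le_one_right (by positivity) (min_le_left _ _)
    have h9 := norm_add_le (transL ℝ volume z (v t) - v t + ∑ i, z i • v1 i t -
      ∑ i, ∑ j, (1 / 2 * z i * z j) • v2 i j t) (∑ i, ∑ j, (1 / 2 * z i * z j) • v2 i j t)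
    rw [sub_add_cancel] at h9
    rw [add_mul]
    linarith
  rw [inner_eq_neg_inner_partialD h1 hφ i, inner_eq_neg_inner_partialD h2 (hφ.partialD i) j, neg_neg]

/-- Smooth flows are weak solutions. -/
theorem isDiffusionSolution (hT : 0 ≤ T) (hv : SmoothFlow θ T C v v1 v2) (hs : ∀ i j, v2 i j = v2 j i)
    (hA : ∀ i j, A i j = 1 / 2 * (θ i j + θ j i)) : IsDiffusionSolution A T (v 0) v := by
  have hc := continuousOn_of_primitive hT hv.flow.1 hv.flow.2
  rw [isDiffusionSolution_iff]
  constructor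
  · obtain ⟨X, hX⟩ := isCompact_Icc.exists_bound_of_continuousOn hc
    refine memLp_top_of_bound ((hc.mono Ioo_subset_Icc_self).aestronglyMeasurable measurableSet_Ioo) X ?_
    filter_upwards [ae_restrict_mem measurableSet_Ioo] with t ht
    exact hX t (Ioo_subset_Icc_self ht)
  intro φ hφ
  filter_upwards [ae_restrict_mem measurableSet_Ioo] with t ht
  have htI := Ioo_subset_Icc_self ht
  have hi := hv.flow.integrable_of_mem htI
  have h1 := (innerSL ℝ hφ.l2).intervalIntegral_comp_comm hi
  simp only [innerSL_apply_apply] at h1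
  rw [hv.flow.2 t htI, inner_add_left, real_inner_comm _ (∫ s in (0 : ℝ)..t, _), ← h1]
  congr 1
  refine intervalIntegral.integral_congr fun s hs' => ?_
  rw [uIcc_of_le htI.1] at hs'
  have hsI : s ∈ Icc 0 T := ⟨hs'.1, hs'.2.trans htI.2⟩
  beta_reduce
  rw [inner_divGrad_l2 hφ]
  -- By symmetry of the Hessian only the symmetric part of `θ` matters, so a flow driven by `θ`
  -- solves the equation with the symmetrised matrix.
  have e : ∑ i, ∑ j, θ i j * inner ℝ (v2 i j s) hφ.l2 = ∑ i, ∑ j, θ j i * inner ℝ (v2 i j s) hφ.l2 := by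
    rw [Finset.sum_comm]
    exact Finset.sum_congr rfl fun i _ => Finset.sum_congr rfl fun j _ => by rw [hs j i]
  have e1 : inner ℝ hφ.l2 (∑ i, ∑ j, θ i j • v2 i j s) = ∑ i, ∑ j, θ i j * inner ℝ (v2 i j s) hφ.l2 := by
    simp only [inner_sum, inner_smul_right, real_inner_comm]
  have e2 : ∑ i, ∑ j, A.transpose i j * inner ℝ (v s) ((hφ.partialD j).partialD i).l2 =
      1 / 2 * ∑ i, ∑ j, θ i j * inner ℝ (v2 i j s) hφ.l2 + 1 / 2 * ∑ i, ∑ j, θ j i * inner ℝ (v2 i j s) hφ.l2 := by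
    simp only [Finset.mul_sum, ← Finset.sum_add_distrib]
    refine Finset.sum_congr rfl fun i _ => Finset.sum_congr rfl fun j _ => ?_
    rw [← hv.inner_hess hφ hsI, Matrix.transpose_apply, hA, hs j i]
    ring
  rw [e1, e2, ← e]
  ring

end SmoothFlow

end NonlocalHomogenization

/-! ### Solvability of the effective problem and convergence -/

namespace NonlocalHomogenization

variable {d : ℕ} {A θ : Matrix (Fin d) (Fin d) ℝ} {T : ℝ} {u₀ : L2Space d} {u : ℝ → L2Space d}

/-- Uniform limits of weak solutions are weak solutions. -/
theorem IsDiffusionSolution.of_tendsto (hT : 0 ≤ T) {w₀ : ℕ → L2Space d} {w : ℕ → ℝ → L2Space d} {c : ℕ → ℝ}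
    (hw : ∀ n, IsDiffusionSolution A T (w₀ n) (w n)) (h0 : Tendsto w₀ atTop (𝓝 u₀)) (hc : Tendsto c atTop (𝓝 0))
    (h : ∀ n, ∀ᵐ t ∂volume.restrict (Ioo 0 T), ‖w n t - u t‖ ≤ c n) : IsDiffusionSolution A T u₀ u := by
  have hw' := fun n => isDiffusionSolution_iff.1 (hw n)
  have hlim : ∀ᵐ t ∂volume.restrict (Ioo 0 T), Tendsto (fun n => w n t) atTop (𝓝 (u t)) := by
    filter_upwards [ae_all_iff.2 h] with t ht
    exact tendsto_iff_norm_sub_tendsto_zero.2 (squeeze_zero (fun _ => norm_nonneg _) ht hc)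
  have hum : AEStronglyMeasurable u (volume.restrict (Ioo 0 T)) :=
    aestronglyMeasurable_of_tendsto_ae atTop (fun n => (hw' n).1.1) hlim
  have hu : MemLp u ⊤ (volume.restrict (Ioo 0 T)) := by
    have h1 : MemLp (fun t => w 0 t - u t) ⊤ (volume.restrict (Ioo 0 T)) :=
      memLp_top_of_bound ((hw' 0).1.1.sub hum) (c 0) (h 0)
    have := (hw' 0).1.sub h1
    refine this.ae_eq (ae_of_all _ fun t => ?_)
    simp
  rw [isDiffusionSolution_iff]
  refine ⟨hu, fun φ hφ => ?_⟩
  set ψ := (hφ.divGrad A.transpose).l2 with hψ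
  filter_upwards [hlim, ae_all_iff.2 fun n => (hw' n).2 φ hφ, ae_restrict_mem measurableSet_Ioo] with t h1 h2 ht
  have htI := Ioo_subset_Icc_self ht
  -- All derivatives sit on the fixed test function, so uniform closeness in L² suffices to pass to
  -- the limit.
  have h3 : Tendsto (fun n => ∫ s in (0 : ℝ)..t, inner ℝ (w n s) ψ) atTop
      (𝓝 (∫ s in (0 : ℝ)..t, inner ℝ (u s) ψ)) := by
    refine tendsto_iff_norm_sub_tendsto_zero.2 (squeeze_zero (fun _ => norm_nonneg _) (fun n => ?_)
      (g := fun n => c n * ‖ψ‖ * |t - 0|) (by simpa using (hc.mul_const ‖ψ‖).mul_const |t - 0|))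
    rw [← intervalIntegral.integral_sub (intervalIntegrable_inner_const hT (hw' n).1 _ htI)
      (intervalIntegrable_inner_const hT hu _ htI)]
    refine intervalIntegral.norm_integral_le_of_norm_le_const_ae ?_
    filter_upwards [ae_Icc_of_ae_restrict_Ioo (h n)] with s hs hs'
    rw [uIoc_of_le htI.1] at hs'
    rw [← inner_sub_left]
    exact (norm_inner_le_norm _ _).trans (mul_le_mul_of_nonneg_right (hs ⟨hs'.1.le, hs'.2.trans htI.2⟩)
      (norm_nonneg _))
  have h4 : Tendsto (fun n => inner ℝ (w n t) hφ.l2) atTop (𝓝 (inner ℝ (u t) hφ.l2)) := h1.inner tendsto_const_nhds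
  have h5 : Tendsto (fun n => inner ℝ (w₀ n) hφ.l2) atTop (𝓝 (inner ℝ u₀ hφ.l2)) := h0.inner tendsto_const_nhds
  exact tendsto_nhds_unique (h4.congr h2) (h5.add h3)

/-- Solvability of the effective Cauchy problem. -/
theorem exists_isDiffusionSolution (hT : 0 < T) (hA : A.PosSemidef) (u₀ : L2Space d) :
    ∃ u, IsDiffusionSolution A T u₀ u := by
  have hAs : ∀ i j, A i j = 1 / 2 * (A i j + A j i) := fun i j => by
    have := hA.isHermitian.apply i j
    simp only [star_trivial] at this
    rw [this]; ring
  choose C v v1 v2 hv hs h0 using fun n : ℕ => exists_smoothFlow_near A hT u₀ (Nat.one_div_pos_of_nat (α := ℝ) (n := n))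
  have hw := fun n => (hv n).isDiffusionSolution hT.le (hs n) hAs
  have hc : Tendsto (fun n => ‖v n 0 - u₀‖) atTop (𝓝 0) :=
    squeeze_zero (fun _ => norm_nonneg _) (fun n => by rw [norm_sub_rev]; exact (h0 n).le)
      tendsto_one_div_add_atTop_nhds_zero_nat
  have hl : Tendsto (fun n => v n 0) atTop (𝓝 u₀) := tendsto_iff_norm_sub_tendsto_zero.2 hc
  -- Contraction applied to differences: convergence of the initial data makes the approximating
  -- flows Cauchy uniformly in time.
  have hd : ∀ᵐ t ∂volume.restrict (Ioo 0 T), ∀ n m, ‖v n t - v m t‖ ≤ ‖v n 0 - v m 0‖ :=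
    ae_all_iff.2 fun n => ae_all_iff.2 fun m => ((hw n).sub hT.le (hw m)).norm_le hT.le hA
  refine ⟨fun t => limUnder atTop fun n => v n t, IsDiffusionSolution.of_tendsto hT.le hw hl hc fun n => ?_⟩
  filter_upwards [hd] with t ht
  have hC : CauchySeq fun n => v n t := by
    rw [Metric.cauchySeq_iff]
    intro ε hε
    obtain ⟨N, hN⟩ := Metric.cauchySeq_iff.1 hl.cauchySeq ε hε
    refine ⟨N, fun m hm n hn => ?_⟩
    have := hN m hm n hn
    rw [dist_eq_norm] at this ⊢
    exact (ht m n).trans_lt this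
  exact le_of_tendsto_of_tendsto (hC.tendsto_limUnder.const_sub (v n t)).norm (hl.const_sub (v n 0)).norm
    (Eventually.of_forall fun m => ht n m)

/-- Homogenization for a Borel measurable kernel. -/
theorem tendsto_eLpNorm_sub {a : Space d → ℝ} {μ : Space d → Space d → ℝ → ℝ} (h : Conditions a μ)
    (hm : Measurable a) {χ : Fin d → ℝ → L2Torus d} (hχ : IsCorrector a μ χ) (hT : 0 < T)
    {uε : ℝ → ℝ → L2Space d} (huε : ∀ ε, 0 < ε → IsScaledSolution a μ ε T u₀ (uε ε))
    (hu : IsDiffusionSolution (effMatrix a μ χ) T u₀ u) :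
    Tendsto (fun ε => eLpNorm (fun t => uε ε t - u t) ⊤ (volume.restrict (Ioo 0 T))) (𝓝[>] 0) (𝓝 0) := by
  have hA := (effMatrix_posDef h hm hχ).posSemidef
  rw [ENNReal.tendsto_nhds_zero]
  intro e he
  obtain ⟨δ, hδ0, hδ⟩ := ENNReal.lt_iff_exists_nnreal_btwn.1 he
  have hδ0' : (0 : ℝ) < δ := by exact_mod_cast hδ0
  -- With initial error below `δ/3`, the distance from the rescaled solution to `v` is below `2δ/3`
  -- once `ρ ε < δ/3`, and the distance from the effective solution to `v` is below `δ/3` by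
  -- contraction. The flow is driven by the unsymmetrised matrix, as the second cell problem
  -- demands.
  obtain ⟨C, v, v1, v2, hv, hs, h0⟩ := exists_smoothFlow_near (preEffMatrix a μ χ) hT u₀
    (δ := δ / 3) (by positivity)
  obtain ⟨ρ, hρ, hbound⟩ := exists_ansatz_rate h hm hχ hT hv
  have hw : IsDiffusionSolution (effMatrix a μ χ) T (v 0) v := hv.isDiffusionSolution hT.le hs fun i j => rfl
  have hd := (hu.sub hT.le hw).norm_le hT.le hA
  filter_upwards [hρ.eventually (gt_mem_nhds (by positivity : (0 : ℝ) < δ / 3)), self_mem_nhdsWithin] with ε hε hε0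
  refine le_trans ?_ hδ.le
  rw [eLpNorm_exponent_top, ← ENNReal.ofReal_coe_nnreal]
  refine eLpNormEssSup_le_of_ae_bound ?_
  filter_upwards [hd, hbound ε hε0 u₀ (uε ε) (huε ε hε0)] with t h1 h2
  have h3 : ‖uε ε t - u t‖ ≤ ‖uε ε t - v t‖ + ‖u t - v t‖ := by
    rw [norm_sub_rev (u t)]; exact norm_sub_le_norm_sub_add_norm_sub _ _ _
  linarith

end NonlocalHomogenization

end

theorem theorem2 {d : ℕ}
    (a : NonlocalHomogenization.Space d → ℝ)
    (μ : NonlocalHomogenization.Space d → NonlocalHomogenization.Space d → ℝ → ℝ)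
    (h : NonlocalHomogenization.Conditions a μ) :
    (∃ χ, NonlocalHomogenization.IsCorrector a μ χ) ∧
    ∀ χ, NonlocalHomogenization.IsCorrector a μ χ →
      (NonlocalHomogenization.effMatrix a μ χ).PosDef ∧
      ∀ T : ℝ, 0 < T → ∀ u₀ : NonlocalHomogenization.L2Space d,
        (∀ ε : ℝ, 0 < ε → ∃ u, NonlocalHomogenization.IsScaledSolution a μ ε T u₀ u) ∧
        (∃ u, NonlocalHomogenization.IsDiffusionSolution
          (NonlocalHomogenization.effMatrix a μ χ) T u₀ u) ∧
        ∀ (uε : ℝ → ℝ → NonlocalHomogenization.L2Space d)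
          (u : ℝ → NonlocalHomogenization.L2Space d),
          (∀ ε : ℝ, 0 < ε → NonlocalHomogenization.IsScaledSolution a μ ε T u₀ (uε ε)) →
          NonlocalHomogenization.IsDiffusionSolution
            (NonlocalHomogenization.effMatrix a μ χ) T u₀ u →
          Tendsto (fun ε => eLpNorm (fun t => uε ε t - u t) ⊤ (volume.restrict (Ioo 0 T)))
            (𝓝[>] 0) (𝓝 0) := by
  -- The pointwise formulas for the operators need a Borel kernel. Every object in the statement
  -- sees the kernel only through integrals, so it may be changed on a null set.
  obtain ⟨b, hb, hab, hc⟩ := h.exists_measurable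
  refine ⟨?_, fun χ hχ => ?_⟩
  · obtain ⟨χ, hχ⟩ := NonlocalHomogenization.exists_corrector hc hb
    exact ⟨χ, (NonlocalHomogenization.isCorrector_congr hab χ).2 hχ⟩
  rw [NonlocalHomogenization.isCorrector_congr hab] at hχ
  rw [NonlocalHomogenization.effMatrix_congr hab]
  have hA := NonlocalHomogenization.effMatrix_posDef hc hb hχ
  refine ⟨hA, fun T hT u₀ => ⟨fun ε hε => ?_,
    NonlocalHomogenization.exists_isDiffusionSolution hT hA.posSemidef u₀, fun uε u huε hu => ?_⟩⟩
  · obtain ⟨u, hu⟩ := NonlocalHomogenization.exists_isScaledSolution hc hb hε hT u₀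
    exact ⟨u, (NonlocalHomogenization.isScaledSolution_congr hab hε.ne' u₀ u).2 hu⟩
  · exact NonlocalHomogenization.tendsto_eLpNorm_sub hc hb hχ hT (fun ε hε =>
      (NonlocalHomogenization.isScaledSolution_congr hab hε.ne' u₀ _).1 (huε ε hε)) hu
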